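/- Let $d\in\{2,3\}$ and let $\Omega\subset\mathbb R^d$ be a nonempty, bounded, convex, open set. Let $\mathcal T_h$ be a conforming triangulation of $\overline\Omega$ into finitely many closed $d$-simplices (so that $\Omega$ is a polygon or polyhedron). Assume that $\mathcal T_h$ is shape regular with parameter $\sigma>0$: every $T\in\mathcal T_h$ contains a ball of radius $\operatorname{diam}(T)/\sigma$. Let $\mathcal E_h^o$ be the set of interior edges ($d=2$) or faces ($d=3$), that is, those not contained in $\partial\Omega$, and let $h_e=|e|^{1/(d-1)}$. **The method.** Let $V_h\subset H_0^1(\Omega)$ be the space of continuous functions on $\overline\Omega$ that vanish on $\partial\Omega$ and are polynomials of degree at most $2$ on each $T\in\mathcal T_h$. On an interior edge or face $e=T^+\cap T^-$ put $\{\nabla v\}=\tfrac12(\nabla v|_{T^+}+\nabla v|_{T^-})$ and $[\nabla v]\cdot n_e=(\nabla v|_{T^+}-\nabla v|_{T^-})\cdot n_e$, with $n_e$ the unit normal pointing from $T^-$ to $T^+$; on a boundary edge or face put $\{\nabla v\}=\nabla v$. The discrete weak Laplacian of $v\in V_h$ is the piecewise constant function with $$\Delta_w v|_T=\frac1{|T|}\int_{\partial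 T}\{\nabla v\}\cdot n_T\,ds ,\qquad T\in\mathcal T_h ,$$ where $n_T$ is the outward unit normal of $T$. The operator $\mathsf A_h:V_h\to V_h'$ is given by $$\langle\mathsf A_h v,w\rangle=\sum_{T\in\mathcal T_h}\int_T\Delta_w v\,\Delta_w w\,dx+\frac14\sum_{e\in\mathcal E_h^o}h_e^{-1}\int_e([\nabla v]\cdot n_e)([\nabla w]\cdot n_e)\,ds .$$ **The decomposition.** Let $\Omega_1,\dots,\Omega_J$ be open sets with $\bigcup_j\Omega_j=\Omega$, each of them the interior of a union of elements of $\mathcal T_h$, such that every point of $\Omega$ belongs to at most $N_c$ of them. Let $0<\delta\le\operatorname{diam}(\Omega)$ (the overlap width), and let $\theta_1,\dots,\theta_J\in C^\infty(\overline\Omega)$ be nonnegative functions with $\theta_j=0$ on $\Omega\setminus\Omega_j$, $\sum_j\theta_j=1$ on $\overline\Omega$, $\|\nabla\theta_j\|_{L^\infty(\Omega)}\le M\delta^{-1}$ and $\|D^2\theta_j\|_{L^\infty(\Omega)}\le M\delta^{-2}$ (operator norms). **The preconditioner.** Let $V_j=\{v\in V_h: v=0\text{ on }\Omega\setminus\Omega_j\}$,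 let $\mathsf I_j:V_j\to V_h$ be the inclusion and $\mathsf I_j^\top:V_h'\to V_j'$ its transpose, and define $\mathsf A_j:V_j\to V_j'$ by the formula for $\mathsf A_h$ with the sums restricted to the $T\in\mathcal T_h$ with $T\subset\overline{\Omega_j}$ and to the $e\in\mathcal E_h^o$ with $e\subset\overline{\Omega_j}$. Put $$\mathsf B_h=\sum_{j=1}^J\mathsf I_j\mathsf A_j^{-1}\mathsf I_j^\top:V_h'\to V_h .$$ **Claim.** There is a constant $C>0$ that depends only on $d$, $\Omega$, $\sigma$, $M$ and $N_c$ (and not on the triangulation or its mesh size, on $J$, on the $\Omega_j$ and $\theta_j$, or on $\delta$) such that in this situation every $\mathsf A_j$ is bijective, so that $\mathsf B_h$ is well defined, and, whenever $V_h\neq\{0\}$, the operator $\mathsf B_h\mathsf A_h$ on $V_h$ has a smallest (real) eigenvalue $\lambda_{\min}>0$ and a largest (real) eigenvalue $\lambda_{\max}$, and $$\kappa(\mathsf B_h\mathsf A_h)=\frac{\lambda_{\max}(\mathsf B_h\mathsf A_h)}{\lambda_{\min}(\mathsf B_h\mathsf A_h)}\le C\,\delta^{-4}.$$ -/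

import Mathlib

open MeasureTheory
open scoped ContDiff

noncomputable section

namespace C0WG

/-- Euclidean `d`-space. -/
abbrev Pt (d : ℕ) : Type := EuclideanSpace ℝ (Fin d)

/-- The closed simplex spanned by a finite set of vertices. -/
def cell {d : ℕ} (s : Finset (Pt d)) : Set (Pt d) := convexHull ℝ (s : Set (Pt d))

/-- A (conforming) triangulation of `Ω`: a finite geometric simplicial complex, all of whose
simplices are faces of `d`-simplices, with underlying space the closure of `Ω`. -/
structure Triangulation {d : ℕ} (Ω : Set (Pt d)) where
  complex : Geometry.SimplicialComplex ℝ (Pt d)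
  finite : complex.faces.Finite
  pure : ∀ s ∈ complex.faces, ∃ T ∈ complex.faces, s ⊆ T ∧ T.card = d + 1
  space_eq : complex.space = closure Ω

/-- The outward unit normal of the simplex `T` on its codimension-one face `e`: the vector from
the barycenter of `T` to the barycenter of `e`, projected onto the orthogonal complement of the
direction of `e` and normalized. -/
def outwardNormal {d : ℕ} (T e : Finset (Pt d)) : Pt d :=
  let q : Pt d := (vectorSpan ℝ (e : Set (Pt d)))ᗮ.starProjection
    (e.centroid ℝ id - T.centroid ℝ id)
  ‖q‖⁻¹ • q

/-- The normal derivative at `x` in the direction `n` of the restriction of `v` to the closed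
simplex `T` (on the boundary of `T`: the trace of the gradient of `v|_T`, dotted with `n`). -/
def gradDot {d : ℕ} (v : Pt d → ℝ) (T : Finset (Pt d)) (x n : Pt d) : ℝ :=
  fderivWithin ℝ v (cell T) x n

/-- Polynomials of total degree at most two: constant plus linear plus quadratic part. -/
def EqQuadraticOn {d : ℕ} (v : Pt d → ℝ) (s : Set (Pt d)) : Prop :=
  ∃ (c : ℝ) (b : Pt d →L[ℝ] ℝ) (A : Pt d →L[ℝ] Pt d →L[ℝ] ℝ),
    ∀ x ∈ s, v x = c + b x + A x x

/-- Surface measure (`(d-1)`-dimensional Euclidean Hausdorff measure) restricted to a face. -/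
def surf {d : ℕ} (e : Finset (Pt d)) : Measure (Pt d) :=
  (Measure.euclideanHausdorffMeasure (d - 1)).restrict (cell e)

/-- The size `h_e = |e|^{1/(d-1)}` of a codimension-one face. -/
def faceSize {d : ℕ} (e : Finset (Pt d)) : ℝ :=
  (surf e).real Set.univ ^ (1 / ((d : ℝ) - 1))

namespace Triangulation

variable {d : ℕ} {Ω : Set (Pt d)} (𝒯 : Triangulation Ω)

open Classical in
/-- The elements (`d`-simplices), each given by its vertices. -/
def elements : Finset (Finset (Pt d)) := {T ∈ 𝒯.finite.toFinset | T.card = d + 1}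

open Classical in
/-- All codimension-one faces (edges if `d = 2`, triangles if `d = 3`). -/
def faces : Finset (Finset (Pt d)) := {e ∈ 𝒯.finite.toFinset | e.card = d}

open Classical in
/-- The interior faces: those that do not lie on the boundary of `Ω`. -/
def interiorFaces : Finset (Finset (Pt d)) := {e ∈ 𝒯.faces | ¬ cell e ⊆ frontier Ω}

open Classical in
/-- The elements that have `e` as a face (two for an interior face, one for a boundary face). -/
def elementsAt (e : Finset (Pt d)) : Finset (Finset (Pt d)) := {T ∈ 𝒯.elements | e ⊆ T}

open Classical in
/-- The codimension-one faces of the element `T`. -/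
def facesOf (T : Finset (Pt d)) : Finset (Finset (Pt d)) := {e ∈ 𝒯.faces | e ⊆ T}

/-- Shape regularity with parameter `σ`: every element contains a ball whose radius is at least
the diameter of the element divided by `σ`. -/
def IsShapeRegular (σ : ℝ) : Prop :=
  0 < σ ∧ ∀ T ∈ 𝒯.elements, ∃ c : Pt d, Metric.ball c (Metric.diam (cell T) / σ) ⊆ cell T

/-- The average `{∇v}·n` on the face `e`: the mean of the two one-sided traces on an interior
face, and the one trace on a boundary face. -/
def avgGradDot (v : Pt d → ℝ) (e : Finset (Pt d)) (x n : Pt d) : ℝ :=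
  ((𝒯.elementsAt e).card : ℝ)⁻¹ * ∑ T ∈ 𝒯.elementsAt e, gradDot v T x n

/-- The jump `[∇v]·n_e = (∇v⁺ - ∇v⁻)·n_e` on an interior face `e = T⁺ ∩ T⁻`. Since `n_e` points
from `T⁻` to `T⁺`, it is the outward normal of `T⁻` and minus that of `T⁺`; hence the formula,
which also shows that the jump does not depend on which element is called `T⁺`. -/
def normalJump (v : Pt d → ℝ) (e : Finset (Pt d)) (x : Pt d) : ℝ :=
  - ∑ T ∈ 𝒯.elementsAt e, gradDot v T x (outwardNormal T e)

/-- The lowest-order discrete weak Laplacian of `{v, v, {∇v}}` on the element `T`: the constant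
`|T|⁻¹ ∫_{∂T} {∇v}·n_T ds`. -/
def weakLaplacian (v : Pt d → ℝ) (T : Finset (Pt d)) : ℝ :=
  (volume.real (cell T))⁻¹ *
    ∑ e ∈ 𝒯.facesOf T, ∫ x, 𝒯.avgGradDot v e x (outwardNormal T e) ∂(surf e)

/-- The form `(Δ_w v, Δ_w w)_𝒮 + (1/4) ⟨h_e⁻¹ [∇v]·n_e, [∇w]·n_e⟩_ℱ` for a set `𝒮` of elements
and a set `ℱ` of interior faces. The weak Laplacians are constant on each element. -/
def form (𝒮 ℱ : Finset (Finset (Pt d))) (v w : Pt d → ℝ) : ℝ :=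
  ∑ T ∈ 𝒮, volume.real (cell T) * (𝒯.weakLaplacian v T * 𝒯.weakLaplacian w T) +
    1 / 4 * ∑ e ∈ ℱ, (faceSize e)⁻¹ * ∫ x, 𝒯.normalJump v e x * 𝒯.normalJump w e x ∂(surf e)

/-- The finite element space `V_h ⊂ H¹₀(Ω)`: continuous functions, quadratic on each
element, vanishing on the boundary of `Ω` (and extended by zero outside of `Ω`). -/
def Vh : Submodule ℝ (Pt d → ℝ) where
  carrier := {v | Continuous v ∧ (∀ x ∉ Ω, v x = 0) ∧ ∀ T ∈ 𝒯.elements, EqQuadraticOn v (cell T)}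
  zero_mem' := ⟨continuous_const, fun _ _ => rfl, fun _ _ => ⟨0, 0, 0, by simp⟩⟩
  add_mem' := by
    rintro v w ⟨hv, hv0, hv2⟩ ⟨hw, hw0, hw2⟩
    refine ⟨hv.add hw, fun x hx => by simp [hv0 x hx, hw0 x hx], fun T hT => ?_⟩
    obtain ⟨c, b, A, h⟩ := hv2 T hT
    obtain ⟨c', b', A', h'⟩ := hw2 T hT
    refine ⟨c + c', b + b', A + A', fun x hx => ?_⟩
    simp [h x hx, h' x hx]
    ring
  smul_mem' := by
    rintro r v ⟨hv, hv0, hv2⟩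
    refine ⟨hv.const_smul r, fun x hx => by simp [hv0 x hx], fun T hT => ?_⟩
    obtain ⟨c, b, A, h⟩ := hv2 T hT
    refine ⟨r * c, r • b, r • A, fun x hx => ?_⟩
    simp [h x hx]
    ring

/-! ### The forms are bilinear on `V_h` -/

variable {𝒯}

lemma mem_elementsAt {e T : Finset (Pt d)} : T ∈ 𝒯.elementsAt e ↔ T ∈ 𝒯.elements ∧ e ⊆ T := by
  simp [elementsAt]

lemma uniqueDiffOn_cell {T : Finset (Pt d)} (hT : T ∈ 𝒯.elements) :
    UniqueDiffOn ℝ (cell T) := by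
  simp only [elements, Finset.mem_filter, Set.Finite.mem_toFinset] at hT
  refine uniqueDiffOn_convex (convex_convexHull ℝ _) ?_
  rw [cell, interior_convexHull_nonempty_iff_affineSpan_eq_top]
  have h := (𝒯.complex.indep hT.1).affineSpan_eq_top_iff_card_eq_finrank_add_one.2
    (by simp [hT.2])
  simpa using h

lemma quad_contDiff (c : ℝ) (b : Pt d →L[ℝ] ℝ) (A : Pt d →L[ℝ] Pt d →L[ℝ] ℝ) :
    ContDiff ℝ 1 (fun x : Pt d => c + b x + A x x) := by
  fun_prop

lemma contDiffOn_cell {v : Pt d → ℝ} (hv : v ∈ 𝒯.Vh) {T : Finset (Pt d)}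
    (hT : T ∈ 𝒯.elements) : ContDiffOn ℝ 1 v (cell T) := by
  obtain ⟨c, b, A, h⟩ := hv.2.2 T hT
  exact (quad_contDiff c b A).contDiffOn.congr h

lemma gradDot_add {v w : Pt d → ℝ} (hv : v ∈ 𝒯.Vh) (hw : w ∈ 𝒯.Vh) {T : Finset (Pt d)}
    (hT : T ∈ 𝒯.elements) {x : Pt d} (hx : x ∈ cell T) (n : Pt d) :
    gradDot (v + w) T x n = gradDot v T x n + gradDot w T x n := by
  simp only [gradDot]
  rw [fderivWithin_add (uniqueDiffOn_cell hT x hx)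
    ((contDiffOn_cell hv hT).differentiableOn (by simp) x hx)
    ((contDiffOn_cell hw hT).differentiableOn (by simp) x hx)]
  simp

lemma gradDot_smul {v : Pt d → ℝ} (hv : v ∈ 𝒯.Vh) (r : ℝ) {T : Finset (Pt d)}
    (hT : T ∈ 𝒯.elements) {x : Pt d} (hx : x ∈ cell T) (n : Pt d) :
    gradDot (r • v) T x n = r * gradDot v T x n := by
  simp only [gradDot]
  rw [fderivWithin_const_smul (uniqueDiffOn_cell hT x hx)
    ((contDiffOn_cell hv hT).differentiableOn (by simp) x hx)]
  simp

lemma continuousOn_gradDot {v : Pt d → ℝ} (hv : v ∈ 𝒯.Vh) {T : Finset (Pt d)}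
    (hT : T ∈ 𝒯.elements) (n : Pt d) : ContinuousOn (fun x => gradDot v T x n) (cell T) := by
  have h := (contDiffOn_cell hv hT).continuousOn_fderivWithin (uniqueDiffOn_cell hT) le_rfl
  exact h.clm_apply continuousOn_const

lemma isCompact_cell (s : Finset (Pt d)) : IsCompact (cell s) :=
  s.finite_toSet.isCompact_convexHull ℝ

lemma surf_lt_top {e : Finset (Pt d)} (he : e ∈ 𝒯.faces) : surf e Set.univ < ⊤ := by
  simp only [faces, Finset.mem_filter, Set.Finite.mem_toFinset] at he
  obtain ⟨p, hp⟩ := 𝒯.complex.nonempty_of_mem_faces he.1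
  rw [surf, Measure.restrict_apply_univ]
  set S : AffineSubspace ℝ (Pt d) := affineSpan ℝ (e : Set (Pt d)) with hS
  have hpS : p ∈ S := subset_affineSpan ℝ _ (by exact_mod_cast hp)
  have hsub : cell e ⊆ (S : Set (Pt d)) := convexHull_subset_affineSpan _
  have hcard : Module.finrank ℝ S.direction = d - 1 := by
    have h := (𝒯.complex.indep he.1).finrank_vectorSpan (n := d - 1) (by
      have : 0 < e.card := Finset.card_pos.2 ⟨p, hp⟩
      simp only [Fintype.card_coe]
      omega)
    rw [hS, direction_affineSpan]
    rw [Subtype.range_coe_subtype] at h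
    exact h
  let f : S.direction → Pt d := fun y => (y : Pt d) + p
  have hf : Isometry f := by
    intro y z
    simp only [f, edist_add_right]
    rfl
  have hfc : Topology.IsClosedEmbedding f := hf.isClosedEmbedding
  have himg : cell e = f '' (f ⁻¹' cell e) := by
    rw [Set.image_preimage_eq_of_subset]
    intro x hx
    refine ⟨⟨x - p, ?_⟩, by simp [f]⟩
    exact S.vsub_mem_direction (hsub hx) hpS
  rw [himg, hf.euclideanHausdorffMeasure_image, ← hcard,
    InnerProductSpace.euclideanHausdorffMeasure_eq_volume]
  exact (hfc.isCompact_preimage (isCompact_cell e)).measure_lt_top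

lemma integrable_surf {e : Finset (Pt d)} (he : e ∈ 𝒯.faces) {g : Pt d → ℝ}
    (hg : ContinuousOn g (cell e)) : Integrable g (surf e) := by
  have h := surf_lt_top he
  rw [surf, Measure.restrict_apply_univ] at h
  exact hg.integrableOn_of_subset_isCompact (isCompact_cell e)
    (isCompact_cell e).measurableSet subset_rfl h.ne

lemma ae_surf_mem (e : Finset (Pt d)) : ∀ᵐ x ∂(surf e), x ∈ cell e :=
  ae_restrict_mem (isCompact_cell e).measurableSet

lemma cell_mono {e T : Finset (Pt d)} (h : e ⊆ T) : cell e ⊆ cell T :=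
  convexHull_mono (by exact_mod_cast h)

lemma avgGradDot_add {v w : Pt d → ℝ} (hv : v ∈ 𝒯.Vh) (hw : w ∈ 𝒯.Vh) {e : Finset (Pt d)}
    {x : Pt d} (hx : x ∈ cell e) (n : Pt d) :
    𝒯.avgGradDot (v + w) e x n = 𝒯.avgGradDot v e x n + 𝒯.avgGradDot w e x n := by
  simp only [avgGradDot, ← mul_add, ← Finset.sum_add_distrib]
  congr 1
  refine Finset.sum_congr rfl fun T hT => ?_
  rw [mem_elementsAt] at hT
  exact gradDot_add hv hw hT.1 (cell_mono hT.2 hx) n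

lemma avgGradDot_smul {v : Pt d → ℝ} (hv : v ∈ 𝒯.Vh) (r : ℝ) {e : Finset (Pt d)}
    {x : Pt d} (hx : x ∈ cell e) (n : Pt d) :
    𝒯.avgGradDot (r • v) e x n = r * 𝒯.avgGradDot v e x n := by
  simp only [avgGradDot, mul_left_comm r, Finset.mul_sum _ _ r]
  congr 1
  refine Finset.sum_congr rfl fun T hT => ?_
  rw [mem_elementsAt] at hT
  exact gradDot_smul hv r hT.1 (cell_mono hT.2 hx) n

lemma continuousOn_avgGradDot {v : Pt d → ℝ} (hv : v ∈ 𝒯.Vh) (e : Finset (Pt d)) (n : Pt d) :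
    ContinuousOn (fun x => 𝒯.avgGradDot v e x n) (cell e) := by
  refine continuousOn_const.mul (continuousOn_finsetSum _ fun T hT => ?_)
  rw [mem_elementsAt] at hT
  exact (continuousOn_gradDot hv hT.1 n).mono (cell_mono hT.2)

lemma normalJump_add {v w : Pt d → ℝ} (hv : v ∈ 𝒯.Vh) (hw : w ∈ 𝒯.Vh) {e : Finset (Pt d)}
    {x : Pt d} (hx : x ∈ cell e) :
    𝒯.normalJump (v + w) e x = 𝒯.normalJump v e x + 𝒯.normalJump w e x := by
  simp only [normalJump, ← neg_add, ← Finset.sum_add_distrib]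
  congr 1
  refine Finset.sum_congr rfl fun T hT => ?_
  rw [mem_elementsAt] at hT
  exact gradDot_add hv hw hT.1 (cell_mono hT.2 hx) _

lemma normalJump_smul {v : Pt d → ℝ} (hv : v ∈ 𝒯.Vh) (r : ℝ) {e : Finset (Pt d)}
    {x : Pt d} (hx : x ∈ cell e) :
    𝒯.normalJump (r • v) e x = r * 𝒯.normalJump v e x := by
  simp only [normalJump, mul_neg, Finset.mul_sum _ _ r]
  congr 1
  refine Finset.sum_congr rfl fun T hT => ?_
  rw [mem_elementsAt] at hT
  exact gradDot_smul hv r hT.1 (cell_mono hT.2 hx) _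

lemma continuousOn_normalJump {v : Pt d → ℝ} (hv : v ∈ 𝒯.Vh) (e : Finset (Pt d)) :
    ContinuousOn (𝒯.normalJump v e) (cell e) := by
  refine ContinuousOn.neg (continuousOn_finsetSum _ fun T hT => ?_)
  rw [mem_elementsAt] at hT
  exact (continuousOn_gradDot hv hT.1 _).mono (cell_mono hT.2)

lemma weakLaplacian_add {v w : Pt d → ℝ} (hv : v ∈ 𝒯.Vh) (hw : w ∈ 𝒯.Vh)
    (T : Finset (Pt d)) :
    𝒯.weakLaplacian (v + w) T = 𝒯.weakLaplacian v T + 𝒯.weakLaplacian w T := by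
  simp only [weakLaplacian, ← mul_add, ← Finset.sum_add_distrib]
  congr 1
  refine Finset.sum_congr rfl fun e he => ?_
  have he' : e ∈ 𝒯.faces := by
    simp only [facesOf, Finset.mem_filter] at he
    exact he.1
  rw [← integral_add (integrable_surf he' (continuousOn_avgGradDot hv e _))
    (integrable_surf he' (continuousOn_avgGradDot hw e _))]
  refine integral_congr_ae ?_
  filter_upwards [ae_surf_mem e] with x hx
  exact avgGradDot_add hv hw hx _

lemma weakLaplacian_smul {v : Pt d → ℝ} (hv : v ∈ 𝒯.Vh) (r : ℝ) (T : Finset (Pt d)) :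
    𝒯.weakLaplacian (r • v) T = r * 𝒯.weakLaplacian v T := by
  simp only [weakLaplacian, mul_left_comm r, Finset.mul_sum _ _ r]
  congr 1
  refine Finset.sum_congr rfl fun e _ => ?_
  rw [← integral_const_mul]
  refine integral_congr_ae ?_
  filter_upwards [ae_surf_mem e] with x hx
  exact avgGradDot_smul hv r hx _

lemma form_comm (𝒮 ℱ : Finset (Finset (Pt d))) (v w : Pt d → ℝ) :
    𝒯.form 𝒮 ℱ v w = 𝒯.form 𝒮 ℱ w v := by
  simp only [form, mul_comm (𝒯.weakLaplacian v _), mul_comm (𝒯.normalJump v _ _)]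

lemma form_add_left {𝒮 ℱ : Finset (Finset (Pt d))} (hℱ : ℱ ⊆ 𝒯.faces) {v v' w : Pt d → ℝ}
    (hv : v ∈ 𝒯.Vh) (hv' : v' ∈ 𝒯.Vh) (hw : w ∈ 𝒯.Vh) :
    𝒯.form 𝒮 ℱ (v + v') w = 𝒯.form 𝒮 ℱ v w + 𝒯.form 𝒮 ℱ v' w := by
  have h : ∀ e ∈ ℱ, ∫ x, 𝒯.normalJump (v + v') e x * 𝒯.normalJump w e x ∂(surf e) =
      ∫ x, 𝒯.normalJump v e x * 𝒯.normalJump w e x ∂(surf e) +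
        ∫ x, 𝒯.normalJump v' e x * 𝒯.normalJump w e x ∂(surf e) := by
    intro e he
    have h1 : Integrable (fun x => 𝒯.normalJump v e x * 𝒯.normalJump w e x) (surf e) :=
      integrable_surf (hℱ he) ((continuousOn_normalJump hv e).mul (continuousOn_normalJump hw e))
    have h2 : Integrable (fun x => 𝒯.normalJump v' e x * 𝒯.normalJump w e x) (surf e) :=
      integrable_surf (hℱ he) ((continuousOn_normalJump hv' e).mul (continuousOn_normalJump hw e))
    rw [← integral_add h1 h2]
    refine integral_congr_ae ?_
    filter_upwards [ae_surf_mem e] with x hx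
    simp only [normalJump_add hv hv' hx, add_mul]
  simp only [form, weakLaplacian_add hv hv']
  rw [Finset.sum_congr rfl fun e he => congrArg (fun t => (faceSize e)⁻¹ * t) (h e he)]
  simp only [mul_add, add_mul, Finset.sum_add_distrib]
  ring

lemma form_smul_left {𝒮 ℱ : Finset (Finset (Pt d))} {v : Pt d → ℝ} (w : Pt d → ℝ)
    (hv : v ∈ 𝒯.Vh) (r : ℝ) :
    𝒯.form 𝒮 ℱ (r • v) w = r * 𝒯.form 𝒮 ℱ v w := by
  have h : ∀ e ∈ ℱ, ∫ x, 𝒯.normalJump (r • v) e x * 𝒯.normalJump w e x ∂(surf e) =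
      r * ∫ x, 𝒯.normalJump v e x * 𝒯.normalJump w e x ∂(surf e) := by
    intro e _
    rw [← integral_const_mul]
    refine integral_congr_ae ?_
    filter_upwards [ae_surf_mem e] with x hx
    simp only [normalJump_smul hv r hx, mul_assoc]
  simp only [form, weakLaplacian_smul hv r]
  rw [Finset.sum_congr rfl fun e he => congrArg (fun t => (faceSize e)⁻¹ * t) (h e he)]
  simp only [mul_add, Finset.mul_sum]
  congr 1 <;> exact Finset.sum_congr rfl fun _ _ => by ring

variable (𝒯)

/-- `form` as a linear map from `V_h` to its dual space. -/
def formOp (𝒮 ℱ : Finset (Finset (Pt d))) (hℱ : ℱ ⊆ 𝒯.faces) :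
    𝒯.Vh →ₗ[ℝ] Module.Dual ℝ 𝒯.Vh :=
  LinearMap.mk₂ ℝ (fun v w => 𝒯.form 𝒮 ℱ v w)
    (fun v v' w => form_add_left hℱ v.2 v'.2 w.2)
    (fun r v w => form_smul_left _ v.2 r)
    (fun v w w' => by
      rw [form_comm, form_comm _ _ (v : Pt d → ℝ), form_comm _ _ (v : Pt d → ℝ)]
      exact form_add_left hℱ w.2 w'.2 v.2)
    (fun r v w => by
      rw [form_comm, form_comm _ _ (v : Pt d → ℝ)]
      exact form_smul_left _ w.2 r)

lemma interiorFaces_subset : 𝒯.interiorFaces ⊆ 𝒯.faces := fun e he => by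
  simp only [interiorFaces, Finset.mem_filter] at he
  exact he.1

/-- The operator `A_h : V_h → V_h'`, `⟨A_h v, w⟩ = a_w(v, w)`. -/
def globalOp : 𝒯.Vh →ₗ[ℝ] Module.Dual ℝ 𝒯.Vh :=
  𝒯.formOp 𝒯.elements 𝒯.interiorFaces 𝒯.interiorFaces_subset

/-! ### Subdomains and the preconditioner -/

/-- `V_D = {v ∈ V_h : v = 0 on Ω \ D}`. -/
def localSpace (D : Set (Pt d)) : Submodule ℝ 𝒯.Vh where
  carrier := {v | ∀ x ∈ Ω \ D, (v : Pt d → ℝ) x = 0}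
  zero_mem' := fun _ _ => rfl
  add_mem' := fun {v w} hv hw x hx => by simp [hv x hx, hw x hx]
  smul_mem' := fun r v hv x hx => by simp [hv x hx]

open Classical in
/-- The elements contained in (the closure of) the subdomain `D`. -/
def localElements (D : Set (Pt d)) : Finset (Finset (Pt d)) :=
  {T ∈ 𝒯.elements | cell T ⊆ closure D}

open Classical in
/-- The interior faces contained in the closure of the subdomain `D`. -/
def localFaces (D : Set (Pt d)) : Finset (Finset (Pt d)) :=
  {e ∈ 𝒯.interiorFaces | cell e ⊆ closure D}

lemma localFaces_subset (D : Set (Pt d)) : 𝒯.localFaces D ⊆ 𝒯.faces := fun e he => by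
  simp only [localFaces, Finset.mem_filter] at he
  exact 𝒯.interiorFaces_subset he.1

/-- The local operator `A_D : V_D → V_D'`,
`⟨A_D v, w⟩ = (Δ_w v, Δ_w w)_{𝒯_D} + (1/4) ⟨h_e⁻¹ [∇v]·n_e, [∇w]·n_e⟩_{ℰ_D}`. -/
def localOp (D : Set (Pt d)) : 𝒯.localSpace D →ₗ[ℝ] Module.Dual ℝ (𝒯.localSpace D) :=
  (𝒯.formOp (𝒯.localElements D) (𝒯.localFaces D)
    (𝒯.localFaces_subset D)).domRestrict₁₂
      (𝒯.localSpace D) (𝒯.localSpace D)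

end Triangulation

open Classical in
/-- The inverse of a bijective linear map (zero if the map is not bijective). -/
def linearInverse {V W : Type*} [AddCommMonoid V] [Module ℝ V] [AddCommMonoid W] [Module ℝ W]
    (f : V →ₗ[ℝ] W) : W →ₗ[ℝ] V :=
  if h : Function.Bijective f then ((LinearEquiv.ofBijective f h).symm : W →ₗ[ℝ] V) else 0

namespace Triangulation

variable {d : ℕ} {Ω : Set (Pt d)} (𝒯 : Triangulation Ω)

/-- The one-level additive Schwarz preconditioner `B_h = ∑ⱼ Iⱼ Aⱼ⁻¹ Iⱼᵀ : V_h' → V_h`, where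
`Iⱼ` is the inclusion of `Vⱼ` in `V_h` and `Iⱼᵀ` its transpose. -/
def schwarz {J : ℕ} (D : Fin J → Set (Pt d)) : Module.Dual ℝ 𝒯.Vh →ₗ[ℝ] 𝒯.Vh :=
  ∑ j, (𝒯.localSpace (D j)).subtype ∘ₗ linearInverse (𝒯.localOp (D j)) ∘ₗ
    (𝒯.localSpace (D j)).subtype.dualMap

/-- The preconditioned operator `B_h A_h : V_h → V_h`. -/
def preconditioned {J : ℕ} (D : Fin J → Set (Pt d)) : Module.End ℝ 𝒯.Vh :=
  𝒯.schwarz D ∘ₗ 𝒯.globalOp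

/-- The open sets `D j` form an overlapping decomposition of `Ω` aligned with the mesh, with
overlap width `δ`, at most `Nc` of the subdomains having a common point, and
`θ j ∈ C^∞(closure Ω)` is a subordinate partition of unity with derivatives bounded by `M δ⁻¹` and
`M δ⁻²`. -/
structure IsOverlappingDecomposition {J : ℕ} (D : Fin J → Set (Pt d)) (θ : Fin J → Pt d → ℝ)
    (δ M : ℝ) (Nc : ℕ) : Prop where
  aligned : ∀ j, ∃ 𝒮 ⊆ 𝒯.elements, D j = interior (⋃ T ∈ 𝒮, cell T)
  cover : ⋃ j, D j = Ω
  overlap : ∀ x ∈ Ω, Nat.card {j : Fin J // x ∈ D j} ≤ Nc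
  smooth : ∀ j, ContDiffOn ℝ ∞ (θ j) (closure Ω)
  nonneg : ∀ j, ∀ x ∈ closure Ω, 0 ≤ θ j x
  eq_zero : ∀ j, ∀ x ∈ Ω \ D j, θ j x = 0
  sum_eq_one : ∀ x ∈ closure Ω, ∑ j, θ j x = 1
  grad_le : ∀ j, ∀ x ∈ Ω, ‖fderiv ℝ (θ j) x‖ ≤ M * δ⁻¹
  hessian_le : ∀ j, ∀ x ∈ Ω, ‖fderiv ℝ (fderiv ℝ (θ j)) x‖ ≤ M * (δ ^ 2)⁻¹

end Triangulation

end C0WG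

end

/-!
# Condition number of an additive Schwarz preconditioner for a weak Galerkin biharmonic method

Write `a(v, w)` for the bilinear form of the method on the whole mesh, `a_j` for its local versions,
and `‖v‖²` for the sum over the elements of `|T| (Δv|_T)²` (with the elementwise Laplacian),
`∫_T |∇v|²` and `∫_T v²`, plus the sum over the interior faces of the scaled jumps
`h_e⁻¹ ∫_e ([∇v]·n_e)²`. Everything follows from two estimates for the splitting of finite element
functions into functions supported in the subdomains, in which the constants depend only on `d`,
`Ω`, `σ`, `M` and `N_c`.

*Coercivity.* `‖v‖² ≤ C a(v, v)` for `v ∈ V_h` (`exists_coercivity`). The divergence theorem on a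
simplex is obtained by slicing the simplex with lines parallel to an edge
(`FacetNormals.integral_fderiv`, `IsSimplex.setIntegral_fderiv`). An interior face belongs to
exactly two elements, with opposite outward normals (`outwardNormal_eq_neg`, `elementsAt_eq_pair`). So
the weak Laplacian differs from the elementwise one only by the mean fluxes of the jumps
(`weakLaplacian_sub_elemLaplacian`), and the form controls the elementwise Laplacian. Summation by
parts (`sum_energySq`) expresses the energy `∑_T ∫_T |∇v|²` by the elementwise Laplacian and the
jumps, tested with `v`; the trace of `v` on the faces is bounded by the inverse estimate
(`exists_inverse_estimate`) and `v` itself by the Poincaré inequality (`sum_massSq_le`), which is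
summation by parts as well. No second derivatives other than the Laplacian have to be controlled,
and no elliptic regularity is used. Conversely, the Laplacians and the jumps bound the form
(`form_le_sum`).

*Upper bound.* For `v_j ∈ V_j` one has `a(∑ v_j, ∑ v_j) ≤ C ∑ a_j(v_j, v_j)`
(`exists_form_sum_le`): every element and every face meets boundedly many subdomains, and
`a(v, v) ≤ C a_j(v, v)` on `V_j` (`IsAligned.form_le`), since outside of `Ω_j` the weak Laplacian of
`v ∈ V_j` consists only of fluxes of jumps on faces of `Ω_j`.

*Stable decomposition.* The functions `v_j = I_h(θ_j v)`, with `I_h` the quadratic Lagrange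
interpolation, lie in `V_j`, add up to `v` and satisfy `∑ a_j(v_j, v_j) ≤ C δ⁻⁴ a(v, v)`
(`exists_stable_decomposition`). On an element `T` and with `x₀ ∈ T`, Taylor expansion gives
`θ_j v = θ_j(x₀) v + v(x₀) ∇θ_j(x₀)·(x - x₀) + R`, where `R` is of size
`h_T² (δ⁻¹ |∇v| + δ⁻² |v|)` (`cutoff_mul_expansion`). Interpolation reproduces the two leading terms
and is stable on the remainder (`interp_expansion`). The affine term has no Laplacian; if `x₀` is
taken on a face, this term is the same on both sides of the face, and it does not jump. What is left
is bounded by `δ⁻⁴` times the energy and the mass of `v` (`volume_mul_cutoffError_sq_le`), hence by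
coercivity.

The upper bound and the stable decomposition bound the eigenvalues of the preconditioned operator
from above and from below by the usual argument for additive Schwarz methods
(`exists_extreme_eigenvalues`).
-/

noncomputable section

open scoped Classical

namespace C0WG

/-! ### Hyperplanes and slicing -/

/-- Surface measure on the hyperplane `⟪n, y⟫ = c`. -/
def hyperplaneMeasure {d : ℕ} (n : Pt d) (c : ℝ) : Measure (Pt d) :=
  (Measure.euclideanHausdorffMeasure (d - 1)).restrict {y | inner ℝ n y = c}

lemma measurableSet_hyperplane {d : ℕ} (n : Pt d) (c : ℝ) :
    MeasurableSet {y : Pt d | inner ℝ n y = c} :=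
  (isClosed_eq (by fun_prop) continuous_const).measurableSet

lemma hyperplane_eq_mk' {d : ℕ} {n : Pt d} (hn : ‖n‖ = 1) (c : ℝ) :
    {y : Pt d | inner ℝ n y = c} = (AffineSubspace.mk' (c • n) (ℝ ∙ n)ᗮ : Set (Pt d)) := by
  ext y
  simp only [Set.mem_ofPred_eq, SetLike.mem_coe, AffineSubspace.mem_mk', vsub_eq_sub,
    Submodule.mem_orthogonal_singleton_iff_inner_right, inner_sub_right, inner_smul_right,
    real_inner_self_eq_norm_sq, hn]
  constructor <;> intro h <;> linarith

lemma finrank_orthogonal_unit {d : ℕ} {n : Pt d} (hn : ‖n‖ = 1) :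
    Module.finrank ℝ (ℝ ∙ n)ᗮ = d - 1 := by
  have h0 : n ≠ 0 := fun h => by simp [h] at hn
  have h := (ℝ ∙ n).finrank_add_finrank_orthogonal
  rw [finrank_span_singleton h0, finrank_euclideanSpace_fin] at h
  omega

/-- The surface measure on a hyperplane is the image of Lebesgue measure on its direction. -/
lemma hyperplaneMeasure_eq_map {d : ℕ} {n : Pt d} (hn : ‖n‖ = 1) (c : ℝ) :
    hyperplaneMeasure n c =
      (volume : Measure (ℝ ∙ n)ᗮ).map (fun w : (ℝ ∙ n)ᗮ => (w : Pt d) + c • n) := by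
  have hf : Isometry (fun w : (ℝ ∙ n)ᗮ => (w : Pt d) + c • n) := by
    intro y z
    simp only [edist_add_right]
    rfl
  have h := hf.map_euclideanHausdorffMeasure (d := d - 1)
  rw [← finrank_orthogonal_unit hn, InnerProductSpace.euclideanHausdorffMeasure_eq_volume,
    finrank_orthogonal_unit hn] at h
  rw [h, hyperplaneMeasure, hyperplane_eq_mk' hn]
  congr 1
  ext y
  simp only [SetLike.mem_coe, AffineSubspace.mem_mk', vsub_eq_sub, Set.mem_range, Subtype.exists]
  constructor
  · intro h
    exact ⟨_, h, by simp⟩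
  · rintro ⟨w, hw, rfl⟩
    simpa using hw

lemma sigmaFinite_hyperplaneMeasure {d : ℕ} {n : Pt d} (hn : ‖n‖ = 1) (c : ℝ) :
    SigmaFinite (hyperplaneMeasure n c) := by
  rw [hyperplaneMeasure_eq_map hn]
  have hf : Isometry (fun w : (ℝ ∙ n)ᗮ => (w : Pt d) + c • n) := by
    intro y z
    simp only [edist_add_right]
    rfl
  exact hf.isClosedEmbedding.measurableEmbedding.sigmaFinite_map

lemma lintegral_smul_measure_volume_mul {a : ℝ} (ha : a ≠ 0) (F : ℝ → ENNReal) :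
    ∫⁻ x, F x = ENNReal.ofReal |a| * ∫⁻ x, F (a * x) := by
  conv_lhs => rw [← Real.smul_map_volume_mul_left ha]
  rw [lintegral_smul_measure, smul_eq_mul]
  congr 1
  exact lintegral_map_equiv F (Homeomorph.mulLeft₀ a ha).toMeasurableEquiv

/-- Lebesgue measure is sliced by lines in a direction `ξ` transversal to a hyperplane. -/
lemma volume_eq_map_hyperplane {d : ℕ} {n : Pt d} (hn : ‖n‖ = 1) (c : ℝ) {ξ : Pt d}
    (hξ : inner ℝ n ξ ≠ 0) :
    (volume : Measure (Pt d)) = ENNReal.ofReal |inner ℝ n ξ| •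
      ((hyperplaneMeasure n c).prod volume).map (fun z : Pt d × ℝ => z.1 + z.2 • ξ) := by
  have := sigmaFinite_hyperplaneMeasure hn c
  have hn0 : n ≠ 0 := fun h => by simp [h] at hn
  have hm : Measurable (fun z : Pt d × ℝ => z.1 + z.2 • ξ) := by fun_prop
  ext t ht
  rw [Measure.smul_apply, Measure.map_apply hm ht, Measure.prod_apply_symm (hm ht)]
  have h := EuclideanGeometry.euclideanHausdorffMeasure_eq_lintegral (c • n) hn0 ht
  rw [InnerProductSpace.euclideanHausdorffMeasure_eq_volume, finrank_euclideanSpace_fin] at h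
  rw [h]
  have hn1 : ‖n‖ₑ = 1 := by rw [← ofReal_norm, hn]; simp
  rw [hn1, one_mul]
  set F : ℝ → ENNReal := fun x => Measure.euclideanHausdorffMeasure (d - 1)
    (t ∩ (AffineSubspace.mk' (x • n +ᵥ c • n) (ℝ ∙ n)ᗮ : Set (Pt d))) with hF
  have key : ∀ τ : ℝ, hyperplaneMeasure n c
      ((fun y : Pt d => (y, τ)) ⁻¹' ((fun z : Pt d × ℝ => z.1 + z.2 • ξ) ⁻¹' t)) =
        F (inner ℝ n ξ * τ) := by
    intro τ
    simp only [hF, hyperplaneMeasure]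
    rw [Measure.restrict_apply (by exact (measurable_prodMk_right (hm ht)))]
    rw [← measure_preimage_add_right (Measure.euclideanHausdorffMeasure (d - 1)) (τ • ξ)
      (t ∩ _)]
    congr 1
    ext y
    simp only [Set.mem_inter_iff, Set.mem_preimage, Set.mem_ofPred_eq, SetLike.mem_coe,
      AffineSubspace.mem_mk', vsub_eq_sub, vadd_eq_add,
      Submodule.mem_orthogonal_singleton_iff_inner_right, inner_sub_right, inner_smul_right,
      inner_add_right, real_inner_self_eq_norm_sq, hn]
    refine and_congr_right fun _ => ?_
    constructor <;> intro h <;> linarith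
  simp_rw [key]
  rw [smul_eq_mul, ← lintegral_smul_measure_volume_mul hξ]

/-- Fubini's theorem for the lines in a direction `ξ` that is transversal to a hyperplane. -/
lemma integral_eq_integral_slices {d : ℕ} {n : Pt d} (hn : ‖n‖ = 1) (c : ℝ) {ξ : Pt d}
    (hξ : inner ℝ n ξ ≠ 0) {g : Pt d → ℝ} (hg : Integrable g) :
    ∫ x, g x = |inner ℝ n ξ| * ∫ y, (∫ t : ℝ, g (y + t • ξ)) ∂(hyperplaneMeasure n c) := by
  have := sigmaFinite_hyperplaneMeasure hn c
  have hm : Measurable (fun z : Pt d × ℝ => z.1 + z.2 • ξ) := by fun_prop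
  have ha : ENNReal.ofReal |inner ℝ n ξ| ≠ 0 := by
    simpa using hξ
  have hg' : Integrable g (((hyperplaneMeasure n c).prod volume).map
      (fun z : Pt d × ℝ => z.1 + z.2 • ξ)) := by
    rw [volume_eq_map_hyperplane hn c hξ] at hg
    exact (integrable_smul_measure ha ENNReal.ofReal_ne_top).1 hg
  conv_lhs => rw [volume_eq_map_hyperplane hn c hξ]
  rw [integral_smul_measure, ENNReal.toReal_ofReal (abs_nonneg _), smul_eq_mul,
    integral_map hm.aemeasurable hg'.aestronglyMeasurable]
  congr 1
  exact integral_prod _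
    ((integrable_map_measure hg'.aestronglyMeasurable hm.aemeasurable).1 hg')

/-! ### The divergence theorem on a simplex -/

/-- Unit outward normals `n i`, heights `h i` and levels `c i` of the facets of the simplex with
vertices `b`: the `i`-th facet lies in the hyperplane `⟪n i, x⟫ = c i`, and the barycentric
coordinate of the opposite vertex `b i` is the distance to it in units of `h i`. -/
structure FacetNormals {d : ℕ} {ι : Type*} (b : AffineBasis ι ℝ (Pt d)) (n : ι → Pt d)
    (h c : ι → ℝ) : Prop where
  norm_eq : ∀ i, ‖n i‖ = 1
  height_pos : ∀ i, 0 < h i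
  coord_mul : ∀ i x, b.coord i x * h i = c i - inner ℝ (n i) x

namespace FacetNormals

variable {d : ℕ} {ι : Type*} {b : AffineBasis ι ℝ (Pt d)} {n : ι → Pt d} {h c : ι → ℝ}

lemma coord_eq_zero_iff (H : FacetNormals b n h c) (i : ι) (x : Pt d) :
    b.coord i x = 0 ↔ inner ℝ (n i) x = c i := by
  have h1 := H.coord_mul i x
  have h2 := H.height_pos i
  constructor
  · intro h0
    rw [h0] at h1
    linarith
  · intro h0
    rw [h0, sub_self] at h1
    exact (mul_eq_zero.1 h1).resolve_right h2.ne'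

lemma inner_sub (H : FacetNormals b n h c) (i : ι) (x y : Pt d) :
    inner ℝ (n i) (x - y) = (b.coord i y - b.coord i x) * h i := by
  rw [inner_sub_right]
  linarith [H.coord_mul i x, H.coord_mul i y]

lemma continuous_coord (b : AffineBasis ι ℝ (Pt d)) (i : ι) : Continuous (b.coord i) :=
  (b.coord i).continuous_of_finiteDimensional

lemma coord_add_smul (b : AffineBasis ι ℝ (Pt d)) (i j k : ι) (x : Pt d) (t : ℝ) :
    b.coord i (x + t • (b j - b k)) = b.coord i x + t * (b.coord i (b j) - b.coord i (b k)) := by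
  have h1 := (b.coord i).map_vadd x (t • (b j - b k))
  have h2 := (b.coord i).linearMap_vsub (b j) (b k)
  simp only [vadd_eq_add, vsub_eq_sub, map_smul, smul_eq_mul] at h1 h2
  rw [add_comm, h1, h2]
  ring

end FacetNormals

namespace FacetNormals

variable {d : ℕ} {ι : Type*} {b : AffineBasis ι ℝ (Pt d)} {n : ι → Pt d} {h c : ι → ℝ}

lemma isCompact_simplex [Finite ι] (b : AffineBasis ι ℝ (Pt d)) :
    IsCompact (convexHull ℝ (Set.range b)) :=
  (Set.finite_range b).isCompact_convexHull ℝ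

lemma mem_simplex {b : AffineBasis ι ℝ (Pt d)} {x : Pt d} :
    x ∈ convexHull ℝ (Set.range b) ↔ ∀ i, 0 ≤ b.coord i x := by
  rw [b.convexHull_eq_nonneg_coord]
  rfl

/-- Along the edge from `b k` to `b j`, only the barycentric coordinates of these two vertices
change. -/
lemma coord_edge {j k : ι} (hjk : j ≠ k) (i : ι) (x : Pt d) (t : ℝ) :
    b.coord j (x + t • (b j - b k)) = b.coord j x + t ∧
    b.coord k (x + t • (b j - b k)) = b.coord k x - t ∧
    (i ≠ j → i ≠ k → b.coord i (x + t • (b j - b k)) = b.coord i x) := by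
  refine ⟨?_, ?_, fun h1 h2 => ?_⟩
  · rw [coord_add_smul, b.coord_apply_eq, b.coord_apply_ne hjk]; ring
  · rw [coord_add_smul, b.coord_apply_eq, b.coord_apply_ne hjk.symm]; ring
  · rw [coord_add_smul, b.coord_apply_ne h1, b.coord_apply_ne h2]; ring

/-- An edge is tangential to all facets but the two that are opposite to its endpoints. -/
lemma inner_edge (H : FacetNormals b n h c) {j k : ι} (hjk : j ≠ k) :
    inner ℝ (n j) (b j - b k) = - h j ∧ inner ℝ (n k) (b j - b k) = h k ∧
    ∀ i, i ≠ j → i ≠ k → inner ℝ (n i) (b j - b k) = 0 := by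
  refine ⟨?_, ?_, fun i h1 h2 => ?_⟩
  · rw [H.inner_sub, b.coord_apply_eq, b.coord_apply_ne hjk]; ring
  · rw [H.inner_sub, b.coord_apply_eq, b.coord_apply_ne hjk.symm]; ring
  · rw [H.inner_sub, b.coord_apply_ne h1, b.coord_apply_ne h2]; ring

lemma ae_hyperplane (n : Pt d) (c : ℝ) : ∀ᵐ y ∂(hyperplaneMeasure n c), inner ℝ n y = c :=
  ae_restrict_mem (measurableSet_hyperplane n c)

/-- Fubini along the lines parallel to an edge, and the fundamental theorem of calculus on each of
them. -/
lemma integral_fderiv_edge [Finite ι] (H : FacetNormals b n h c) {j k : ι} (hjk : j ≠ k)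
    {f : Pt d → ℝ} (hf : ContDiff ℝ 1 f) :
    ∫ x in convexHull ℝ (Set.range b), fderiv ℝ f x (b j - b k) =
      h j * ∫ y in convexHull ℝ (Set.range b),
        (f (y + b.coord k y • (b j - b k)) - f y) ∂(hyperplaneMeasure (n j) (c j)) := by
  set S := convexHull ℝ (Set.range b) with hS
  have hSc : IsCompact S := isCompact_simplex b
  have hSm : MeasurableSet S := hSc.measurableSet
  set ξ := b j - b k with hξ
  have hcont : Continuous fun x => fderiv ℝ f x ξ :=
    (hf.continuous_fderiv one_ne_zero).clm_apply continuous_const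
  have hint : Integrable (S.indicator fun x => fderiv ℝ f x ξ) :=
    (integrable_indicator_iff hSm).2 (hcont.continuousOn.integrableOn_compact hSc)
  have hj : inner ℝ (n j) ξ = - h j := (H.inner_edge hjk).1
  rw [← integral_indicator hSm, integral_eq_integral_slices (H.norm_eq j) (c j)
    (by rw [hj]; exact (neg_neg_of_pos (H.height_pos j)).ne) hint, hj, abs_neg,
    abs_of_pos (H.height_pos j), ← integral_indicator hSm]
  congr 1
  refine integral_congr_ae ?_
  filter_upwards [ae_hyperplane (n j) (c j)] with y hy
  have hy0 : b.coord j y = 0 := (H.coord_eq_zero_iff j y).2 hy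
  by_cases hyS : y ∈ S
  · rw [Set.indicator_of_mem hyS]
    have hk : 0 ≤ b.coord k y := mem_simplex.1 hyS k
    -- for `y` on the facet opposite to `b j`, the line meets the simplex in the segment
    -- `0 ≤ t ≤ λ_k(y)`
    have hmem : ∀ t : ℝ, y + t • ξ ∈ S ↔ t ∈ Set.Icc 0 (b.coord k y) := by
      intro t
      rw [hS, mem_simplex]
      constructor
      · intro ht
        have h1 := ht j
        have h2 := ht k
        rw [(coord_edge hjk j y t).1] at h1
        rw [(coord_edge hjk j y t).2.1] at h2
        constructor <;> linarith
      · rintro ⟨h1, h2⟩ i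
        by_cases hij : i = j
        · rw [hij, (coord_edge hjk j y t).1]; linarith
        · by_cases hik : i = k
          · rw [hik, (coord_edge hjk j y t).2.1]; linarith
          · rw [(coord_edge hjk i y t).2.2 hij hik]
            exact mem_simplex.1 hyS i
    have hfun : (fun t : ℝ => S.indicator (fun x => fderiv ℝ f x ξ) (y + t • ξ)) =
        (Set.Icc 0 (b.coord k y)).indicator (fun t => fderiv ℝ f (y + t • ξ) ξ) := by
      ext t
      by_cases ht : t ∈ Set.Icc 0 (b.coord k y)
      · rw [Set.indicator_of_mem ht, Set.indicator_of_mem ((hmem t).2 ht)]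
      · rw [Set.indicator_of_notMem ht, Set.indicator_of_notMem (fun h => ht ((hmem t).1 h))]
    rw [hfun, integral_indicator measurableSet_Icc, integral_Icc_eq_integral_Ioc,
      ← intervalIntegral.integral_of_le hk]
    have hd : ∀ t ∈ Set.uIcc 0 (b.coord k y),
        HasDerivAt (fun t : ℝ => f (y + t • ξ)) (fderiv ℝ f (y + t • ξ) ξ) t := by
      intro t _
      have h1 : HasDerivAt (fun t : ℝ => y + t • ξ) ξ t := by
        simpa using ((hasDerivAt_id t).smul_const ξ).const_add y
      exact ((hf.differentiable one_ne_zero) _).hasFDerivAt.comp_hasDerivAt t h1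
    rw [intervalIntegral.integral_eq_sub_of_hasDerivAt hd]
    · simp
    · exact Continuous.intervalIntegrable (hcont.comp (by fun_prop)) _ _
  · rw [Set.indicator_of_notMem hyS]
    -- a line that meets the simplex meets the facet `λ_j = 0` in a point of the simplex
    have : ∀ t : ℝ, y + t • ξ ∉ S := by
      intro t ht
      apply hyS
      rw [hS, mem_simplex] at ht ⊢
      have h1 := ht j
      have h2 := ht k
      rw [(coord_edge hjk j y t).1] at h1
      rw [(coord_edge hjk j y t).2.1] at h2
      intro i
      by_cases hij : i = j
      · rw [hij]; linarith
      · by_cases hik : i = k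
        · rw [hik]; linarith
        · have h3 := ht i
          rwa [(coord_edge hjk i y t).2.2 hij hik] at h3
    simp [Set.indicator_of_notMem (this _)]

/-- Projection of one facet to another along their transversal edge: both sides are the integral
of a function that is constant along that edge over a prism of unit width. -/
lemma integral_facet_edge [Finite ι] (H : FacetNormals b n h c) {j k : ι} (hjk : j ≠ k)
    {f : Pt d → ℝ} (hf : Continuous f) :
    h j * ∫ y in convexHull ℝ (Set.range b),
        f (y + b.coord k y • (b j - b k)) ∂(hyperplaneMeasure (n j) (c j)) =
      h k * ∫ y in convexHull ℝ (Set.range b), f y ∂(hyperplaneMeasure (n k) (c k)) := by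
  set S := convexHull ℝ (Set.range b) with hS
  have hSc : IsCompact S := isCompact_simplex b
  have hSm : MeasurableSet S := hSc.measurableSet
  set ξ := b j - b k with hξ
  have hcc : ∀ i, Continuous (b.coord i) := continuous_coord b
  set proj : Pt d → Pt d := fun x => x + b.coord k x • ξ with hproj
  have hpc : Continuous proj := by
    have := hcc k
    fun_prop
  -- the prism
  set Q : Set (Pt d) := {x | proj x ∈ S ∧ b.coord j x ∈ Set.Icc (0 : ℝ) 1} with hQ
  have hQsub : Q ⊆ (fun z : Pt d × ℝ => z.1 - z.2 • ξ) '' (S ×ˢ Set.Icc (-1) 1) := by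
    rintro x ⟨h1, h2, h3⟩
    refine ⟨(proj x, b.coord k x), ⟨h1, ?_⟩, by simp [hproj]⟩
    have h4 := mem_simplex.1 h1 j
    have h5 : b.coord j (proj x) ≤ 1 := by
      classical
      have : Fintype ι := Fintype.ofFinite ι
      have hs := b.sum_coord_apply_eq_one (proj x)
      rw [← hs]
      exact Finset.single_le_sum (f := fun i => b.coord i (proj x))
        (fun i _ => mem_simplex.1 h1 i) (Finset.mem_univ j)
    rw [hproj] at h4 h5
    simp only [(coord_edge hjk j x _).1, hξ] at h4 h5
    constructor <;> linarith
  have hQclosed : IsClosed Q :=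
    (hSc.isClosed.preimage hpc).inter (isClosed_Icc.preimage (hcc j))
  have hQc : IsCompact Q :=
    ((hSc.prod isCompact_Icc).image (by fun_prop)).of_isClosed_subset hQclosed hQsub
  have hQm : MeasurableSet Q := hQclosed.measurableSet
  have hint : Integrable (Q.indicator fun x => f (proj x)) :=
    (integrable_indicator_iff hQm).2 ((hf.comp hpc).continuousOn.integrableOn_compact hQc)
  have hj : inner ℝ (n j) ξ = - h j := (H.inner_edge hjk).1
  have hk : inner ℝ (n k) ξ = h k := (H.inner_edge hjk).2.1
  have hpj : ∀ (y : Pt d) (t : ℝ), proj (y + t • ξ) = proj y := by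
    intro y t
    simp only [hproj, hξ, (coord_edge hjk j y t).2.1]
    module
  have hwin : ∀ a v : ℝ, ∫ t : ℝ, (Set.Icc (0 : ℝ) 1).indicator (fun _ => v) (a + t) = v := by
    intro a v
    rw [integral_add_left_eq_self (fun t => (Set.Icc (0 : ℝ) 1).indicator (fun _ => v) t) a,
      integral_indicator measurableSet_Icc]
    simp
  have hslice : ∀ y : Pt d, ∫ t : ℝ, Q.indicator (fun x => f (proj x)) (y + t • ξ) =
      (proj ⁻¹' S).indicator (fun y => f (proj y)) y := by
    intro y
    by_cases hy : proj y ∈ S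
    · rw [Set.indicator_of_mem (by exact hy), ← hwin (b.coord j y) (f (proj y))]
      congr 1
      ext t
      by_cases ht : b.coord j y + t ∈ Set.Icc (0 : ℝ) 1
      · rw [Set.indicator_of_mem ht, Set.indicator_of_mem, hpj]
        exact ⟨by rw [hpj]; exact hy, by rw [hξ, (coord_edge hjk j y t).1]; exact ht⟩
      · rw [Set.indicator_of_notMem ht, Set.indicator_of_notMem]
        rintro ⟨-, h2⟩
        rw [hξ, (coord_edge hjk j y t).1] at h2
        exact ht h2
    · rw [Set.indicator_of_notMem (by exact hy)]
      have : ∀ t : ℝ, y + t • ξ ∉ Q := fun t ht => hy (by rw [← hpj y t]; exact ht.1)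
      simp [Set.indicator_of_notMem (this _)]
  have e1 := integral_eq_integral_slices (H.norm_eq j) (c j)
    (by rw [hj]; exact (neg_neg_of_pos (H.height_pos j)).ne) hint
  have e2 := integral_eq_integral_slices (H.norm_eq k) (c k)
    (by rw [hk]; exact (H.height_pos k).ne') hint
  rw [e1, hj, hk, abs_neg, abs_of_pos (H.height_pos j), abs_of_pos (H.height_pos k)] at e2
  simp_rw [hslice] at e2
  rw [← integral_indicator hSm, ← integral_indicator hSm]
  convert! e2 using 2
  · refine integral_congr_ae ?_
    filter_upwards [ae_hyperplane (n j) (c j)] with y hy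
    have hy0 : b.coord j y = 0 := (H.coord_eq_zero_iff j y).2 hy
    have hiff : y ∈ S ↔ proj y ∈ S := by
      rw [hS, mem_simplex, mem_simplex]
      constructor
      · intro h1 i
        by_cases hij : i = j
        · rw [hij, hproj]; simp only [hξ, (coord_edge hjk j y _).1, hy0, zero_add]; exact h1 k
        · by_cases hik : i = k
          · rw [hik, hproj]; simp only [hξ, (coord_edge hjk j y _).2.1, sub_self, le_refl]
          · rw [hproj]; simp only [hξ, (coord_edge hjk i y _).2.2 hij hik]; exact h1 i
      · intro h1 i
        by_cases hij : i = j
        · rw [hij, hy0]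
        · by_cases hik : i = k
          · have h2 := h1 j
            rw [hproj] at h2
            simp only [hξ, (coord_edge hjk j y _).1, hy0, zero_add] at h2
            rwa [hik]
          · have h2 := h1 i
            rw [hproj] at h2
            simpa only [hξ, (coord_edge hjk i y _).2.2 hij hik] using h2
    by_cases hyS : y ∈ S
    · rw [Set.indicator_of_mem hyS, Set.indicator_of_mem (by exact hiff.1 hyS)]
    · rw [Set.indicator_of_notMem hyS, Set.indicator_of_notMem (by exact fun h => hyS (hiff.2 h))]
  · refine integral_congr_ae ?_
    filter_upwards [ae_hyperplane (n k) (c k)] with y hy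
    have hy0 : b.coord k y = 0 := (H.coord_eq_zero_iff k y).2 hy
    have : proj y = y := by simp [hproj, hy0]
    by_cases hyS : y ∈ S
    · rw [Set.indicator_of_mem hyS, Set.indicator_of_mem (by rw [Set.mem_preimage, this]; exact hyS),
        this]
    · rw [Set.indicator_of_notMem hyS,
        Set.indicator_of_notMem (by rw [Set.mem_preimage, this]; exact hyS)]

end FacetNormals

lemma hyperplaneMeasure_lt_top_of_isCompact {d : ℕ} {n : Pt d} (hn : ‖n‖ = 1) (c : ℝ)
    {K : Set (Pt d)} (hK : IsCompact K) : hyperplaneMeasure n c K < ⊤ := by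
  have hf : Isometry (fun w : (ℝ ∙ n)ᗮ => (w : Pt d) + c • n) := by
    intro y z
    simp only [edist_add_right]
    rfl
  rw [hyperplaneMeasure_eq_map hn, Measure.map_apply hf.continuous.measurable hK.measurableSet]
  exact (hf.isClosedEmbedding.isCompact_preimage hK).measure_lt_top

lemma integrableOn_hyperplaneMeasure {d : ℕ} {n : Pt d} (hn : ‖n‖ = 1) (c : ℝ)
    {K : Set (Pt d)} (hK : IsCompact K) {f : Pt d → ℝ} (hf : Continuous f) :
    IntegrableOn f K (hyperplaneMeasure n c) :=
  hf.continuousOn.integrableOn_of_subset_isCompact hK hK.measurableSet subset_rfl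
    (hyperplaneMeasure_lt_top_of_isCompact hn c hK).ne

/-- The divergence theorem on a simplex, for the constant direction `ξ`. -/
theorem FacetNormals.integral_fderiv {d : ℕ} {ι : Type*} [Fintype ι] {b : AffineBasis ι ℝ (Pt d)}
    {n : ι → Pt d} {h c : ι → ℝ} (H : FacetNormals b n h c) {f : Pt d → ℝ}
    (hf : ContDiff ℝ 1 f) (ξ : Pt d) :
    ∫ x in convexHull ℝ (Set.range b), fderiv ℝ f x ξ =
      ∑ i, inner ℝ (n i) ξ *
        ∫ x in convexHull ℝ (Set.range b), f x ∂(hyperplaneMeasure (n i) (c i)) := by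
  classical
  have hSc : IsCompact (convexHull ℝ (Set.range b)) := isCompact_simplex b
  have hint : IntegrableOn (fderiv ℝ f) (convexHull ℝ (Set.range b)) :=
    (hf.continuous_fderiv one_ne_zero).continuousOn.integrableOn_compact hSc
  have hfi : ∀ i, IntegrableOn f (convexHull ℝ (Set.range b)) (hyperplaneMeasure (n i) (c i)) :=
    fun i => integrableOn_hyperplaneMeasure (H.norm_eq i) _ hSc hf.continuous
  -- both sides are linear in `ξ`, so it suffices to treat the edge vectors
  set L : Pt d →ₗ[ℝ] ℝ :=
    (∫ x in convexHull ℝ (Set.range b), fderiv ℝ f x : Pt d →L[ℝ] ℝ).toLinearMap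
  set R : Pt d →ₗ[ℝ] ℝ := ∑ i, (∫ x in convexHull ℝ (Set.range b), f x
    ∂(hyperplaneMeasure (n i) (c i))) • (innerSL ℝ (n i)).toLinearMap
  have hL : ∀ ξ, L ξ = ∫ x in convexHull ℝ (Set.range b), fderiv ℝ f x ξ := fun ξ =>
    ContinuousLinearMap.integral_apply hint ξ
  have hR : ∀ ξ, R ξ = ∑ i, inner ℝ (n i) ξ *
      ∫ x in convexHull ℝ (Set.range b), f x ∂(hyperplaneMeasure (n i) (c i)) := fun ξ => by
    simp [R, mul_comm]
  rw [← hL, ← hR]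
  obtain ⟨k⟩ := b.nonempty
  refine LinearMap.congr_fun ((b.basisOf k).ext fun j => ?_) ξ
  obtain ⟨j, hjk⟩ := j
  rw [b.basisOf_apply, vsub_eq_sub, hL, hR, H.integral_fderiv_edge hjk hf]
  obtain ⟨h1, h2, h3⟩ := H.inner_edge hjk
  rw [← Finset.add_sum_erase _ _ (Finset.mem_univ j),
    ← Finset.add_sum_erase _ _ (Finset.mem_erase.2 ⟨Ne.symm hjk, Finset.mem_univ k⟩),
    Finset.sum_eq_zero fun i hi => ?_, h1, h2]
  · have hcont : Continuous fun y => f (y + b.coord k y • (b j - b k)) := by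
      have := continuous_coord b k
      have := hf.continuous
      fun_prop
    rw [integral_sub (integrableOn_hyperplaneMeasure (H.norm_eq j) _ hSc hcont) (hfi j), mul_sub,
      H.integral_facet_edge hjk hf.continuous]
    ring
  · simp only [Finset.mem_erase, Finset.mem_univ, and_true] at hi
    rw [h3 i hi.2 hi.1, zero_mul]

/-! ### Simplices given by their vertices -/

/-- `T` is the vertex set of a nondegenerate `d`-simplex. -/
structure IsSimplex {d : ℕ} (T : Finset (Pt d)) : Prop where
  indep : AffineIndependent ℝ ((↑) : T → Pt d)
  card_eq : T.card = d + 1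

namespace IsSimplex

variable {d : ℕ} {T : Finset (Pt d)}

/-- The vertices of a `d`-simplex, as an affine basis. -/
def basis (hT : IsSimplex T) : AffineBasis T ℝ (Pt d) :=
  ⟨(↑), hT.indep, (hT.indep.affineSpan_eq_top_iff_card_eq_finrank_add_one).2 (by
    simp [hT.card_eq])⟩

@[simp] lemma basis_apply (hT : IsSimplex T) (p : T) : hT.basis p = p := rfl

lemma convexHull_range (hT : IsSimplex T) : convexHull ℝ (Set.range hT.basis) = cell T := by
  have : Set.range hT.basis = (T : Set (Pt d)) := by
    ext x
    simp
  rw [this, cell]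

lemma mem_cell (hT : IsSimplex T) {x : Pt d} : x ∈ cell T ↔ ∀ p, 0 ≤ hT.basis.coord p x := by
  rw [← hT.convexHull_range]
  exact FacetNormals.mem_simplex

/-- The barycentric coordinate of the vertex `p` (zero if `p` is not a vertex). -/
def bary (hT : IsSimplex T) (p : Pt d) : Pt d →ᵃ[ℝ] ℝ :=
  if h : p ∈ T then hT.basis.coord ⟨p, h⟩ else 0

lemma bary_of_mem (hT : IsSimplex T) {p : Pt d} (h : p ∈ T) :
    hT.bary p = hT.basis.coord ⟨p, h⟩ := dif_pos h

lemma bary_coe (hT : IsSimplex T) (p : T) : hT.bary p = hT.basis.coord p := dif_pos p.2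

lemma sum_bary (hT : IsSimplex T) (x : Pt d) : ∑ p ∈ T, hT.bary p x = 1 := by
  rw [← Finset.sum_coe_sort]
  simp only [bary_coe]
  exact hT.basis.sum_coord_apply_eq_one x

lemma sum_bary_smul (hT : IsSimplex T) (x : Pt d) : ∑ p ∈ T, hT.bary p x • p = x := by
  rw [← Finset.sum_coe_sort]
  simp only [bary_coe]
  exact hT.basis.linear_combination_coord_eq_self x

lemma bary_nonneg (hT : IsSimplex T) {x : Pt d} (hx : x ∈ cell T) (p : Pt d) :
    0 ≤ hT.bary p x := by
  by_cases h : p ∈ T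
  · rw [hT.bary_of_mem h]
    exact hT.mem_cell.1 hx _
  · simp [bary, h]

lemma mem_cell_of_bary (hT : IsSimplex T) {x : Pt d} (hx : ∀ p ∈ T, 0 ≤ hT.bary p x) :
    x ∈ cell T :=
  hT.mem_cell.2 fun p => by rw [← bary_coe]; exact hx p p.2

lemma bary_self (hT : IsSimplex T) {p : Pt d} (hp : p ∈ T) : hT.bary p p = 1 := by
  rw [hT.bary_of_mem hp]
  exact hT.basis.coord_apply_eq ⟨p, hp⟩

lemma bary_of_ne (hT : IsSimplex T) {p q : Pt d} (hq : q ∈ T) (hpq : p ≠ q) :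
    hT.bary p q = 0 := by
  by_cases h : p ∈ T
  · rw [hT.bary_of_mem h]
    exact hT.basis.coord_apply_ne (i := ⟨p, h⟩) (j := ⟨q, hq⟩) fun h' => hpq (Subtype.ext_iff.1 h')
  · simp [bary, h]

lemma sum_coord_smul (hT : IsSimplex T) (x : Pt d) :
    ∑ p : T, hT.basis.coord p x • (p : Pt d) = x :=
  hT.basis.linear_combination_coord_eq_self x

lemma card_erase (hT : IsSimplex T) {p : Pt d} (hp : p ∈ T) : (T.erase p).card = d := by
  rw [Finset.card_erase_of_mem hp, hT.card_eq]
  rfl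

lemma centroid_sub (hT : IsSimplex T) (hd : 1 ≤ d) {p : Pt d} (hp : p ∈ T) :
    (T.erase p).centroid ℝ id - T.centroid ℝ id =
      ((d : ℝ) + 1)⁻¹ • ((T.erase p).centroid ℝ id - p) := by
  have hd0 : (d : ℝ) ≠ 0 := by positivity
  have hne : (T.erase p).Nonempty := Finset.card_pos.1 (by rw [hT.card_erase hp]; omega)
  have h1 : (T.erase p).centroid ℝ id = (d : ℝ)⁻¹ • ∑ q ∈ T.erase p, q := by
    rw [Finset.centroid_eq_centerMass _ hne, Finset.centerMass]
    simp [Finset.centroidWeights, hT.card_erase hp, hd0, Finset.smul_sum]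
  have h2 : T.centroid ℝ id = ((d : ℝ) + 1)⁻¹ • ∑ q ∈ T, q := by
    rw [Finset.centroid_eq_centerMass _ ⟨p, hp⟩, Finset.centerMass]
    have : (d : ℝ) + 1 ≠ 0 := by positivity
    simp [Finset.centroidWeights, hT.card_eq, this, Finset.smul_sum]
  rw [h2, ← Finset.add_sum_erase _ _ hp, h1]
  have : (d : ℝ) + 1 ≠ 0 := by positivity
  match_scalars
  · field_simp
    ring
  · simp

lemma notMem_affineSpan_erase (hT : IsSimplex T) {p : Pt d} (hp : p ∈ T) :
    p ∉ affineSpan ℝ ((T.erase p : Finset (Pt d)) : Set (Pt d)) := by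
  have h := hT.indep.notMem_affineSpan_sdiff ⟨p, hp⟩ Set.univ
  convert! h using 4
  ext x
  simp [and_comm]

/-- The outward normal of a facet is a unit vector, its inner product is constant on the vertices of
the facet, and it points away from the opposite vertex. -/
lemma inner_outwardNormal (hT : IsSimplex T) (hd : 1 ≤ d) {p : Pt d} (hp : p ∈ T) :
    ‖outwardNormal T (T.erase p)‖ = 1 ∧
    (∀ q ∈ T.erase p, inner ℝ (outwardNormal T (T.erase p)) q =
      inner ℝ (outwardNormal T (T.erase p)) ((T.erase p).centroid ℝ id)) ∧
    (∀ q ∈ T.erase p, 0 < inner ℝ (outwardNormal T (T.erase p)) (q - p)) := by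
  set e := T.erase p with he
  have hne : e.Nonempty := Finset.card_pos.1 (by rw [he, hT.card_erase hp]; omega)
  set W := vectorSpan ℝ (e : Set (Pt d)) with hW
  set u := e.centroid ℝ id - T.centroid ℝ id with hu
  set m := e.centroid ℝ id with hm
  have hmem : m ∈ affineSpan ℝ (e : Set (Pt d)) :=
    by
      have h := centroid_mem_affineSpan_of_nonempty ℝ ((↑) : e → Pt d) (s := Finset.univ)
        (Finset.univ_nonempty_iff.2 hne.to_subtype)
      rw [Subtype.range_coe_subtype] at h
      rwa [Finset.centroid_univ] at h
  have hu' : u = ((d : ℝ) + 1)⁻¹ • (m - p) := hT.centroid_sub hd hp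
  set P := Wᗮ.starProjection u with hP
  have hPW : P ∈ Wᗮ := by
    rw [hP]; exact Submodule.starProjection_apply_mem _ _
  -- `u` and its projection `P` have the same inner products with the normal directions
  have hinner : ∀ x ∈ Wᗮ, inner ℝ x u = inner ℝ x P := by
    intro x hx
    have : u - P ∈ Wᗮᗮ := Submodule.sub_starProjection_mem_orthogonal u
    have h := (Submodule.mem_orthogonal _ _).1 this x hx
    rw [inner_sub_right] at h
    linarith
  have hP0 : P ≠ 0 := by
    intro h0
    have : u ∈ W := by
      have h1 : u - P ∈ Wᗮᗮ := Submodule.sub_starProjection_mem_orthogonal u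
      rw [h0, sub_zero, Submodule.orthogonal_orthogonal] at h1
      exact h1
    have hd1 : (d : ℝ) + 1 ≠ 0 := by positivity
    have h2 : m - p ∈ W := by
      have := W.smul_mem ((d : ℝ) + 1) this
      rwa [hu', smul_inv_smul₀ hd1] at this
    apply hT.notMem_affineSpan_erase hp
    rw [← he]
    have h3 := AffineSubspace.vadd_mem_of_mem_direction
      (s := affineSpan ℝ (e : Set (Pt d))) (v := -(m - p)) (by
        rw [direction_affineSpan]; exact W.neg_mem h2) hmem
    simpa using h3
  have hPpos : 0 < ‖P‖ := norm_pos_iff.2 hP0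
  have hN : outwardNormal T e = ‖P‖⁻¹ • P := rfl
  have hconst : ∀ x ∈ affineSpan ℝ (e : Set (Pt d)), ∀ y ∈ affineSpan ℝ (e : Set (Pt d)),
      inner ℝ (outwardNormal T e) (x - y) = 0 := by
    intro x hx y hy
    have h1 : x - y ∈ W := by
      have := AffineSubspace.vsub_mem_direction hx hy
      rwa [direction_affineSpan] at this
    rw [hN, inner_smul_left, (Submodule.mem_orthogonal' _ _).1 hPW _ h1, mul_zero]
  have hsub : ∀ q ∈ e, q ∈ affineSpan ℝ (e : Set (Pt d)) := fun q hq =>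
    subset_affineSpan ℝ _ (by exact_mod_cast hq)
  refine ⟨?_, fun q hq => ?_, fun q hq => ?_⟩
  · rw [hN, norm_smul, norm_inv, norm_norm, inv_mul_cancel₀ hPpos.ne']
  · have := hconst q (hsub q hq) m hmem
    rw [inner_sub_right] at this
    linarith
  · have h1 : q - p = (q - m) + ((d : ℝ) + 1) • u := by
      have hd1 : (d : ℝ) + 1 ≠ 0 := by positivity
      rw [hu', smul_inv_smul₀ hd1]
      abel
    rw [h1, inner_add_right, hconst q (hsub q hq) m hmem, zero_add, inner_smul_right, hN,
      inner_smul_left, hinner P hPW, real_inner_self_eq_norm_sq]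
    simp only [conj_trivial]
    positivity

/-- The level of the supporting hyperplane of the facet opposite to `p`. -/
def level (T : Finset (Pt d)) (p : Pt d) : ℝ :=
  inner ℝ (outwardNormal T (T.erase p)) ((T.erase p).centroid ℝ id)

/-- The height of the simplex `T` over the facet opposite to `p`. -/
def height (T : Finset (Pt d)) (p : Pt d) : ℝ :=
  level T p - inner ℝ (outwardNormal T (T.erase p)) p

lemma level_eq (hT : IsSimplex T) (hd : 1 ≤ d) {p q : Pt d} (hp : p ∈ T) (hq : q ∈ T.erase p) :
    level T p = inner ℝ (outwardNormal T (T.erase p)) q :=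
  ((hT.inner_outwardNormal hd hp).2.1 q hq).symm

/-- The outward normals of a simplex, with the heights and levels of its facets. -/
lemma facetNormals (hT : IsSimplex T) (hd : 1 ≤ d) :
    FacetNormals hT.basis (fun p => outwardNormal T (T.erase p)) (fun p => height T p)
      (fun p => level T p) where
  norm_eq p := (hT.inner_outwardNormal hd p.2).1
  height_pos p := by
    have hne : (T.erase (p : Pt d)).Nonempty :=
      Finset.card_pos.1 (by rw [hT.card_erase p.2]; omega)
    obtain ⟨q, hq⟩ := hne
    have := (hT.inner_outwardNormal hd p.2).2.2 q hq
    rw [height, hT.level_eq hd p.2 hq, ← inner_sub_right]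
    exact this
  coord_mul p x := by
    conv_rhs => rw [← hT.sum_coord_smul x, inner_sum]
    have hterm : ∀ q : T, inner ℝ (outwardNormal T (T.erase p)) (hT.basis.coord q x • (q : Pt d)) =
        hT.basis.coord q x * level T p - if q = p then hT.basis.coord q x * height T p else 0 := by
      intro q
      rw [inner_smul_right]
      split_ifs with h
      · rw [h, height]; ring
      · rw [hT.level_eq hd p.2 (q := q) (Finset.mem_erase.2 ⟨fun h' => h (Subtype.ext h'), q.2⟩),
          sub_zero]
    rw [Finset.sum_congr rfl fun q _ => hterm q, Finset.sum_sub_distrib, ← Finset.sum_mul,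
      hT.basis.sum_coord_apply_eq_one, Finset.sum_ite_eq' Finset.univ p]
    simp

/-- The face spanned by `s` is the part of the simplex where the barycentric coordinates of the
other vertices vanish. -/
lemma cell_eq_of_subset (hT : IsSimplex T) {s : Finset (Pt d)} (hs : s ⊆ T) :
    cell s = {x | x ∈ cell T ∧ ∀ p ∉ s, hT.bary p x = 0} := by
  apply Set.Subset.antisymm
  · refine convexHull_min ?_ ?_
    · intro q hq
      have hq' : q ∈ s := hq
      refine ⟨subset_convexHull ℝ _ (hs hq'), fun p hp => ?_⟩
      exact hT.bary_of_ne (hs hq') fun h => hp (h ▸ hq')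
    · have : {x | x ∈ cell T ∧ ∀ p ∉ s, hT.bary p x = 0} =
          cell T ∩ ⋂ p ∉ s, hT.bary p ⁻¹' {0} := by
        ext x
        simp
      rw [this]
      exact (convex_convexHull ℝ _).inter (convex_iInter fun p => convex_iInter fun _ =>
        (convex_singleton (0 : ℝ)).affine_preimage (hT.bary p))
  · rintro x ⟨hx, hx0⟩
    rw [cell, Finset.mem_convexHull']
    refine ⟨fun q => hT.bary q x, fun q _ => hT.bary_nonneg hx q, ?_, ?_⟩
    · rw [← hT.sum_bary x]
      exact Finset.sum_subset hs fun p _ hp => hx0 p hp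
    · conv_rhs => rw [← hT.sum_bary_smul x]
      exact Finset.sum_subset hs fun p _ hp => by simp [hx0 p hp]

lemma cell_erase_eq (hT : IsSimplex T) (p : Pt d) :
    cell (T.erase p) = {x | x ∈ cell T ∧ hT.bary p x = 0} := by
  rw [hT.cell_eq_of_subset (T.erase_subset p)]
  ext x
  refine and_congr_right fun _ => ⟨fun h => h p (by simp), fun h q hq => ?_⟩
  by_cases hqp : q = p
  · rw [hqp, h]
  · have : q ∉ T := fun h' => hq (Finset.mem_erase.2 ⟨hqp, h'⟩)
    simp [bary, this]

lemma height_pos (hT : IsSimplex T) (hd : 1 ≤ d) {p : Pt d} (hp : p ∈ T) : 0 < height T p :=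
  (hT.facetNormals hd).height_pos ⟨p, hp⟩

lemma norm_outwardNormal (hT : IsSimplex T) (hd : 1 ≤ d) {p : Pt d} (hp : p ∈ T) :
    ‖outwardNormal T (T.erase p)‖ = 1 :=
  (hT.inner_outwardNormal hd hp).1

/-- The barycentric coordinate of `p` is the distance to the opposite facet, in units of the height
over this facet. -/
lemma bary_mul_height (hT : IsSimplex T) (hd : 1 ≤ d) {p : Pt d} (hp : p ∈ T) (x : Pt d) :
    hT.bary p x * height T p = level T p - inner ℝ (outwardNormal T (T.erase p)) x := by
  rw [hT.bary_of_mem hp]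
  exact (hT.facetNormals hd).coord_mul ⟨p, hp⟩ x

/-- The surface measure of a facet is the restriction to the simplex of the surface measure of its
supporting hyperplane. -/
lemma surf_erase (hT : IsSimplex T) (hd : 1 ≤ d) {p : Pt d} (hp : p ∈ T) :
    surf (T.erase p) =
      (hyperplaneMeasure (outwardNormal T (T.erase p)) (level T p)).restrict (cell T) := by
  rw [hyperplaneMeasure, Measure.restrict_restrict (Triangulation.isCompact_cell T).measurableSet,
    surf]
  congr 1
  rw [hT.cell_erase_eq _]
  ext x
  refine and_congr_right fun _ => ?_
  rw [hT.bary_of_mem hp]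
  exact (hT.facetNormals hd).coord_eq_zero_iff ⟨p, hp⟩ x

/-- The divergence theorem on a simplex given by its vertices. -/
theorem setIntegral_fderiv (hT : IsSimplex T) (hd : 1 ≤ d) {f : Pt d → ℝ} (hf : ContDiff ℝ 1 f)
    (ξ : Pt d) :
    ∫ x in cell T, fderiv ℝ f x ξ =
      ∑ p ∈ T, inner ℝ (outwardNormal T (T.erase p)) ξ * ∫ x, f x ∂(surf (T.erase p)) := by
  rw [← hT.convexHull_range, (hT.facetNormals hd).integral_fderiv hf ξ, hT.convexHull_range,
    ← Finset.sum_coe_sort T]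
  exact Finset.sum_congr rfl fun p _ => by rw [hT.surf_erase hd p.2]

end IsSimplex

/-! ### Shape-regular simplices -/

/-- A nondegenerate simplex that contains a ball of radius its diameter divided by `σ`. -/
structure IsShapeRegularSimplex {d : ℕ} (σ : ℝ) (T : Finset (Pt d)) : Prop extends
    IsSimplex T where
  exists_ball : ∃ c : Pt d, Metric.ball c (Metric.diam (cell T) / σ) ⊆ cell T

/-- The diameter of a simplex. -/
abbrev cellDiam {d : ℕ} (T : Finset (Pt d)) : ℝ := Metric.diam (cell T)

lemma dist_le_cellDiam {d : ℕ} {T : Finset (Pt d)} {x y : Pt d} (hx : x ∈ cell T)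
    (hy : y ∈ cell T) : dist x y ≤ cellDiam T :=
  Metric.dist_le_diam_of_mem (Triangulation.isCompact_cell T).isBounded hx hy

lemma mem_cell_of_mem {d : ℕ} {T : Finset (Pt d)} {p : Pt d} (hp : p ∈ T) : p ∈ cell T :=
  subset_convexHull ℝ _ hp

lemma volume_cell_lt_top {d : ℕ} (T : Finset (Pt d)) : volume (cell T) < ⊤ :=
  (Triangulation.isCompact_cell T).measure_lt_top

/-- The volume of the unit ball. -/
def unitBallVolume (d : ℕ) : ℝ := volume.real (Metric.ball (0 : Pt d) 1)

lemma unitBallVolume_pos (d : ℕ) : 0 < unitBallVolume d :=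
  ENNReal.toReal_pos (Metric.measure_ball_pos _ _ one_pos).ne' measure_ball_lt_top.ne

lemma volume_real_ball {d : ℕ} (c : Pt d) {r : ℝ} (hr : 0 < r) :
    volume.real (Metric.ball c r) = r ^ d * unitBallVolume d := by
  rw [unitBallVolume, measureReal_def, Measure.addHaar_ball_of_pos _ _ hr, ENNReal.toReal_mul,
    ENNReal.toReal_ofReal (by positivity), finrank_euclideanSpace_fin, measureReal_def]

lemma volume_real_closedBall {d : ℕ} (c : Pt d) {r : ℝ} (hr : 0 ≤ r) :
    volume.real (Metric.closedBall c r) = r ^ d * unitBallVolume d := by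
  rw [unitBallVolume, measureReal_def, Measure.addHaar_closedBall _ _ hr, ENNReal.toReal_mul,
    ENNReal.toReal_ofReal (by positivity), finrank_euclideanSpace_fin, measureReal_def]

namespace IsSimplex

variable {d : ℕ} {T : Finset (Pt d)}

lemma exists_mem_erase (hT : IsSimplex T) (hd : 1 ≤ d) {p : Pt d} (hp : p ∈ T) :
    ∃ q, q ∈ T.erase p :=
  Finset.card_pos.1 (by rw [hT.card_erase hp]; omega)

lemma nonempty (hT : IsSimplex T) : T.Nonempty :=
  Finset.card_pos.1 (by rw [hT.card_eq]; omega)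

lemma cellDiam_pos (hT : IsSimplex T) (hd : 1 ≤ d) : 0 < cellDiam T := by
  obtain ⟨p, hp⟩ := hT.nonempty
  obtain ⟨q, hq⟩ := hT.exists_mem_erase hd hp
  exact (dist_pos.2 (Finset.ne_of_mem_erase hq)).trans_le
    (dist_le_cellDiam (mem_cell_of_mem (Finset.mem_of_mem_erase hq)) (mem_cell_of_mem hp))

lemma height_le (hT : IsSimplex T) (hd : 1 ≤ d) {p : Pt d} (hp : p ∈ T) :
    height T p ≤ cellDiam T := by
  obtain ⟨q, hq⟩ := hT.exists_mem_erase hd hp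
  rw [height, hT.level_eq hd hp hq, ← inner_sub_right]
  refine (real_inner_le_norm _ _).trans ?_
  rw [hT.norm_outwardNormal hd hp, one_mul, ← dist_eq_norm]
  exact dist_le_cellDiam (mem_cell_of_mem (Finset.mem_of_mem_erase hq)) (mem_cell_of_mem hp)

lemma bary_le_one (hT : IsSimplex T) {x : Pt d} (hx : x ∈ cell T) (p : Pt d) :
    hT.bary p x ≤ 1 := by
  by_cases hp : p ∈ T
  · rw [← hT.sum_bary x]
    exact Finset.single_le_sum (f := fun p => hT.bary p x) (fun q _ => hT.bary_nonneg hx q) hp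
  · simp [bary, hp]

/-- The heights of a simplex are bounded below by the radius of an inscribed ball. -/
lemma le_height (hT : IsSimplex T) (hd : 1 ≤ d) {p : Pt d} (hp : p ∈ T) {c : Pt d} {r : ℝ}
    (hr : 0 < r) (hb : Metric.ball c r ⊆ cell T) : r ≤ height T p := by
  set n := outwardNormal T (T.erase p)
  have hn : ‖n‖ = 1 := hT.norm_outwardNormal hd hp
  have key : ∀ s : ℝ, |s| < r → c + s • n ∈ cell T := fun s hs => hb (by
    rw [Metric.mem_ball, dist_eq_norm, add_sub_cancel_left, norm_smul, hn, mul_one]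
    exact hs)
  -- between these two points on a normal line of the facet, the barycentric coordinate of `p`,
  -- which lies in `[0, 1]`, changes by `r` divided by the height
  have h1 := key (r / 2) (by rw [abs_of_pos (by positivity)]; linarith)
  have h2 := key (-(r / 2)) (by rw [abs_neg, abs_of_pos (by positivity)]; linarith)
  have e1 := hT.bary_mul_height hd hp (c + (r / 2) • n)
  have e2 := hT.bary_mul_height hd hp (c + (-(r / 2)) • n)
  rw [inner_add_right, inner_smul_right, real_inner_self_eq_norm_sq, hn] at e1 e2
  have b1 := hT.bary_nonneg h1 p
  have b2 := hT.bary_le_one h2 p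
  have hh := hT.height_pos hd hp
  nlinarith [mul_nonneg b1 hh.le, mul_le_mul_of_nonneg_right b2 hh.le]

/-- The volume of a simplex in terms of the area of a facet and the height over it. -/
lemma dim_mul_volume (hT : IsSimplex T) (hd : 1 ≤ d) {p : Pt d} (hp : p ∈ T) :
    (d : ℝ) * volume.real (cell T) = height T p * (surf (T.erase p)).real Set.univ := by
  -- divergence theorem for the vector field `x - p`, which is tangential to the other facets
  have h1 : ∀ k : Fin d, volume.real (cell T) = ∑ q ∈ T,
      ∫ x, outwardNormal T (T.erase q) k * (x k - p k) ∂(surf (T.erase q)) := by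
    intro k
    set f : Pt d → ℝ := fun x => EuclideanSpace.proj (𝕜 := ℝ) k x - p k with hf
    have hfc : ContDiff ℝ 1 f := by fun_prop
    have h := hT.setIntegral_fderiv hd hfc (EuclideanSpace.single k 1)
    have hd' : ∀ x, fderiv ℝ f x (EuclideanSpace.single k 1) = 1 := by
      intro x
      simp only [hf, fderiv_sub_const, ContinuousLinearMap.fderiv]
      simp
    simp only [hd'] at h
    rw [setIntegral_const, smul_eq_mul, mul_one] at h
    rw [h]
    refine Finset.sum_congr rfl fun q hq => ?_
    rw [← integral_const_mul]
    refine integral_congr_ae (Filter.Eventually.of_forall fun x => ?_)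
    simp [hf, EuclideanSpace.inner_single_right]
  have hint : ∀ q ∈ T, ∀ g : Pt d → ℝ, Continuous g → Integrable g (surf (T.erase q)) := by
    intro q hq g hg
    rw [hT.surf_erase hd hq]
    exact integrableOn_hyperplaneMeasure (hT.norm_outwardNormal hd hq) _
      (Triangulation.isCompact_cell T) hg
  have h2 : (d : ℝ) * volume.real (cell T) = ∑ q ∈ T,
      ∫ x, inner ℝ (outwardNormal T (T.erase q)) (x - p) ∂(surf (T.erase q)) := by
    calc (d : ℝ) * volume.real (cell T) = ∑ k : Fin d, volume.real (cell T) := by simp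
      _ = ∑ k : Fin d, ∑ q ∈ T,
          ∫ x, outwardNormal T (T.erase q) k * (x k - p k) ∂(surf (T.erase q)) :=
        Finset.sum_congr rfl fun k _ => h1 k
      _ = _ := by
        rw [Finset.sum_comm]
        refine Finset.sum_congr rfl fun q hq => ?_
        rw [← integral_finsetSum _ fun k _ => hint q hq _ (by fun_prop)]
        refine integral_congr_ae (Filter.Eventually.of_forall fun x => ?_)
        simp [PiLp.inner_apply, mul_comm]
  have hval : ∀ q ∈ T, ∀ x ∈ cell (T.erase q),
      inner ℝ (outwardNormal T (T.erase q)) x = level T q := by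
    intro q hq x hx
    rw [hT.cell_erase_eq _] at hx
    have := hT.bary_mul_height hd hq x
    rw [hx.2, zero_mul] at this
    linarith
  rw [h2, ← Finset.add_sum_erase _ _ hp, Finset.sum_eq_zero, add_zero]
  · rw [integral_congr_ae (g := fun _ => height T p), integral_const, smul_eq_mul, mul_comm]
    filter_upwards [Triangulation.ae_surf_mem (T.erase p)] with x hx
    rw [inner_sub_right, hval p hp x hx, height]
  · intro q hq
    rw [integral_congr_ae (g := fun _ => (0 : ℝ)), integral_zero]
    filter_upwards [Triangulation.ae_surf_mem (T.erase q)] with x hx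
    have hq' := Finset.mem_of_mem_erase hq
    rw [inner_sub_right, hval q hq' x hx, hval q hq' p
      (mem_cell_of_mem (Finset.mem_erase.2 ⟨(Finset.ne_of_mem_erase hq).symm, hp⟩)), sub_self]

end IsSimplex

namespace IsShapeRegularSimplex

variable {d : ℕ} {T : Finset (Pt d)} {σ : ℝ}

lemma le_height (hT : IsShapeRegularSimplex σ T) (hσ : 0 < σ) (hd : 1 ≤ d) {p : Pt d}
    (hp : p ∈ T) : cellDiam T / σ ≤ IsSimplex.height T p := by
  obtain ⟨c, hc⟩ := hT.exists_ball
  exact hT.toIsSimplex.le_height hd hp (div_pos (hT.cellDiam_pos hd) hσ) hc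

lemma volume_le (hT : IsShapeRegularSimplex σ T) :
    volume.real (cell T) ≤ cellDiam T ^ d * unitBallVolume d := by
  obtain ⟨p, hp⟩ := hT.nonempty
  rw [← volume_real_closedBall p Metric.diam_nonneg]
  exact measureReal_mono (fun x hx => dist_le_cellDiam hx (mem_cell_of_mem hp))
    (measure_closedBall_lt_top).ne

lemma le_volume (hT : IsShapeRegularSimplex σ T) (hσ : 0 < σ) (hd : 1 ≤ d) :
    (cellDiam T / σ) ^ d * unitBallVolume d ≤ volume.real (cell T) := by
  obtain ⟨c, hc⟩ := hT.exists_ball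
  rw [← volume_real_ball c (div_pos (hT.cellDiam_pos hd) hσ)]
  exact measureReal_mono hc (volume_cell_lt_top T).ne

/-- The area of a facet is comparable to the power `d - 1` of the diameter, because `d` times the
volume is the product of the area and the height. -/
lemma area_bounds (hT : IsShapeRegularSimplex σ T) (hσ : 0 < σ) (hd : 1 ≤ d) {p : Pt d}
    (hp : p ∈ T) :
    (d * unitBallVolume d * σ⁻¹ ^ d) * cellDiam T ^ (d - 1) ≤ (surf (T.erase p)).real Set.univ ∧
    (surf (T.erase p)).real Set.univ ≤ (d * unitBallVolume d * σ) * cellDiam T ^ (d - 1) := by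
  have hh := hT.cellDiam_pos hd
  have hω := unitBallVolume_pos d
  have hvol := hT.dim_mul_volume hd hp
  have hH := hT.height_pos hd hp
  have hpow : cellDiam T ^ d = cellDiam T ^ (d - 1) * cellDiam T := by
    rw [← pow_succ]; congr 1; omega
  have h1 := hT.height_le hd hp
  have h2 := hT.le_height hσ hd hp
  have h3 := hT.volume_le
  have h4 := hT.le_volume hσ hd
  have ha : 0 ≤ (surf (T.erase p)).real Set.univ := measureReal_nonneg
  have hdpos : (0 : ℝ) < d := by exact_mod_cast hd
  constructor
  · refine le_of_mul_le_mul_left ?_ hh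
    calc cellDiam T * (d * unitBallVolume d * σ⁻¹ ^ d * cellDiam T ^ (d - 1))
        = d * ((cellDiam T / σ) ^ d * unitBallVolume d) := by
          rw [div_eq_mul_inv, mul_pow, hpow]; ring
      _ ≤ d * volume.real (cell T) := by gcongr
      _ = _ := hvol
      _ ≤ _ := by gcongr
  · refine le_of_mul_le_mul_left ?_ (div_pos hh hσ)
    calc cellDiam T / σ * (surf (T.erase p)).real Set.univ
        ≤ IsSimplex.height T p * (surf (T.erase p)).real Set.univ := by gcongr
      _ = d * volume.real (cell T) := hvol.symm
      _ ≤ d * (cellDiam T ^ d * unitBallVolume d) := by gcongr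
      _ = _ := by rw [hpow]; field_simp

end IsShapeRegularSimplex

/-- Scaling of facets of shape-regular simplices: area, size and volume are comparable to the
corresponding powers of the diameter. -/
lemma exists_facet_scaling {d : ℕ} (hd : 2 ≤ d) {σ : ℝ} (hσ : 0 < σ) :
    ∃ C : ℝ, 0 < C ∧ ∀ T : Finset (Pt d), IsShapeRegularSimplex σ T → ∀ p ∈ T,
      0 < faceSize (T.erase p) ∧
      faceSize (T.erase p) * (surf (T.erase p)).real Set.univ ≤ C * volume.real (cell T) ∧
      (faceSize (T.erase p))⁻¹ * (surf (T.erase p)).real Set.univ * cellDiam T ^ 2 ≤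
        C * volume.real (cell T) := by
  set s : ℝ := 1 / ((d : ℝ) - 1) with hs
  have hω := unitBallVolume_pos d
  have hd' : (0 : ℝ) < (d : ℝ) - 1 := by
    have : (2 : ℝ) ≤ d := by exact_mod_cast hd
    linarith
  have hdpos : (0 : ℝ) < d := by linarith
  have hs0 : 0 < s := by positivity
  set a : ℝ := d * unitBallVolume d * σ⁻¹ ^ d with ha
  set b : ℝ := d * unitBallVolume d * σ with hb
  have ha0 : 0 < a := by positivity
  have hb0 : 0 < b := by positivity
  set v : ℝ := unitBallVolume d * σ⁻¹ ^ d with hv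
  have hv0 : 0 < v := by positivity
  have has : 0 < a ^ s := Real.rpow_pos_of_pos ha0 _
  have hbs : 0 < b ^ s := Real.rpow_pos_of_pos hb0 _
  refine ⟨b ^ s * b / v + (a ^ s)⁻¹ * b / v, by positivity, fun T hT p hp => ?_⟩
  obtain ⟨h1, h2⟩ := hT.area_bounds hσ (by omega) hp
  have hh := hT.cellDiam_pos (by omega)
  have h4 := hT.le_volume hσ (by omega)
  set h := cellDiam T with hhdef
  set A := (surf (T.erase p)).real Set.univ with hA
  have hroot : (h ^ (d - 1)) ^ s = h := by
    rw [← Real.rpow_natCast, ← Real.rpow_mul hh.le, hs, Nat.cast_sub (by omega), Nat.cast_one,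
      mul_one_div_cancel hd'.ne', Real.rpow_one]
  have hA0 : 0 < A := lt_of_lt_of_le (by positivity) h1
  have f1 : a ^ s * h ≤ A ^ s := by
    rw [← hroot, ← Real.mul_rpow ha0.le (by positivity)]
    exact Real.rpow_le_rpow (by positivity) h1 hs0.le
  have f2 : A ^ s ≤ b ^ s * h := by
    rw [← hroot, ← Real.mul_rpow hb0.le (by positivity)]
    exact Real.rpow_le_rpow hA0.le h2 hs0.le
  have hpow : h ^ d = h ^ (d - 1) * h := by
    rw [← pow_succ]; congr 1; omega
  have hvol : v * (h ^ (d - 1) * h) ≤ volume.real (cell T) := by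
    refine le_trans (le_of_eq ?_) h4
    rw [hv, ← hpow, div_eq_mul_inv, mul_pow]
    ring
  have hF : faceSize (T.erase p) = A ^ s := rfl
  have hAs : 0 < A ^ s := Real.rpow_pos_of_pos hA0 _
  have hV0 : 0 ≤ volume.real (cell T) := measureReal_nonneg
  rw [hF]
  refine ⟨hAs, ?_, ?_⟩
  · calc A ^ s * A ≤ (b ^ s * h) * (b * h ^ (d - 1)) := by gcongr
      _ = b ^ s * b / v * (v * (h ^ (d - 1) * h)) := by field_simp
      _ ≤ b ^ s * b / v * volume.real (cell T) := by gcongr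
      _ ≤ _ := by
        refine mul_le_mul_of_nonneg_right ?_ hV0
        have : 0 ≤ (a ^ s)⁻¹ * b / v := by positivity
        linarith
  · calc (A ^ s)⁻¹ * A * h ^ 2 ≤ (a ^ s * h)⁻¹ * (b * h ^ (d - 1)) * h ^ 2 := by gcongr
      _ = (a ^ s)⁻¹ * b / v * (v * (h ^ (d - 1) * h)) := by field_simp
      _ ≤ (a ^ s)⁻¹ * b / v * volume.real (cell T) := by gcongr
      _ ≤ _ := by
        refine mul_le_mul_of_nonneg_right ?_ hV0
        have : 0 ≤ b ^ s * b / v := by positivity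
        linarith

/-! ### Inverse estimates for quadratic polynomials -/

lemma EqQuadraticOn.continuous {d : ℕ} {q : Pt d → ℝ} (hq : EqQuadraticOn q Set.univ) :
    Continuous q := by
  obtain ⟨c, b, A, h⟩ := hq
  rw [show q = fun x => c + b x + A x x from funext fun x => h x trivial]
  exact (Triangulation.quad_contDiff c b A).continuous

/-- Extrapolation of a quadratic polynomial along a line. -/
lemma EqQuadraticOn.extrapolate {d : ℕ} {q : Pt d → ℝ} (hq : EqQuadraticOn q Set.univ)
    (ε : ℝ) (x y : Pt d) :
    2 * ε ^ 2 * q x = (1 - ε) * (1 - 2 * ε) * q y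
      - 2 * (1 - 2 * ε) * q ((1 - ε) • y + ε • x)
      + (1 - ε) * q ((1 - 2 * ε) • y + (2 * ε) • x) := by
  obtain ⟨c, b, A, h⟩ := hq
  simp only [h _ trivial, map_add, map_smul, add_apply,
    smul_apply, smul_eq_mul]
  ring

/-- `(z, v) ↦ a z + v` changes integrals by the factor `|a|⁻ᵈ`. -/
lemma setIntegral_homothety_le {d : ℕ} {F : Pt d → ℝ} (hF : Continuous F) (hF0 : ∀ x, 0 ≤ F x)
    {c v : Pt d} {a r ρ : ℝ} (ha : 1 / 2 ≤ a)
    (hsub : ∀ y ∈ Metric.ball c ρ, a • y + v ∈ Metric.ball c r) :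
    ∫ y in Metric.ball c ρ, F (a • y + v) ≤ 2 ^ d * ∫ y in Metric.ball c r, F y := by
  set G : Pt d → ℝ := (Metric.ball c r).indicator F with hG
  have hFi : ∀ r', IntegrableOn F (Metric.ball c r') := fun r' =>
    (hF.continuousOn.integrableOn_compact (isCompact_closedBall c r')).mono_set
      Metric.ball_subset_closedBall
  have hGi : Integrable G := (integrable_indicator_iff measurableSet_ball).2 (hFi r)
  have hG0 : ∀ x, 0 ≤ G x := fun x => Set.indicator_nonneg (fun x _ => hF0 x) x
  have ha0 : a ≠ 0 := by linarith
  have h1 : ∫ y, G (a • y + v) = |(a ^ d)⁻¹| * ∫ y, G y := by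
    have e1 := Measure.integral_comp_smul (volume : Measure (Pt d)) (fun y => G (y + v)) a
    rw [finrank_euclideanSpace_fin, integral_add_right_eq_self G v, smul_eq_mul] at e1
    exact e1
  have hGi' : Integrable fun y => G (a • y + v) :=
    (integrable_comp_smul_iff volume (fun y => G (y + v)) ha0).2 (hGi.comp_add_right v)
  have h2 : ∫ y in Metric.ball c ρ, F (a • y + v) ≤ ∫ y, G (a • y + v) := by
    rw [← integral_indicator measurableSet_ball]
    refine integral_mono ?_ hGi' fun y => ?_
    · rw [integrable_indicator_iff measurableSet_ball]
      refine (Continuous.continuousOn ?_).integrableOn_compact (isCompact_closedBall c ρ) |>.mono_set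
        Metric.ball_subset_closedBall
      fun_prop
    · by_cases hy : y ∈ Metric.ball c ρ
      · rw [Set.indicator_of_mem hy]
        simp only [hG, Set.indicator_of_mem (hsub y hy), le_refl]
      · rw [Set.indicator_of_notMem hy]
        exact hG0 _
  have h3 : |(a ^ d)⁻¹| ≤ 2 ^ d := by
    rw [abs_of_pos (by positivity), ← inv_pow]
    refine pow_le_pow_left₀ (by positivity) ?_ d
    rw [inv_le_comm₀ (by linarith) (by norm_num)]
    linarith
  rw [← integral_indicator (f := F) measurableSet_ball]
  refine h2.trans (h1.le.trans ?_)
  exact mul_le_mul_of_nonneg_right h3 (integral_nonneg hG0)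

/-- Inverse estimate: the maximum of a quadratic polynomial over a shape-regular simplex is
bounded by its mean square. The polynomial is extrapolated from points of a ball in the simplex,
and the result is averaged over the ball. -/
theorem exists_inverse_estimate (d : ℕ) (hd : 1 ≤ d) {σ : ℝ} (hσ : 0 < σ) :
    ∃ C : ℝ, 0 < C ∧ ∀ T : Finset (Pt d), IsShapeRegularSimplex σ T →
      ∀ q : Pt d → ℝ, EqQuadraticOn q Set.univ → ∀ x ∈ cell T,
        volume.real (cell T) * q x ^ 2 ≤ C * ∫ y in cell T, q y ^ 2 := by
  -- `x` has distance at most `σ r` from the center `c` of the inscribed ball of radius `r`; this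
  -- choice of `ε` keeps the points `(1 - s) y + s x` with `y` in the ball of radius `r / 2` and
  -- `s ≤ 2 ε` inside the inscribed ball
  set ε : ℝ := 1 / (4 * (σ + 1)) with hε
  have hε0 : 0 < ε := by positivity
  have hε4 : ε ≤ 1 / 4 := by
    rw [hε]
    apply one_div_le_one_div_of_le <;> linarith
  have hεσ : ε * (σ + 1) = 1 / 4 := by rw [hε]; field_simp
  refine ⟨(2 * σ) ^ d * (3 / ε ^ 4 * (1 + 2 * 2 ^ d)), by positivity,
    fun T hT q hq x hx => ?_⟩
  obtain ⟨c, hc⟩ := hT.exists_ball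
  set h := cellDiam T with hh
  have hh0 : 0 < h := hT.cellDiam_pos hd
  set r : ℝ := h / σ with hr
  have hr0 : 0 < r := by positivity
  have hhr : h = σ * r := by rw [hr]; field_simp
  have hqc := hq.continuous
  set I := ∫ y in Metric.ball c r, q y ^ 2 with hI
  have hIT : I ≤ ∫ y in cell T, q y ^ 2 :=
    setIntegral_mono_set ((hqc.pow 2).continuousOn.integrableOn_compact
      (Triangulation.isCompact_cell T)) (Filter.Eventually.of_forall fun y => sq_nonneg _)
      (Filter.Eventually.of_forall hc)
  have hcT : c ∈ cell T := hc (Metric.mem_ball_self hr0)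
  have hxc : ‖x - c‖ ≤ σ * r := by
    rw [← hhr, ← dist_eq_norm]; exact dist_le_cellDiam hx hcT
  have hmem : ∀ s : ℝ, 0 ≤ s → s ≤ 2 * ε → ∀ y ∈ Metric.ball c (r / 2),
      (1 - s) • y + s • x ∈ Metric.ball c r := by
    intro s hs0 hs y hy
    rw [Metric.mem_ball, dist_eq_norm] at hy ⊢
    have e : (1 - s) • y + s • x - c = (1 - s) • (y - c) + s • (x - c) := by module
    rw [e]
    calc ‖(1 - s) • (y - c) + s • (x - c)‖ ≤ ‖(1 - s) • (y - c)‖ + ‖s • (x - c)‖ :=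
          norm_add_le _ _
      _ = (1 - s) * ‖y - c‖ + s * ‖x - c‖ := by
        rw [norm_smul, norm_smul, Real.norm_of_nonneg hs0, Real.norm_of_nonneg (by linarith)]
      _ ≤ 1 * ‖y - c‖ + (2 * ε) * (σ * r) := by
        gcongr
        linarith
      _ < r := by nlinarith
  have hpt : ∀ y, q x ^ 2 ≤ 3 / ε ^ 4 * (q y ^ 2 + q ((1 - ε) • y + ε • x) ^ 2 +
      q ((1 - 2 * ε) • y + (2 * ε) • x) ^ 2) := by
    intro y
    have e := hq.extrapolate ε x y
    set A := q y
    set B := q ((1 - ε) • y + ε • x)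
    set D := q ((1 - 2 * ε) • y + (2 * ε) • x)
    have e1 : q x ^ 2 = ((1 - ε) * (1 - 2 * ε) / 2 * A - (1 - 2 * ε) * B + (1 - ε) / 2 * D) ^ 2 /
        ε ^ 4 := by
      have : ε ^ 2 * q x = (1 - ε) * (1 - 2 * ε) / 2 * A - (1 - 2 * ε) * B + (1 - ε) / 2 * D := by
        linarith
      rw [← this]; field_simp
    rw [e1, div_mul_eq_mul_div 3]
    refine div_le_div_of_nonneg_right ?_ (pow_nonneg hε0.le 4)
    have b1 : ((1 - ε) * (1 - 2 * ε) / 2) ^ 2 ≤ 1 := by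
      rw [sq_le_one_iff_abs_le_one, abs_le]; constructor <;> nlinarith
    have b2 : (1 - 2 * ε) ^ 2 ≤ 1 := by
      rw [sq_le_one_iff_abs_le_one, abs_le]; constructor <;> nlinarith
    have b3 : ((1 - ε) / 2) ^ 2 ≤ 1 := by
      rw [sq_le_one_iff_abs_le_one, abs_le]; constructor <;> nlinarith
    have hsum : ∀ u v w : ℝ, (u - v + w) ^ 2 ≤ 3 * (u ^ 2 + v ^ 2 + w ^ 2) := by
      intro u v w
      nlinarith [sq_nonneg (u + v), sq_nonneg (u - w), sq_nonneg (v + w)]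
    refine (hsum _ _ _).trans ?_
    simp only [mul_pow ((1 - ε) * (1 - 2 * ε) / 2), mul_pow (1 - 2 * ε), mul_pow ((1 - ε) / 2)]
    have := mul_le_mul_of_nonneg_right b1 (sq_nonneg A)
    have := mul_le_mul_of_nonneg_right b2 (sq_nonneg B)
    have := mul_le_mul_of_nonneg_right b3 (sq_nonneg D)
    linarith
  have hio : ∀ F : Pt d → ℝ, Continuous F →
      Integrable F (volume.restrict (Metric.ball c (r / 2))) :=
    fun F hF => (hF.continuousOn.integrableOn_compact (isCompact_closedBall c _)).mono_set
      Metric.ball_subset_closedBall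
  have hball : volume.real (Metric.ball c (r / 2)) * q x ^ 2 ≤
      3 / ε ^ 4 * ((1 + 2 * 2 ^ d) * I) := by
    have i1 := hio (fun y => q y ^ 2) (by fun_prop)
    have i2 := hio (fun y => q ((1 - ε) • y + ε • x) ^ 2) (by fun_prop)
    have i12 := hio (fun y => q y ^ 2 + q ((1 - ε) • y + ε • x) ^ 2) (by fun_prop)
    have i3 := hio (fun y => q ((1 - 2 * ε) • y + (2 * ε) • x) ^ 2) (by fun_prop)
    calc volume.real (Metric.ball c (r / 2)) * q x ^ 2
        = ∫ y in Metric.ball c (r / 2), q x ^ 2 := by rw [setIntegral_const, smul_eq_mul]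
      _ ≤ ∫ y in Metric.ball c (r / 2), 3 / ε ^ 4 * (q y ^ 2 + q ((1 - ε) • y + ε • x) ^ 2 +
            q ((1 - 2 * ε) • y + (2 * ε) • x) ^ 2) :=
          integral_mono (hio _ continuous_const) (hio _ (by fun_prop)) hpt
      _ = 3 / ε ^ 4 * ((∫ y in Metric.ball c (r / 2), q y ^ 2) +
            (∫ y in Metric.ball c (r / 2), q ((1 - ε) • y + ε • x) ^ 2) +
            ∫ y in Metric.ball c (r / 2), q ((1 - 2 * ε) • y + (2 * ε) • x) ^ 2) := by
          rw [integral_const_mul, integral_add i12 i3,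
            integral_add i1 i2]
      _ ≤ 3 / ε ^ 4 * (I + 2 ^ d * I + 2 ^ d * I) := by
          gcongr
          · refine setIntegral_mono_set ?_ (Filter.Eventually.of_forall fun y => sq_nonneg _)
              (Filter.Eventually.of_forall (Metric.ball_subset_ball (by linarith)))
            exact ((hqc.pow 2).continuousOn.integrableOn_compact
              (isCompact_closedBall c r)).mono_set Metric.ball_subset_closedBall
          · exact setIntegral_homothety_le (F := fun y => q y ^ 2) (by fun_prop)
              (fun y => sq_nonneg _) (by linarith) (hmem ε hε0.le (by linarith))
          · exact setIntegral_homothety_le (F := fun y => q y ^ 2) (by fun_prop)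
              (fun y => sq_nonneg _) (by linarith) (hmem (2 * ε) (by linarith) le_rfl)
      _ = _ := by ring
  have hvol : volume.real (cell T) ≤ (2 * σ) ^ d * volume.real (Metric.ball c (r / 2)) := by
    rw [volume_real_ball c (by positivity), ← mul_assoc, ← mul_pow]
    refine hT.volume_le.trans (le_of_eq ?_)
    rw [← hh, hhr]
    congr 2
    ring
  calc volume.real (cell T) * q x ^ 2
      ≤ (2 * σ) ^ d * volume.real (Metric.ball c (r / 2)) * q x ^ 2 := by gcongr
    _ = (2 * σ) ^ d * (volume.real (Metric.ball c (r / 2)) * q x ^ 2) := by ring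
    _ ≤ (2 * σ) ^ d * (3 / ε ^ 4 * ((1 + 2 * 2 ^ d) * I)) := by gcongr
    _ ≤ (2 * σ) ^ d * (3 / ε ^ 4 * ((1 + 2 * 2 ^ d) * ∫ y in cell T, q y ^ 2)) := by gcongr
    _ = _ := by ring

/-! ### Barycentric coordinates on faces and in the interior -/

namespace IsSimplex

variable {d : ℕ} {T : Finset (Pt d)}

lemma continuous_bary (hT : IsSimplex T) (p : Pt d) : Continuous (hT.bary p) :=
  (hT.bary p).continuous_of_finiteDimensional

lemma affineMap_sum {f : Pt d →ᵃ[ℝ] ℝ} {s : Finset (Pt d)} {w : Pt d → ℝ}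
    (hw : ∑ q ∈ s, w q = 1) : f (∑ q ∈ s, w q • q) = ∑ q ∈ s, w q * f q := by
  have hf : ∀ x, f x = f.linear x + f 0 := fun x => by
    have h := congrFun f.decomp x
    simpa using h
  rw [hf, map_sum]
  simp only [map_smul, smul_eq_mul]
  rw [← one_mul (f 0), ← hw, Finset.sum_mul, ← Finset.sum_add_distrib]
  exact Finset.sum_congr rfl fun q _ => by rw [hf q]; ring

lemma bary_sum (hT : IsSimplex T) {s : Finset (Pt d)} (hs : s ⊆ T) {w : Pt d → ℝ}
    (hw : ∑ q ∈ s, w q = 1) {r : Pt d} (hr : r ∈ s) :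
    hT.bary r (∑ q ∈ s, w q • q) = w r := by
  rw [affineMap_sum hw, Finset.sum_eq_single r]
  · rw [hT.bary_self (hs hr), mul_one]
  · intro q hq hqr
    rw [hT.bary_of_ne (hs hq) hqr.symm, mul_zero]
  · exact fun h => absurd hr h

/-- Barycentric coordinates with respect to two simplices agree on a common face. -/
lemma bary_eq_of_mem_face {T' : Finset (Pt d)} (hT : IsSimplex T) (hT' : IsSimplex T')
    {s : Finset (Pt d)} (hs : s ⊆ T) (hs' : s ⊆ T') {x : Pt d} (hx : x ∈ cell s) (p : Pt d) :
    hT.bary p x = hT'.bary p x := by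
  have h1 := (hT.cell_eq_of_subset hs ▸ hx).2
  have h2 := (hT'.cell_eq_of_subset hs' ▸ hx).2
  by_cases hp : p ∈ s
  · have e1 : ∑ q ∈ s, hT.bary q x = 1 := by
      rw [← hT.sum_bary x]
      exact Finset.sum_subset hs fun q _ hq => h1 q hq
    have e2 : ∑ q ∈ s, hT.bary q x • q = x := by
      conv_rhs => rw [← hT.sum_bary_smul x]
      exact Finset.sum_subset hs fun q _ hq => by simp [h1 q hq]
    conv_rhs => rw [← e2]
    rw [hT'.bary_sum hs' e1 hp]
  · rw [h1 p hp, h2 p hp]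

lemma mem_interior_of_bary_pos (hT : IsSimplex T) {x : Pt d} (hx : ∀ p ∈ T, 0 < hT.bary p x) :
    x ∈ interior (cell T) := by
  have hopen : IsOpen (⋂ p ∈ T, hT.bary p ⁻¹' Set.Ioi 0) :=
    isOpen_biInter_finset fun p _ => isOpen_Ioi.preimage (hT.continuous_bary p)
  refine interior_maximal (fun y hy => hT.mem_cell_of_bary fun p hp => ?_) hopen
    (Set.mem_iInter₂.2 hx)
  exact (Set.mem_iInter₂.1 hy p hp).le

lemma bary_pos_of_mem_interior (hT : IsSimplex T) (hd : 1 ≤ d) {x : Pt d}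
    (hx : x ∈ interior (cell T)) {p : Pt d} (hp : p ∈ T) : 0 < hT.bary p x := by
  -- near an interior point `x`, one may move a little further in the direction of the normal, which
  -- decreases the barycentric coordinate of `p` but keeps it nonnegative
  set n := outwardNormal T (T.erase p)
  have hcont : Continuous fun t : ℝ => x + t • n := by fun_prop
  have h1 : ∀ᶠ t : ℝ in nhds 0, x + t • n ∈ cell T :=
    (hcont.tendsto' 0 x (by simp)).eventually (mem_interior_iff_mem_nhds.1 hx)
  obtain ⟨t, ht, ht0⟩ := (h1.filter_mono nhdsWithin_le_nhds).and
    (self_mem_nhdsWithin : Set.Ioi (0 : ℝ) ∈ nhdsWithin 0 (Set.Ioi 0)) |>.exists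
  have e1 := hT.bary_mul_height hd hp (x + t • n)
  have e2 := hT.bary_mul_height hd hp x
  rw [inner_add_right, inner_smul_right, real_inner_self_eq_norm_sq,
    hT.norm_outwardNormal hd hp] at e1
  have hh := hT.height_pos hd hp
  have hb := mul_nonneg (hT.bary_nonneg ht p) hh.le
  have ht0' : 0 < t := ht0
  by_contra hneg
  push Not at hneg
  nlinarith [mul_nonneg (neg_nonneg.2 hneg) hh.le]

lemma exists_mem_interior (hT : IsSimplex T) : (interior (cell T)).Nonempty := by
  rw [cell, interior_convexHull_nonempty_iff_affineSpan_eq_top]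
  have h := hT.basis.tot
  rwa [show Set.range hT.basis = (T : Set (Pt d)) by ext; simp] at h

lemma inner_normal_eq_level (hT : IsSimplex T) (hd : 1 ≤ d) {p : Pt d} (hp : p ∈ T) {x : Pt d}
    (hx : x ∈ cell (T.erase p)) : inner ℝ (outwardNormal T (T.erase p)) x = level T p := by
  have h := hT.bary_mul_height hd hp x
  rw [hT.cell_erase_eq _] at hx
  rw [hx.2, zero_mul] at h
  linarith

/-- A vector that is orthogonal to a facet is a multiple of the normal. -/
lemma eq_smul_normal (hT : IsSimplex T) (hd : 1 ≤ d) {p : Pt d} (hp : p ∈ T) {m : Pt d} {κ : ℝ}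
    (hm : ∀ q ∈ T.erase p, inner ℝ m q = κ) :
    ∃ b : ℝ, m = b • outwardNormal T (T.erase p) := by
  set n := outwardNormal T (T.erase p)
  have hh := hT.height_pos hd hp
  have h1 : ∀ x, inner ℝ m x = κ + hT.bary p x * (inner ℝ m p - κ) := by
    intro x
    conv_lhs => rw [← hT.sum_bary_smul x, inner_sum]
    simp only [inner_smul_right]
    have e := hT.sum_bary x
    rw [← Finset.add_sum_erase _ _ hp] at e ⊢
    rw [Finset.sum_congr rfl fun q hq => by rw [hm q hq], ← Finset.sum_mul]
    linear_combination κ * e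
  have h2 : ∀ x, hT.bary p x = (height T p)⁻¹ * (level T p - inner ℝ n x) := by
    intro x
    rw [← hT.bary_mul_height hd hp x]
    field_simp
  refine ⟨-(height T p)⁻¹ * (inner ℝ m p - κ), ?_⟩
  refine ext_inner_right ℝ fun x => ?_
  have e0 := h1 0
  have e1 := h1 x
  rw [h2, inner_zero_right] at e0
  rw [h2] at e1
  rw [inner_smul_left, e1]
  simp only [inner_zero_right, conj_trivial] at e0 ⊢
  linear_combination -e0

end IsSimplex

namespace Triangulation

variable {d : ℕ} {Ω : Set (Pt d)} {𝒯 : Triangulation Ω}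

/-! ### Combinatorics of the mesh -/

lemma mem_elements {T : Finset (Pt d)} :
    T ∈ 𝒯.elements ↔ T ∈ 𝒯.complex.faces ∧ T.card = d + 1 := by
  simp [elements]

lemma mem_faces {e : Finset (Pt d)} : e ∈ 𝒯.faces ↔ e ∈ 𝒯.complex.faces ∧ e.card = d := by
  simp [faces]

lemma mem_facesOf {e T : Finset (Pt d)} : e ∈ 𝒯.facesOf T ↔ e ∈ 𝒯.faces ∧ e ⊆ T := by
  simp [facesOf]

lemma mem_interiorFaces {e : Finset (Pt d)} :
    e ∈ 𝒯.interiorFaces ↔ e ∈ 𝒯.faces ∧ ¬ cell e ⊆ frontier Ω := by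
  simp [interiorFaces]

lemma isSimplex {T : Finset (Pt d)} (hT : T ∈ 𝒯.elements) : IsSimplex T :=
  ⟨𝒯.complex.indep (mem_elements.1 hT).1, (mem_elements.1 hT).2⟩

lemma erase_mem_facesOf (hd : 1 ≤ d) {T : Finset (Pt d)} (hT : T ∈ 𝒯.elements) {p : Pt d}
    (hp : p ∈ T) : T.erase p ∈ 𝒯.facesOf T := by
  rw [mem_facesOf, mem_faces]
  have hc := (isSimplex hT).card_erase hp
  exact ⟨⟨𝒯.complex.down_closed (mem_elements.1 hT).1 (T.erase_subset p)
    (Finset.card_pos.1 (by omega)), hc⟩, T.erase_subset p⟩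

lemma exists_eq_erase {T e : Finset (Pt d)} (hT : T ∈ 𝒯.elements) (he : e ∈ 𝒯.faces)
    (heT : e ⊆ T) : ∃ p ∈ T, e = T.erase p := by
  have h1 := (mem_elements.1 hT).2
  have h2 := (mem_faces.1 he).2
  have h3 : (T \ e).card = 1 := by rw [Finset.card_sdiff_of_subset heT]; omega
  obtain ⟨p, hp⟩ := Finset.card_eq_one.1 h3
  have hpm : p ∈ T \ e := by rw [hp]; exact Finset.mem_singleton_self p
  refine ⟨p, (Finset.mem_sdiff.1 hpm).1, ?_⟩
  rw [← Finset.sdiff_singleton_eq_erase, ← hp, Finset.sdiff_sdiff_eq_self heT]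

lemma sum_facesOf (hd : 1 ≤ d) {T : Finset (Pt d)} (hT : T ∈ 𝒯.elements)
    (f : Finset (Pt d) → ℝ) : ∑ e ∈ 𝒯.facesOf T, f e = ∑ p ∈ T, f (T.erase p) := by
  have h : 𝒯.facesOf T = T.image fun p => T.erase p := by
    ext e
    rw [Finset.mem_image]
    constructor
    · intro he
      obtain ⟨p, hp, h⟩ := exists_eq_erase hT (mem_facesOf.1 he).1 (mem_facesOf.1 he).2
      exact ⟨p, hp, h.symm⟩
    · rintro ⟨p, hp, rfl⟩
      exact erase_mem_facesOf hd hT hp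
  rw [h, Finset.sum_image]
  intro p hp q hq hpq
  by_contra hne
  have : p ∈ T.erase q := Finset.mem_erase.2 ⟨hne, hp⟩
  have hpq' : T.erase p = T.erase q := hpq
  rw [← hpq'] at this
  simp at this

lemma card_facesOf (hd : 1 ≤ d) {T : Finset (Pt d)} (hT : T ∈ 𝒯.elements) :
    ((𝒯.facesOf T).card : ℝ) = d + 1 := by
  have h := sum_facesOf hd hT fun _ => (1 : ℝ)
  simpa [(mem_elements.1 hT).2] using h

lemma elementsAt_nonempty {e : Finset (Pt d)} (he : e ∈ 𝒯.faces) :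
    (𝒯.elementsAt e).Nonempty := by
  obtain ⟨T, hT, heT, hc⟩ := 𝒯.pure e (mem_faces.1 he).1
  exact ⟨T, mem_elementsAt.2 ⟨mem_elements.2 ⟨hT, hc⟩, heT⟩⟩

lemma iUnion_cell : ⋃ T ∈ 𝒯.elements, cell T = closure Ω := by
  rw [← 𝒯.space_eq]
  apply Set.Subset.antisymm
  · refine Set.iUnion₂_subset fun T hT => ?_
    exact 𝒯.complex.convexHull_subset_space (mem_elements.1 hT).1
  · intro x hx
    obtain ⟨s, hs, hxs⟩ := Geometry.SimplicialComplex.mem_space_iff.1 hx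
    obtain ⟨T, hT, hsT, hc⟩ := 𝒯.pure s hs
    exact Set.mem_iUnion₂.2 ⟨T, mem_elements.2 ⟨hT, hc⟩, cell_mono hsT hxs⟩

lemma cell_subset_closure {T : Finset (Pt d)} (hT : T ∈ 𝒯.elements) : cell T ⊆ closure Ω := by
  rw [← iUnion_cell (𝒯 := 𝒯)]
  exact Set.subset_iUnion₂ (s := fun T _ => cell T) T hT

lemma exists_mem_cell {x : Pt d} (hx : x ∈ closure Ω) : ∃ T ∈ 𝒯.elements, x ∈ cell T := by
  rw [← iUnion_cell (𝒯 := 𝒯)] at hx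
  simpa using hx

/-- Conformity of the mesh: the elements `T` and `T'` meet in their common face. -/
lemma mem_cell_inter {T T' : Finset (Pt d)} (hT : T ∈ 𝒯.elements) (hT' : T' ∈ 𝒯.elements)
    {x : Pt d} (hx : x ∈ cell T) (hx' : x ∈ cell T') : x ∈ cell (T ∩ T') := by
  have := 𝒯.complex.inter_subset_convexHull (mem_elements.1 hT).1 (mem_elements.1 hT').1 ⟨hx, hx'⟩
  rw [cell, Finset.coe_inter]
  exact this

lemma interior_closure_eq (hΩ_open : IsOpen Ω) (hΩ_convex : Convex ℝ Ω) :
    interior (closure Ω) = Ω := by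
  rcases Ω.eq_empty_or_nonempty with h | h
  · simp [h]
  · rw [hΩ_convex.interior_closure_eq_interior_of_nonempty_interior (by
      rwa [hΩ_open.interior_eq]), hΩ_open.interior_eq]

lemma interior_cell_subset (hΩ_open : IsOpen Ω) (hΩ_convex : Convex ℝ Ω) {T : Finset (Pt d)}
    (hT : T ∈ 𝒯.elements) : interior (cell T) ⊆ Ω := by
  rw [← interior_closure_eq hΩ_open hΩ_convex]
  exact interior_mono (cell_subset_closure hT)

/-- If a point of an element has positive barycentric coordinates at the vertices in `s`, then
every element that contains the point has the vertices in `s`. -/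
lemma subset_of_bary_pos {T T' s : Finset (Pt d)} (hT : T ∈ 𝒯.elements) (hT' : T' ∈ 𝒯.elements)
    {x : Pt d} (hx : x ∈ cell T) (hx' : x ∈ cell T')
    (hpos : ∀ p ∈ s, 0 < (isSimplex hT).bary p x) : s ⊆ T' := by
  intro p hp
  by_contra hpT
  have h := ((isSimplex hT).cell_eq_of_subset (Finset.inter_subset_left (s₂ := T')) ▸
    mem_cell_inter hT hT' hx hx').2 p fun h => hpT (Finset.mem_inter.1 h).2
  exact (hpos p hp).ne' h

/-- Distinct elements do not overlap: an element that contains an interior point of `T` contains all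
of its vertices. -/
lemma disjoint_interior_cell (hd : 1 ≤ d) {T T' : Finset (Pt d)} (hT : T ∈ 𝒯.elements)
    (hT' : T' ∈ 𝒯.elements) (hne : T ≠ T') : Disjoint (interior (cell T)) (cell T') := by
  rw [Set.disjoint_left]
  intro x hx hx'
  have hsub := subset_of_bary_pos hT hT' (interior_subset hx) hx' (s := T)
    fun p hp => (isSimplex hT).bary_pos_of_mem_interior hd hx hp
  exact hne (Finset.eq_of_subset_of_card_le hsub (by
    rw [(mem_elements.1 hT).2, (mem_elements.1 hT').2]))

/-- The barycenter of a codimension-one face. -/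
def faceCenter (e : Finset (Pt d)) : Pt d := ∑ q ∈ e, (d : ℝ)⁻¹ • q

/-- The barycenter lies in the relative interior of the face. -/
lemma faceCenter_spec (hd : 1 ≤ d) {e : Finset (Pt d)} (he : e.card = d) :
    faceCenter e ∈ cell e ∧ ∀ {T : Finset (Pt d)} (hT : IsSimplex T), e ⊆ T → ∀ p ∈ e,
      0 < hT.bary p (faceCenter e) := by
  have hd0 : (0 : ℝ) < d := by exact_mod_cast hd
  have hw : ∑ q ∈ e, (d : ℝ)⁻¹ = 1 := by
    rw [Finset.sum_const, he, nsmul_eq_mul, mul_inv_cancel₀ hd0.ne']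
  refine ⟨?_, fun hT heT p hp => ?_⟩
  · rw [cell, Finset.mem_convexHull']
    exact ⟨fun _ => (d : ℝ)⁻¹, fun _ _ => by positivity, hw, rfl⟩
  · rw [faceCenter, hT.bary_sum heT hw hp]
    positivity

lemma eventually_bary_pos {T : Finset (Pt d)} (hT : IsSimplex T) {s : Finset (Pt d)} {y : Pt d}
    (hy : ∀ p ∈ s, 0 < hT.bary p y) : ∀ᶠ x in nhds y, ∀ p ∈ s, 0 < hT.bary p x :=
  (Filter.eventually_all_finset s).2 fun p hp =>
    (hT.continuous_bary p).continuousAt.eventually (lt_mem_nhds (hy p hp))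

lemma exists_small_shift {P : Pt d → Prop} {y : Pt d} (hP : ∀ᶠ x in nhds y, P x) (n : Pt d) :
    ∃ t : ℝ, 0 < t ∧ P (y + t • n) := by
  have hcont : Continuous fun t : ℝ => y + t • n := by fun_prop
  have h1 : ∀ᶠ t : ℝ in nhds 0, P (y + t • n) := (hcont.tendsto' 0 y (by simp)).eventually hP
  obtain ⟨t, ht, ht0⟩ := (h1.filter_mono nhdsWithin_le_nhds).and
    (self_mem_nhdsWithin : Set.Ioi (0 : ℝ) ∈ nhdsWithin 0 (Set.Ioi 0)) |>.exists
  exact ⟨t, ht0, ht⟩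

/-- Two elements with a common face lie on different sides of it. -/
lemma outwardNormal_eq_neg (hd : 1 ≤ d) {T T' e : Finset (Pt d)} (he : e ∈ 𝒯.faces)
    (hT : T ∈ 𝒯.elementsAt e) (hT' : T' ∈ 𝒯.elementsAt e) (hne : T ≠ T') :
    outwardNormal T' e = - outwardNormal T e := by
  obtain ⟨hTe, heT⟩ := mem_elementsAt.1 hT
  obtain ⟨hTe', heT'⟩ := mem_elementsAt.1 hT'
  obtain ⟨p, hp, hep⟩ := exists_eq_erase hTe he heT
  obtain ⟨p', hp', hep'⟩ := exists_eq_erase hTe' he heT'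
  have hS := isSimplex hTe
  have hS' := isSimplex hTe'
  have hcard := (mem_faces.1 he).2
  have hn : ‖outwardNormal T e‖ = 1 := by rw [hep]; exact hS.norm_outwardNormal hd hp
  have hn' : ‖outwardNormal T' e‖ = 1 := by
    rw [hep']; exact hS'.norm_outwardNormal hd hp'
  have hlev' : ∀ x ∈ cell e, inner ℝ (outwardNormal T' e) x = IsSimplex.level T' p' := by
    intro x hx
    rw [hep'] at hx ⊢
    exact hS'.inner_normal_eq_level hd hp' hx
  obtain ⟨b, hb⟩ := hS.eq_smul_normal hd hp (m := outwardNormal T' e)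
    (κ := IsSimplex.level T' p') fun q hq => hlev' q (mem_cell_of_mem (hep ▸ hq))
  rw [← hep] at hb
  have hb1 : |b| = 1 := by
    rw [hb, norm_smul, hn, mul_one] at hn'
    exact hn'
  rcases (abs_eq zero_le_one).1 hb1 with h1 | h1
  · -- if the normals agreed, the elements would overlap below the barycenter of the face
    exfalso
    rw [h1, one_smul] at hb
    obtain ⟨hy, hpos⟩ := faceCenter_spec hd hcard
    obtain ⟨t, ht, hx1, hx2⟩ := exists_small_shift
      ((eventually_bary_pos hS (hpos hS heT)).and (eventually_bary_pos hS' (hpos hS' heT')))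
      (-outwardNormal T e)
    set x := faceCenter e + t • -outwardNormal T e with hx
    have hin : inner ℝ (outwardNormal T e) x =
        inner ℝ (outwardNormal T e) (faceCenter e) - t := by
      rw [hx, inner_add_right, inner_smul_right, inner_neg_right, real_inner_self_eq_norm_sq, hn]
      ring
    have hlev : inner ℝ (outwardNormal T e) (faceCenter e) = IsSimplex.level T p := by
      rw [hep] at hy ⊢
      exact hS.inner_normal_eq_level hd hp hy
    have hbp : 0 < hS.bary p x := by
      have := hS.bary_mul_height hd hp x
      rw [← hep, hin, hlev] at this
      have hh := hS.height_pos hd hp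
      by_contra hneg
      push Not at hneg
      nlinarith [mul_nonneg (neg_nonneg.2 hneg) hh.le]
    have hbp' : 0 < hS'.bary p' x := by
      have := hS'.bary_mul_height hd hp' x
      rw [← hep', ← hlev' _ hy, hb, hin] at this
      have hh := hS'.height_pos hd hp'
      by_contra hneg
      push Not at hneg
      nlinarith [mul_nonneg (neg_nonneg.2 hneg) hh.le]
    have hall : ∀ q ∈ T, 0 < hS.bary q x := by
      intro q hq
      by_cases hqp : q = p
      · rw [hqp]; exact hbp
      · exact hx1 q (by rw [hep]; exact Finset.mem_erase.2 ⟨hqp, hq⟩)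
    have hall' : ∀ q ∈ T', 0 < hS'.bary q x := by
      intro q hq
      by_cases hqp : q = p'
      · rw [hqp]; exact hbp'
      · exact hx2 q (by rw [hep']; exact Finset.mem_erase.2 ⟨hqp, hq⟩)
    exact Set.disjoint_left.1 (disjoint_interior_cell hd hTe hTe' hne)
      (hS.mem_interior_of_bary_pos hall)
      (interior_subset (hS'.mem_interior_of_bary_pos hall'))
  · rw [hb, h1, neg_smul, one_smul]

/-- A face that belongs to two elements is an interior face. -/
lemma mem_interiorFaces_of_ne (hd : 1 ≤ d) (hΩ_open : IsOpen Ω) (hΩ_convex : Convex ℝ Ω)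
    {T T' e : Finset (Pt d)} (he : e ∈ 𝒯.faces)
    (hT : T ∈ 𝒯.elementsAt e) (hT' : T' ∈ 𝒯.elementsAt e) (hne : T ≠ T') :
    e ∈ 𝒯.interiorFaces := by
  refine mem_interiorFaces.2 ⟨he, fun hfr => ?_⟩
  have hopp := outwardNormal_eq_neg hd he hT hT' hne
  obtain ⟨hTe, heT⟩ := mem_elementsAt.1 hT
  obtain ⟨hTe', heT'⟩ := mem_elementsAt.1 hT'
  obtain ⟨p, hp, hep⟩ := exists_eq_erase hTe he heT
  obtain ⟨p', hp', hep'⟩ := exists_eq_erase hTe' he heT'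
  have hS := isSimplex hTe
  have hS' := isSimplex hTe'
  obtain ⟨hy, hpos⟩ := faceCenter_spec hd (mem_faces.1 he).2
  have hlev : inner ℝ (outwardNormal T e) (faceCenter e) = IsSimplex.level T p := by
    rw [hep] at hy ⊢
    exact hS.inner_normal_eq_level hd hp hy
  have hlev' : inner ℝ (outwardNormal T' e) (faceCenter e) = IsSimplex.level T' p' := by
    rw [hep'] at hy ⊢
    exact hS'.inner_normal_eq_level hd hp' hy
  -- near the barycenter of the face, each point lies in one of the two elements, depending on its
  -- side of the face
  have hint : faceCenter e ∈ interior (closure Ω) := by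
    rw [mem_interior_iff_mem_nhds]
    filter_upwards [eventually_bary_pos hS (hpos hS heT),
      eventually_bary_pos hS' (hpos hS' heT')] with x hx1 hx2
    have e1 := hS.bary_mul_height hd hp x
    have e2 := hS'.bary_mul_height hd hp' x
    rw [← hep, ← hlev] at e1
    rw [← hep', ← hlev', hopp, inner_neg_left, inner_neg_left] at e2
    rcases le_total (inner ℝ (outwardNormal T e) x)
      (inner ℝ (outwardNormal T e) (faceCenter e)) with hle | hle
    · refine cell_subset_closure hTe (hS.mem_cell_of_bary fun q hq => ?_)
      by_cases hqp : q = p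
      · rw [hqp]
        exact nonneg_of_mul_nonneg_left (by linarith) (hS.height_pos hd hp)
      · exact (hx1 q (by rw [hep]; exact Finset.mem_erase.2 ⟨hqp, hq⟩)).le
    · refine cell_subset_closure hTe' (hS'.mem_cell_of_bary fun q hq => ?_)
      by_cases hqp : q = p'
      · rw [hqp]
        exact nonneg_of_mul_nonneg_left (by linarith) (hS'.height_pos hd hp')
      · exact (hx2 q (by rw [hep']; exact Finset.mem_erase.2 ⟨hqp, hq⟩)).le
  rw [interior_closure_eq hΩ_open hΩ_convex] at hint
  have h2 := hfr hy
  rw [hΩ_open.frontier_eq] at h2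
  exact h2.2 hint

/-- An interior face contains a point of `Ω`. -/
lemma exists_mem_cell_inter {e : Finset (Pt d)} (hΩ_open : IsOpen Ω)
    (he : e ∈ 𝒯.interiorFaces) : ∃ x ∈ cell e, x ∈ Ω := by
  obtain ⟨hef, hnot⟩ := mem_interiorFaces.1 he
  obtain ⟨x, hx, hxf⟩ := Set.not_subset.1 hnot
  obtain ⟨T, hT⟩ := elementsAt_nonempty hef
  obtain ⟨hTe, heT⟩ := mem_elementsAt.1 hT
  refine ⟨x, hx, ?_⟩
  by_contra hxΩ
  exact hxf (by
    rw [hΩ_open.frontier_eq]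
    exact ⟨cell_subset_closure hTe (cell_mono heT hx), hxΩ⟩)

/-- On the other side of an interior face there is another element. -/
lemma exists_ne_of_mem_interiorFaces (hd : 1 ≤ d) (hΩ_open : IsOpen Ω)
    {T e : Finset (Pt d)} (he : e ∈ 𝒯.interiorFaces) (hT : T ∈ 𝒯.elementsAt e) :
    ∃ T' ∈ 𝒯.elementsAt e, T ≠ T' := by
  by_contra! hall
  have hef := (mem_interiorFaces.1 he).1
  obtain ⟨hTe, heT⟩ := mem_elementsAt.1 hT
  obtain ⟨p, hp, hep⟩ := exists_eq_erase hTe hef heT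
  have hS := isSimplex hTe
  obtain ⟨x₀, hx₀, hx₀Ω⟩ := exists_mem_cell_inter hΩ_open he
  obtain ⟨hm, hpos⟩ := faceCenter_spec hd (mem_faces.1 hef).2
  -- a point of `Ω` in the relative interior of the face
  obtain ⟨y, hyΩ, hye, hypos⟩ : ∃ y ∈ Ω, y ∈ cell e ∧ ∀ q ∈ e, 0 < hS.bary q y := by
    have hcont : Continuous fun t : ℝ => AffineMap.lineMap x₀ (faceCenter e) t :=
      AffineMap.lineMap_continuous
    have h1 : ∀ᶠ t : ℝ in nhds 0, AffineMap.lineMap x₀ (faceCenter e) t ∈ Ω :=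
      (hcont.tendsto' 0 x₀ (by simp)).eventually (hΩ_open.mem_nhds hx₀Ω)
    obtain ⟨t, ht, ht0, ht1⟩ := (h1.filter_mono nhdsWithin_le_nhds).and
      (Ioo_mem_nhdsGT (zero_lt_one' ℝ)) |>.exists
    refine ⟨_, ht, ?_, fun q hq => ?_⟩
    · exact (convex_convexHull ℝ _).lineMap_mem hx₀ hm ⟨ht0.le, ht1.le⟩
    · rw [AffineMap.apply_lineMap, AffineMap.lineMap_apply_module]
      have h2 := hpos hS heT q hq
      have h3 := hS.bary_nonneg (cell_mono heT hx₀) q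
      have := mul_pos ht0 h2
      have := mul_nonneg (sub_nonneg.2 ht1.le) h3
      simp only [smul_eq_mul]
      linarith
  -- near this point there are no other elements
  have hnear : ∀ᶠ x in nhds y, x ∈ cell T := by
    have hclosed : IsClosed (⋃ T' ∈ 𝒯.elements.erase T, cell T') :=
      (𝒯.elements.erase T).finite_toSet.isClosed_biUnion fun T' _ =>
        (isCompact_cell T').isClosed
    have hy : y ∉ ⋃ T' ∈ 𝒯.elements.erase T, cell T' := by
      intro hmem
      obtain ⟨T', hT', hyT'⟩ := Set.mem_iUnion₂.1 hmem
      have hT'e := Finset.mem_of_mem_erase hT'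
      have hsub := subset_of_bary_pos hTe hT'e (cell_mono heT hye) hyT' hypos
      exact Finset.ne_of_mem_erase hT' (hall T' (mem_elementsAt.2 ⟨hT'e, hsub⟩)).symm
    filter_upwards [hclosed.isOpen_compl.mem_nhds hy, hΩ_open.mem_nhds hyΩ] with x hx hxΩ
    obtain ⟨T', hT', hxT'⟩ := exists_mem_cell (𝒯 := 𝒯) (subset_closure hxΩ)
    by_cases hTT' : T' = T
    · rwa [← hTT']
    · exact absurd (Set.mem_iUnion₂.2 ⟨T', Finset.mem_erase.2 ⟨hTT', hT'⟩, hxT'⟩) hx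
  -- hence a small shift along the outward normal would not leave the element `T`, which is absurd
  obtain ⟨t, ht, hxT⟩ := exists_small_shift hnear (outwardNormal T e)
  have e1 := hS.bary_mul_height hd hp (y + t • outwardNormal T e)
  have hye' := hye
  rw [hep] at hye'
  rw [hep, inner_add_right, inner_smul_right, real_inner_self_eq_norm_sq,
    hS.norm_outwardNormal hd hp, hS.inner_normal_eq_level hd hp hye', ← hep] at e1
  have := mul_nonneg (hS.bary_nonneg hxT p) (hS.height_pos hd hp).le
  linarith

/-- At most two elements share a face: for three of them, each normal would be the negative of the
two others. -/
lemma elementsAt_eq_pair (hd : 1 ≤ d) {T T' e : Finset (Pt d)} (he : e ∈ 𝒯.faces)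
    (hT : T ∈ 𝒯.elementsAt e) (hT' : T' ∈ 𝒯.elementsAt e) (hne : T ≠ T') :
    𝒯.elementsAt e = {T, T'} := by
  ext S
  simp only [Finset.mem_insert, Finset.mem_singleton]
  refine ⟨fun hS => ?_, ?_⟩
  · by_contra! hcon
    have h1 := outwardNormal_eq_neg hd he hT hT' hne
    have h2 := outwardNormal_eq_neg hd he hS hT hcon.1
    have h3 := outwardNormal_eq_neg hd he hS hT' hcon.2
    have h4 : outwardNormal S e = 0 := by
      rw [h2, h3, neg_neg] at h1
      have h5 : (2 : ℝ) • outwardNormal S e = 0 := by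
        rw [two_smul]
        nth_rewrite 1 [← h1]
        exact neg_add_cancel _
      exact (smul_eq_zero.1 h5).resolve_left two_ne_zero
    obtain ⟨hSe, heS⟩ := mem_elementsAt.1 hS
    obtain ⟨p, hp, hep⟩ := exists_eq_erase hSe he heS
    have := (isSimplex hSe).norm_outwardNormal hd hp
    rw [← hep, h4, norm_zero] at this
    exact zero_ne_one this
  · rintro (rfl | rfl) <;> assumption

/-- A face on the boundary belongs to a single element. -/
lemma elementsAt_eq_singleton (hd : 1 ≤ d) (hΩ_open : IsOpen Ω) (hΩ_convex : Convex ℝ Ω)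
    {T e : Finset (Pt d)} (he : e ∈ 𝒯.faces) (hei : e ∉ 𝒯.interiorFaces)
    (hT : T ∈ 𝒯.elementsAt e) : 𝒯.elementsAt e = {T} := by
  refine Finset.eq_singleton_iff_unique_mem.2 ⟨hT, fun T' hT' => ?_⟩
  by_contra hne
  exact hei (mem_interiorFaces_of_ne hd hΩ_open hΩ_convex he hT' hT hne)

lemma card_elementsAt_le (hd : 1 ≤ d) {e : Finset (Pt d)} (he : e ∈ 𝒯.faces) :
    (𝒯.elementsAt e).card ≤ 2 := by
  obtain ⟨T, hT⟩ := elementsAt_nonempty he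
  by_cases h : ∃ T' ∈ 𝒯.elementsAt e, T ≠ T'
  · obtain ⟨T', hT', hne⟩ := h
    rw [elementsAt_eq_pair hd he hT hT' hne]
    exact Finset.card_le_two
  · push Not at h
    rw [Finset.eq_singleton_iff_unique_mem.2 ⟨hT, fun T' hT' => (h T' hT').symm⟩]
    simp

end Triangulation

/-! ### Calculus of quadratic polynomials -/

/-- The quadratic polynomial with coefficients `c`, `b`, `A`. -/
def quad {d : ℕ} (c : ℝ) (b : Pt d →L[ℝ] ℝ) (A : Pt d →L[ℝ] Pt d →L[ℝ] ℝ) (x : Pt d) : ℝ :=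
  c + b x + A x x

/-- The directional derivative of `quad c b A` in the direction `n`. -/
def quadDeriv {d : ℕ} (b : Pt d →L[ℝ] ℝ) (A : Pt d →L[ℝ] Pt d →L[ℝ] ℝ) (n x : Pt d) : ℝ :=
  b n + A x n + A n x

section quad

variable {d : ℕ} (c : ℝ) (b : Pt d →L[ℝ] ℝ) (A : Pt d →L[ℝ] Pt d →L[ℝ] ℝ)

lemma hasFDerivAt_quad (x : Pt d) :
    HasFDerivAt (quad c b A) (b + (A x + A.flip x)) x := by
  have h1 : HasFDerivAt (fun x => A x x) (A x + A.flip x) x := by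
    have h := A.isBoundedBilinearMap.hasFDerivAt (x, x)
    have h2 := HasFDerivAt.comp (f := fun x : Pt d => (x, x)) x h
      ((hasFDerivAt_id x).prodMk (hasFDerivAt_id x))
    convert! h2 using 1
  have h3 := (b.hasFDerivAt (x := x)).const_add c
  exact h3.add h1

lemma fderiv_quad (x n : Pt d) : fderiv ℝ (quad c b A) x n = quadDeriv b A n x := by
  rw [(hasFDerivAt_quad c b A x).fderiv]
  simp [quadDeriv, add_assoc]

lemma contDiff_quad : ContDiff ℝ ∞ (quad c b A) := by
  unfold quad
  fun_prop

lemma quadDeriv_eq_quad (n : Pt d) : quadDeriv b A n = quad (b n) (A.flip n + A n) 0 := by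
  ext x
  simp [quadDeriv, quad, add_assoc]

lemma contDiff_quadDeriv (n : Pt d) : ContDiff ℝ ∞ (quadDeriv b A n) := by
  rw [quadDeriv_eq_quad]
  exact contDiff_quad _ _ _

lemma fderiv_quadDeriv (n x : Pt d) : fderiv ℝ (quadDeriv b A n) x n = 2 * A n n := by
  rw [quadDeriv_eq_quad, fderiv_quad]
  simp [quadDeriv]
  ring

lemma eqQuadraticOn_quad : EqQuadraticOn (quad c b A) Set.univ := ⟨c, b, A, fun _ _ => rfl⟩

lemma eqQuadraticOn_quadDeriv (n : Pt d) : EqQuadraticOn (quadDeriv b A n) Set.univ := by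
  rw [quadDeriv_eq_quad]
  exact eqQuadraticOn_quad _ _ _

lemma sum_mul_quadDeriv (n x : Pt d) :
    ∑ i, n i * quadDeriv b A (EuclideanSpace.single i 1) x = quadDeriv b A n x := by
  have h : n = ∑ i, n i • EuclideanSpace.single i (1 : ℝ) := by
    ext j
    simp [Finset.sum_apply, Pi.single_apply]
  conv_rhs => rw [h]
  simp [quadDeriv, map_sum, Finset.sum_add_distrib, mul_add]

/-- The Laplacian of `quad c b A`. -/
def quadLaplacian : ℝ := ∑ i, 2 * A (EuclideanSpace.single i 1) (EuclideanSpace.single i 1)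

end quad

lemma inner_single {d : ℕ} (n : Pt d) (i : Fin d) :
    inner ℝ n (EuclideanSpace.single i (1 : ℝ)) = n i := by
  simp [EuclideanSpace.inner_single_right]

namespace IsSimplex

variable {d : ℕ} {T : Finset (Pt d)}

lemma integrable_surf (hT : IsSimplex T) (hd : 1 ≤ d) {p : Pt d} (hp : p ∈ T) {g : Pt d → ℝ}
    (hg : Continuous g) : Integrable g (surf (T.erase p)) := by
  rw [hT.surf_erase hd hp]
  exact integrableOn_hyperplaneMeasure (hT.norm_outwardNormal hd hp) _
    (Triangulation.isCompact_cell T) hg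

lemma integrableOn_cell {g : Pt d → ℝ} (hg : Continuous g) : IntegrableOn g (cell T) :=
  hg.continuousOn.integrableOn_compact (Triangulation.isCompact_cell T)

/-- The divergence theorem for the gradient of a quadratic polynomial, whose Laplacian is
constant. -/
lemma integral_quadLaplacian (hT : IsSimplex T) (hd : 1 ≤ d) (b : Pt d →L[ℝ] ℝ)
    (A : Pt d →L[ℝ] Pt d →L[ℝ] ℝ) :
    volume.real (cell T) * quadLaplacian A =
      ∑ p ∈ T, ∫ x, quadDeriv b A (outwardNormal T (T.erase p)) x ∂(surf (T.erase p)) := by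
  have h1 : ∀ i : Fin d, volume.real (cell T) *
      (2 * A (EuclideanSpace.single i 1) (EuclideanSpace.single i 1)) =
      ∑ p ∈ T, ∫ x, outwardNormal T (T.erase p) i *
        quadDeriv b A (EuclideanSpace.single i 1) x ∂(surf (T.erase p)) := by
    intro i
    have h := hT.setIntegral_fderiv hd
      ((contDiff_quadDeriv b A (EuclideanSpace.single i 1)).of_le (by simp))
      (EuclideanSpace.single i 1)
    simp only [fderiv_quadDeriv, setIntegral_const, smul_eq_mul, inner_single] at h
    rw [h]
    exact Finset.sum_congr rfl fun p _ => by rw [integral_const_mul]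
  rw [quadLaplacian, Finset.mul_sum, Finset.sum_congr rfl fun i _ => h1 i, Finset.sum_comm]
  refine Finset.sum_congr rfl fun p hp => ?_
  have hq' : ∀ n, Continuous (quadDeriv b A n) := fun n => (contDiff_quadDeriv b A n).continuous
  rw [← integral_finsetSum _ fun i _ => hT.integrable_surf hd hp
    (g := fun x => outwardNormal T (T.erase p) i *
      quadDeriv b A (EuclideanSpace.single i 1) x) (by fun_prop)]
  exact integral_congr_ae (Filter.Eventually.of_forall fun x => sum_mul_quadDeriv b A _ x)

/-- Green's first identity for a quadratic polynomial on a simplex. -/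
lemma integral_green (hT : IsSimplex T) (hd : 1 ≤ d) (c : ℝ) (b : Pt d →L[ℝ] ℝ)
    (A : Pt d →L[ℝ] Pt d →L[ℝ] ℝ) :
    (∫ x in cell T, ∑ i, quadDeriv b A (EuclideanSpace.single i 1) x ^ 2) +
        quadLaplacian A * ∫ x in cell T, quad c b A x =
      ∑ p ∈ T, ∫ x, quad c b A x * quadDeriv b A (outwardNormal T (T.erase p)) x
        ∂(surf (T.erase p)) := by
  have hq : Continuous (quad c b A) := (contDiff_quad c b A).continuous
  have hq' : ∀ n, Continuous (quadDeriv b A n) := fun n => (contDiff_quadDeriv b A n).continuous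
  have h1 : ∀ i : Fin d, (∫ x in cell T, quadDeriv b A (EuclideanSpace.single i 1) x ^ 2) +
      (2 * A (EuclideanSpace.single i 1) (EuclideanSpace.single i 1)) *
        ∫ x in cell T, quad c b A x =
      ∑ p ∈ T, ∫ x, outwardNormal T (T.erase p) i *
        (quad c b A x * quadDeriv b A (EuclideanSpace.single i 1) x) ∂(surf (T.erase p)) := by
    intro i
    have hd1 : Differentiable ℝ (quad c b A) := (contDiff_quad c b A).differentiable (by simp)
    have hd2 : Differentiable ℝ (quadDeriv b A (EuclideanSpace.single i 1)) :=
      (contDiff_quadDeriv b A _).differentiable (by simp)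
    have h := hT.setIntegral_fderiv hd
      (f := fun x => quad c b A x * quadDeriv b A (EuclideanSpace.single i 1) x)
      (((contDiff_quad c b A).mul (contDiff_quadDeriv b A (EuclideanSpace.single i 1))).of_le
        (by simp)) (EuclideanSpace.single i 1)
    have hfd : ∀ x, fderiv ℝ (fun x => quad c b A x * quadDeriv b A (EuclideanSpace.single i 1) x) x
        (EuclideanSpace.single i 1) = quadDeriv b A (EuclideanSpace.single i 1) x ^ 2 +
          (2 * A (EuclideanSpace.single i 1) (EuclideanSpace.single i 1)) * quad c b A x := by
      intro x
      rw [fderiv_fun_mul (hd1 x) (hd2 x)]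
      simp only [add_apply, smul_apply, smul_eq_mul, fderiv_quad, fderiv_quadDeriv]
      ring
    simp only [hfd, inner_single] at h
    rw [integral_add (integrableOn_cell (by fun_prop)) (integrableOn_cell (by fun_prop)),
      integral_const_mul] at h
    rw [h]
    exact Finset.sum_congr rfl fun p _ => by rw [integral_const_mul]
  rw [integral_finsetSum _ fun i _ => integrableOn_cell
    (g := fun x => quadDeriv b A (EuclideanSpace.single i 1) x ^ 2) (by fun_prop), quadLaplacian,
    Finset.sum_mul, ← Finset.sum_add_distrib, Finset.sum_congr rfl fun i _ => h1 i,
    Finset.sum_comm]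
  refine Finset.sum_congr rfl fun p hp => ?_
  rw [← integral_finsetSum _ fun i _ => hT.integrable_surf hd hp
    (g := fun x => outwardNormal T (T.erase p) i *
      (quad c b A x * quadDeriv b A (EuclideanSpace.single i 1) x)) (by fun_prop)]
  refine integral_congr_ae (Filter.Eventually.of_forall fun x => ?_)
  beta_reduce
  rw [← sum_mul_quadDeriv b A _ x]
  simp only [Finset.mul_sum]
  exact Finset.sum_congr rfl fun i _ => by ring

/-- The divergence theorem for the field `(xᵢ - zᵢ) q² eᵢ`, where `q` is a quadratic polynomial. -/
lemma integral_coord_mul_sq (hT : IsSimplex T) (hd : 1 ≤ d) (c : ℝ) (b : Pt d →L[ℝ] ℝ)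
    (A : Pt d →L[ℝ] Pt d →L[ℝ] ℝ) (i : Fin d) (z : Pt d) :
    (∫ x in cell T, quad c b A x ^ 2) + (∫ x in cell T, 2 * (x i - z i) *
        (quad c b A x * quadDeriv b A (EuclideanSpace.single i 1) x)) =
      ∑ p ∈ T, outwardNormal T (T.erase p) i *
        ∫ x, (x i - z i) * quad c b A x ^ 2 ∂(surf (T.erase p)) := by
  have hq : Continuous (quad c b A) := (contDiff_quad c b A).continuous
  have hq' : Continuous (quadDeriv b A (EuclideanSpace.single i 1)) :=
    (contDiff_quadDeriv b A _).continuous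
  have hd1 : Differentiable ℝ (quad c b A) := (contDiff_quad c b A).differentiable (by simp)
  set P : Pt d →L[ℝ] ℝ := EuclideanSpace.proj i with hP
  have hd3 : Differentiable ℝ fun x : Pt d => P x - z i := by fun_prop
  have hcd : ContDiff ℝ 1 fun x : Pt d => (P x - z i) * quad c b A x ^ 2 := by
    have := (contDiff_quad c b A).of_le (show (1 : WithTop ℕ∞) ≤ ∞ by simp)
    fun_prop
  have h := hT.setIntegral_fderiv hd hcd (EuclideanSpace.single i 1)
  have hfd : ∀ x, fderiv ℝ (fun x : Pt d => (P x - z i) * quad c b A x ^ 2) x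
      (EuclideanSpace.single i 1) = quad c b A x ^ 2 + 2 * (x i - z i) *
        (quad c b A x * quadDeriv b A (EuclideanSpace.single i 1) x) := by
    intro x
    rw [fderiv_fun_mul (hd3 x) ((hd1 x).fun_pow 2), fderiv_sub_const, P.fderiv,
      fderiv_fun_pow 2 (hd1 x)]
    simp only [add_apply, smul_apply, smul_eq_mul, fderiv_quad]
    simp [hP]
    ring
  simp only [hfd, inner_single] at h
  rw [← integral_add (integrableOn_cell (by fun_prop)) (integrableOn_cell (by fun_prop))]
  exact h

end IsSimplex

/-! ### Elementwise Laplacian, energy and mass -/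

namespace Triangulation

variable {d : ℕ} {Ω : Set (Pt d)} {𝒯 : Triangulation Ω}

lemma exists_quad {v : Pt d → ℝ} (hv : v ∈ 𝒯.Vh) {T : Finset (Pt d)} (hT : T ∈ 𝒯.elements) :
    ∃ c b A, ∀ x ∈ cell T, v x = quad c b A x := hv.2.2 T hT

lemma gradDot_eq_quadDeriv {v : Pt d → ℝ} {T : Finset (Pt d)} (hT : T ∈ 𝒯.elements)
    {c : ℝ} {b : Pt d →L[ℝ] ℝ} {A : Pt d →L[ℝ] Pt d →L[ℝ] ℝ}
    (h : ∀ x ∈ cell T, v x = quad c b A x) {x : Pt d} (hx : x ∈ cell T) (n : Pt d) :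
    gradDot v T x n = quadDeriv b A n x := by
  rw [gradDot, fderivWithin_congr h (h x hx), fderivWithin_eq_fderiv (uniqueDiffOn_cell hT x hx)
    (((contDiff_quad c b A).differentiable (by simp)) x), fderiv_quad]

/-- The Laplacian of the restriction of `v` to the element `T`, expressed by the flux of the
gradient of this restriction through the boundary of `T`. -/
def elemLaplacian (𝒯 : Triangulation Ω) (v : Pt d → ℝ) (T : Finset (Pt d)) : ℝ :=
  (volume.real (cell T))⁻¹ * ∑ e ∈ 𝒯.facesOf T, ∫ x, gradDot v T x (outwardNormal T e) ∂(surf e)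

lemma volume_cell_pos {T : Finset (Pt d)} (hT : T ∈ 𝒯.elements) : 0 < volume.real (cell T) := by
  refine ENNReal.toReal_pos ?_ (volume_cell_lt_top T).ne
  exact (Measure.measure_pos_of_nonempty_interior _ (isSimplex hT).exists_mem_interior).ne'

/-- The elementwise Laplacian is the Laplacian of the quadratic polynomial that represents `v`. -/
lemma elemLaplacian_eq (hd : 1 ≤ d) {v : Pt d → ℝ} {T : Finset (Pt d)} (hT : T ∈ 𝒯.elements)
    {c : ℝ} {b : Pt d →L[ℝ] ℝ} {A : Pt d →L[ℝ] Pt d →L[ℝ] ℝ}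
    (h : ∀ x ∈ cell T, v x = quad c b A x) : 𝒯.elemLaplacian v T = quadLaplacian A := by
  rw [elemLaplacian, inv_mul_eq_iff_eq_mul₀ (volume_cell_pos hT).ne',
    (isSimplex hT).integral_quadLaplacian hd b A, sum_facesOf hd hT]
  refine Finset.sum_congr rfl fun p hp => integral_congr_ae ?_
  filter_upwards [ae_surf_mem (T.erase p)] with x hx
  exact gradDot_eq_quadDeriv hT h (cell_mono (T.erase_subset p) hx) _

/-- The integral of `v²` over an element. -/
def massSq (v : Pt d → ℝ) (T : Finset (Pt d)) : ℝ := ∫ x in cell T, v x ^ 2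

/-- The integral of `|∇v|²` over an element. -/
def energySq (v : Pt d → ℝ) (T : Finset (Pt d)) : ℝ :=
  ∫ x in cell T, ∑ i, gradDot v T x (EuclideanSpace.single i 1) ^ 2

lemma massSq_nonneg (v : Pt d → ℝ) (T : Finset (Pt d)) : 0 ≤ massSq v T :=
  integral_nonneg fun _ => sq_nonneg _

lemma energySq_nonneg (v : Pt d → ℝ) (T : Finset (Pt d)) : 0 ≤ energySq v T :=
  integral_nonneg fun _ => Finset.sum_nonneg fun _ _ => sq_nonneg _

lemma setIntegral_cell_congr {T : Finset (Pt d)} {f g : Pt d → ℝ} (h : ∀ x ∈ cell T, f x = g x) :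
    ∫ x in cell T, f x = ∫ x in cell T, g x :=
  setIntegral_congr_fun (isCompact_cell T).measurableSet h

lemma integral_surf_congr {e : Finset (Pt d)} {f g : Pt d → ℝ} (h : ∀ x ∈ cell e, f x = g x) :
    ∫ x, f x ∂(surf e) = ∫ x, g x ∂(surf e) :=
  integral_congr_ae (by filter_upwards [ae_surf_mem e] with x hx using h x hx)

/-- Integration by parts of `|∇v|²` on an element. -/
lemma energySq_eq (hd : 1 ≤ d) {v : Pt d → ℝ} (hv : v ∈ 𝒯.Vh) {T : Finset (Pt d)}
    (hT : T ∈ 𝒯.elements) :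
    energySq v T = -(𝒯.elemLaplacian v T * ∫ x in cell T, v x) +
      ∑ e ∈ 𝒯.facesOf T, ∫ x, v x * gradDot v T x (outwardNormal T e) ∂(surf e) := by
  obtain ⟨c, b, A, h⟩ := exists_quad hv hT
  have hg := (isSimplex hT).integral_green hd c b A
  rw [elemLaplacian_eq hd hT h, setIntegral_cell_congr h, sum_facesOf hd hT, energySq,
    setIntegral_cell_congr (g := fun x => ∑ i, quadDeriv b A (EuclideanSpace.single i 1) x ^ 2)
      fun x hx => Finset.sum_congr rfl fun i _ => by rw [gradDot_eq_quadDeriv hT h hx]]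
  rw [eq_neg_add_iff_add_eq, add_comm, hg]
  refine Finset.sum_congr rfl fun p hp => integral_surf_congr fun x hx => ?_
  have hx' := cell_mono (T.erase_subset p) hx
  rw [gradDot_eq_quadDeriv hT h hx', h x hx']

/-- Integration by parts of `v² = v² ∂ᵢ(xᵢ - zᵢ)` on an element. -/
lemma massSq_eq (hd : 1 ≤ d) {v : Pt d → ℝ} (hv : v ∈ 𝒯.Vh) {T : Finset (Pt d)}
    (hT : T ∈ 𝒯.elements) (i : Fin d) (z : Pt d) :
    massSq v T = -(∫ x in cell T, 2 * (x i - z i) *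
        (v x * gradDot v T x (EuclideanSpace.single i 1))) +
      ∑ e ∈ 𝒯.facesOf T, outwardNormal T e i * ∫ x, (x i - z i) * v x ^ 2 ∂(surf e) := by
  obtain ⟨c, b, A, h⟩ := exists_quad hv hT
  have hg := (isSimplex hT).integral_coord_mul_sq hd c b A i z
  rw [sum_facesOf hd hT, massSq, setIntegral_cell_congr (g := fun x => quad c b A x ^ 2)
    fun x hx => by rw [h x hx]]
  rw [setIntegral_cell_congr (f := fun x => 2 * (x i - z i) *
    (v x * gradDot v T x (EuclideanSpace.single i 1))) (g := fun x => 2 * (x i - z i) *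
    (quad c b A x * quadDeriv b A (EuclideanSpace.single i 1) x)) fun x hx => by
      rw [h x hx, gradDot_eq_quadDeriv hT h hx], eq_neg_add_iff_add_eq, add_comm, hg]
  refine Finset.sum_congr rfl fun p hp => ?_
  congr 1
  refine integral_surf_congr fun x hx => ?_
  rw [h x (cell_mono (T.erase_subset p) hx)]

end Triangulation

namespace Triangulation

variable {d : ℕ} {Ω : Set (Pt d)} {𝒯 : Triangulation Ω}

/-! ### Averages and jumps -/

/-- On an interior face, the average of the gradients is the gradient on `T` plus half of the jump;
with the outward normal of `T`, this holds for both sides with the same sign. -/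
lemma avgGradDot_eq_of_mem_interiorFaces (hd : 1 ≤ d) (hΩ_open : IsOpen Ω)
    {v : Pt d → ℝ} {T e : Finset (Pt d)} (he : e ∈ 𝒯.interiorFaces) (hT : T ∈ 𝒯.elementsAt e)
    (x : Pt d) : 𝒯.avgGradDot v e x (outwardNormal T e) =
      gradDot v T x (outwardNormal T e) + 1 / 2 * 𝒯.normalJump v e x := by
  obtain ⟨T', hT', hne⟩ := exists_ne_of_mem_interiorFaces hd hΩ_open he hT
  have hef := (mem_interiorFaces.1 he).1
  have hn := outwardNormal_eq_neg hd hef hT hT' hne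
  rw [avgGradDot, normalJump, elementsAt_eq_pair hd hef hT hT' hne, Finset.card_pair hne,
    Finset.sum_pair hne, Finset.sum_pair hne, hn]
  simp only [gradDot, map_neg]
  push_cast
  ring

lemma avgGradDot_eq_of_notMem_interiorFaces (hd : 1 ≤ d) (hΩ_open : IsOpen Ω)
    (hΩ_convex : Convex ℝ Ω) {v : Pt d → ℝ} {T e : Finset (Pt d)} (he : e ∈ 𝒯.faces)
    (hei : e ∉ 𝒯.interiorFaces) (hT : T ∈ 𝒯.elementsAt e) (x n : Pt d) :
    𝒯.avgGradDot v e x n = gradDot v T x n := by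
  rw [avgGradDot, elementsAt_eq_singleton hd hΩ_open hΩ_convex he hei hT]
  simp

/-- The sum of the outward normals at an interior face vanishes. -/
lemma sum_outwardNormal (hd : 1 ≤ d) (hΩ_open : IsOpen Ω) {e : Finset (Pt d)}
    (he : e ∈ 𝒯.interiorFaces) : ∑ T ∈ 𝒯.elementsAt e, outwardNormal T e = 0 := by
  have hef := (mem_interiorFaces.1 he).1
  obtain ⟨T, hT⟩ := elementsAt_nonempty hef
  obtain ⟨T', hT', hne⟩ := exists_ne_of_mem_interiorFaces hd hΩ_open he hT
  rw [elementsAt_eq_pair hd hef hT hT' hne, Finset.sum_pair hne,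
    outwardNormal_eq_neg hd hef hT hT' hne, add_neg_cancel]

lemma eq_zero_of_mem_boundary_face {v : Pt d → ℝ} (hv : v ∈ 𝒯.Vh) (hΩ_open : IsOpen Ω)
    {e : Finset (Pt d)} (he : e ∈ 𝒯.faces) (hei : e ∉ 𝒯.interiorFaces) {x : Pt d}
    (hx : x ∈ cell e) : v x = 0 := by
  have h : cell e ⊆ frontier Ω := by
    by_contra h
    exact hei (mem_interiorFaces.2 ⟨he, h⟩)
  have := h hx
  rw [hΩ_open.frontier_eq] at this
  exact hv.2.1 x this.2

lemma sum_elements_facesOf (F : Finset (Pt d) → Finset (Pt d) → ℝ) :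
    ∑ T ∈ 𝒯.elements, ∑ e ∈ 𝒯.facesOf T, F T e =
      ∑ e ∈ 𝒯.faces, ∑ T ∈ 𝒯.elementsAt e, F T e := by
  refine Finset.sum_comm' fun T e => ?_
  rw [mem_facesOf, mem_elementsAt]
  tauto

lemma sum_faces_eq_sum_interiorFaces {F : Finset (Pt d) → ℝ}
    (hF : ∀ e ∈ 𝒯.faces, e ∉ 𝒯.interiorFaces → F e = 0) :
    ∑ e ∈ 𝒯.faces, F e = ∑ e ∈ 𝒯.interiorFaces, F e :=
  (Finset.sum_subset 𝒯.interiorFaces_subset fun e he hei => hF e he hei).symm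

/-- Nonnegative quantities on interior faces, summed over the faces of all elements, are counted
at most twice. -/
lemma sum_elements_interior_facesOf_le (hd : 1 ≤ d) {F : Finset (Pt d) → ℝ}
    (hF : ∀ e, 0 ≤ F e) :
    ∑ T ∈ 𝒯.elements, ∑ e ∈ 𝒯.facesOf T with e ∈ 𝒯.interiorFaces, F e ≤
      2 * ∑ e ∈ 𝒯.interiorFaces, F e := by
  have h : ∀ T, ∑ e ∈ 𝒯.facesOf T with e ∈ 𝒯.interiorFaces, F e =
      ∑ e ∈ 𝒯.facesOf T, if e ∈ 𝒯.interiorFaces then F e else 0 := fun T =>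
    Finset.sum_filter _ _
  simp only [h]
  rw [sum_elements_facesOf (F := fun _ e => if e ∈ 𝒯.interiorFaces then F e else 0),
    sum_faces_eq_sum_interiorFaces, Finset.mul_sum]
  · refine Finset.sum_le_sum fun e he => ?_
    rw [if_pos he, Finset.sum_const, nsmul_eq_mul]
    refine mul_le_mul_of_nonneg_right ?_ (hF e)
    exact_mod_cast card_elementsAt_le hd (mem_interiorFaces.1 he).1
  · intro e he hei
    simp [hei]

/-- The Cauchy–Schwarz inequality on a face. -/
lemma integral_surf_sq_le {e : Finset (Pt d)} (he : e ∈ 𝒯.faces) {f : Pt d → ℝ}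
    (hf : ContinuousOn f (cell e)) :
    (∫ x, f x ∂(surf e)) ^ 2 ≤ (surf e).real Set.univ * ∫ x, f x ^ 2 ∂(surf e) := by
  have hfin : IsFiniteMeasure (surf e) := ⟨surf_lt_top he⟩
  set μ := (surf e).real Set.univ with hμ
  set I := ∫ x, f x ∂(surf e) with hI
  have h1 := integrable_surf he hf
  have h2 : Integrable (fun x => f x ^ 2) (surf e) := integrable_surf he (hf.pow 2)
  have h : 0 ≤ ∫ x, (μ * f x - I) ^ 2 ∂(surf e) := integral_nonneg fun _ => sq_nonneg _
  have e1 : ∫ x, (μ * f x - I) ^ 2 ∂(surf e) = μ ^ 2 * ∫ x, f x ^ 2 ∂(surf e) - μ * I ^ 2 := by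
    have e2 : ∀ x, (μ * f x - I) ^ 2 = (μ ^ 2 * f x ^ 2 - 2 * μ * I * f x) + I ^ 2 := fun x => by
      ring
    simp only [e2]
    have h12 : Integrable (fun x => μ ^ 2 * f x ^ 2 - 2 * μ * I * f x) (surf e) :=
      (h2.const_mul _).sub (h1.const_mul _)
    rw [integral_add h12 (integrable_const _), integral_sub (h2.const_mul _) (h1.const_mul _),
      integral_const_mul, integral_const_mul,
      integral_const, smul_eq_mul, ← hμ, ← hI]
    ring
  rw [e1] at h
  have hμ0 : 0 ≤ μ := measureReal_nonneg
  rcases hμ0.eq_or_lt with h0 | h0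
  · have hz : surf e = 0 := by
      rw [← Measure.measure_univ_eq_zero]
      exact (measureReal_eq_zero_iff (measure_ne_top _ _)).1 h0.symm
    rw [← h0, zero_mul, hI, hz]
    simp
  · have : 0 ≤ μ * (μ * ∫ x, f x ^ 2 ∂(surf e) - I ^ 2) := by linarith
    linarith [nonneg_of_mul_nonneg_right this h0]

/-- The scaled squared norm `h_e⁻¹ ∫_e ([∇v]·n_e)²` of the jump on the face `e`. -/
def jumpSq (𝒯 : Triangulation Ω) (v : Pt d → ℝ) (e : Finset (Pt d)) : ℝ :=
  (faceSize e)⁻¹ * ∫ x, 𝒯.normalJump v e x ^ 2 ∂(surf e)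

lemma faceSize_nonneg (e : Finset (Pt d)) : 0 ≤ faceSize e :=
  Real.rpow_nonneg measureReal_nonneg _

lemma jumpSq_nonneg (v : Pt d → ℝ) (e : Finset (Pt d)) : 0 ≤ 𝒯.jumpSq v e :=
  mul_nonneg (inv_nonneg.2 (faceSize_nonneg e)) (integral_nonneg fun _ => sq_nonneg _)

lemma form_self (𝒮 ℱ : Finset (Finset (Pt d))) (v : Pt d → ℝ) :
    𝒯.form 𝒮 ℱ v v = ∑ T ∈ 𝒮, volume.real (cell T) * 𝒯.weakLaplacian v T ^ 2 +
      1 / 4 * ∑ e ∈ ℱ, 𝒯.jumpSq v e := by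
  simp only [form, jumpSq, pow_two]

/-! ### The weak Laplacian and the elementwise Laplacian -/

/-- The weak Laplacian differs from the elementwise Laplacian by the fluxes of the jumps. -/
lemma weakLaplacian_sub_elemLaplacian (hd : 1 ≤ d) (hΩ_open : IsOpen Ω) (hΩ_convex : Convex ℝ Ω)
    {v : Pt d → ℝ} (hv : v ∈ 𝒯.Vh) {T : Finset (Pt d)} (hT : T ∈ 𝒯.elements) :
    𝒯.weakLaplacian v T - 𝒯.elemLaplacian v T = (volume.real (cell T))⁻¹ *
      ∑ e ∈ 𝒯.facesOf T with e ∈ 𝒯.interiorFaces,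
        1 / 2 * ∫ x, 𝒯.normalJump v e x ∂(surf e) := by
  rw [weakLaplacian, elemLaplacian, ← mul_sub, ← Finset.sum_sub_distrib, Finset.sum_filter]
  congr 1
  refine Finset.sum_congr rfl fun e he => ?_
  obtain ⟨hef, heT⟩ := mem_facesOf.1 he
  have hTe : T ∈ 𝒯.elementsAt e := mem_elementsAt.2 ⟨hT, heT⟩
  have hg : ContinuousOn (fun x => gradDot v T x (outwardNormal T e)) (cell e) :=
    (continuousOn_gradDot hv hT _).mono (cell_mono heT)
  split_ifs with hei
  · rw [← integral_sub (integrable_surf hef (continuousOn_avgGradDot hv e _))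
      (integrable_surf hef hg), ← integral_const_mul]
    refine integral_surf_congr fun x _ => ?_
    rw [avgGradDot_eq_of_mem_interiorFaces hd hΩ_open hei hTe]
    ring
  · rw [integral_surf_congr fun x _ => avgGradDot_eq_of_notMem_interiorFaces hd hΩ_open hΩ_convex
      hef hei hTe x _, sub_self]

lemma isShapeRegularSimplex {σ : ℝ} (h𝒯 : 𝒯.IsShapeRegular σ) {T : Finset (Pt d)}
    (hT : T ∈ 𝒯.elements) : IsShapeRegularSimplex σ T :=
  ⟨isSimplex hT, h𝒯.2 T hT⟩

/-- A constant for which `exists_facet_scaling` holds on every element of `𝒯`. -/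
def FacetScaling (𝒯 : Triangulation Ω) (C : ℝ) : Prop :=
  0 < C ∧ ∀ e ∈ 𝒯.faces, 0 < faceSize e ∧ ∀ T ∈ 𝒯.elementsAt e,
    faceSize e * (surf e).real Set.univ ≤ C * volume.real (cell T) ∧
    (faceSize e)⁻¹ * (surf e).real Set.univ * cellDiam T ^ 2 ≤ C * volume.real (cell T)

lemma exists_facetScaling (hd : 2 ≤ d) {σ : ℝ} (hσ : 0 < σ) :
    ∃ C : ℝ, 0 < C ∧ ∀ 𝒯 : Triangulation Ω, 𝒯.IsShapeRegular σ → 𝒯.FacetScaling C := by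
  obtain ⟨C, hC, h⟩ := exists_facet_scaling hd hσ
  refine ⟨C, hC, fun 𝒯 h𝒯 => ⟨hC, fun e he => ?_⟩⟩
  have key : ∀ T ∈ 𝒯.elementsAt e, 0 < faceSize e ∧
      faceSize e * (surf e).real Set.univ ≤ C * volume.real (cell T) ∧
      (faceSize e)⁻¹ * (surf e).real Set.univ * cellDiam T ^ 2 ≤ C * volume.real (cell T) := by
    intro T hT
    obtain ⟨hTe, heT⟩ := mem_elementsAt.1 hT
    obtain ⟨p, hp, rfl⟩ := exists_eq_erase hTe he heT
    exact h T (isShapeRegularSimplex h𝒯 hTe) p hp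
  obtain ⟨T, hT⟩ := elementsAt_nonempty he
  exact ⟨(key T hT).1, fun T' hT' => (key T' hT').2⟩

/-- The difference of the weak and the elementwise Laplacian on an element is controlled by the
scaled jumps on its faces. -/
lemma weakLaplacian_sub_sq_le (hd : 1 ≤ d) (hΩ_open : IsOpen Ω) (hΩ_convex : Convex ℝ Ω)
    {C : ℝ} (hC : 𝒯.FacetScaling C) {v : Pt d → ℝ} (hv : v ∈ 𝒯.Vh) {T : Finset (Pt d)}
    (hT : T ∈ 𝒯.elements) :
    volume.real (cell T) * (𝒯.weakLaplacian v T - 𝒯.elemLaplacian v T) ^ 2 ≤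
      (d + 1) * C * ∑ e ∈ 𝒯.facesOf T with e ∈ 𝒯.interiorFaces, 𝒯.jumpSq v e := by
  have hvol := volume_cell_pos hT
  set S := (𝒯.facesOf T).filter (· ∈ 𝒯.interiorFaces) with hS
  have hcard : (S.card : ℝ) ≤ d + 1 := by
    rw [← card_facesOf hd hT]
    exact_mod_cast Finset.card_filter_le _ _
  have hterm : ∀ e ∈ S, (1 / 2 * ∫ x, 𝒯.normalJump v e x ∂(surf e)) ^ 2 ≤
      C * volume.real (cell T) * 𝒯.jumpSq v e := by
    intro e he
    obtain ⟨he1, he2⟩ := Finset.mem_filter.1 he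
    obtain ⟨hef, heT⟩ := mem_facesOf.1 he1
    obtain ⟨hs, hsc⟩ := hC.2 e hef
    have h1 := integral_surf_sq_le hef (continuousOn_normalJump hv e)
    have hj := jumpSq_nonneg (𝒯 := 𝒯) v e
    have h2 : ∫ x, 𝒯.normalJump v e x ^ 2 ∂(surf e) = faceSize e * 𝒯.jumpSq v e := by
      rw [jumpSq, mul_inv_cancel_left₀ hs.ne']
    calc (1 / 2 * ∫ x, 𝒯.normalJump v e x ∂(surf e)) ^ 2
        ≤ (∫ x, 𝒯.normalJump v e x ∂(surf e)) ^ 2 := by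
          nlinarith [sq_nonneg (∫ x, 𝒯.normalJump v e x ∂(surf e))]
      _ ≤ (surf e).real Set.univ * (faceSize e * 𝒯.jumpSq v e) := by rw [← h2]; exact h1
      _ = (faceSize e * (surf e).real Set.univ) * 𝒯.jumpSq v e := by ring
      _ ≤ _ := mul_le_mul_of_nonneg_right (hsc T (mem_elementsAt.2 ⟨hT, heT⟩)).1 hj
  rw [weakLaplacian_sub_elemLaplacian hd hΩ_open hΩ_convex hv hT]
  have hJ : 0 ≤ ∑ e ∈ S, 𝒯.jumpSq v e := Finset.sum_nonneg fun e _ => jumpSq_nonneg v e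
  calc volume.real (cell T) * ((volume.real (cell T))⁻¹ *
        ∑ e ∈ S, 1 / 2 * ∫ x, 𝒯.normalJump v e x ∂(surf e)) ^ 2
      = (volume.real (cell T))⁻¹ *
        (∑ e ∈ S, 1 / 2 * ∫ x, 𝒯.normalJump v e x ∂(surf e)) ^ 2 := by field_simp
    _ ≤ (volume.real (cell T))⁻¹ *
        (S.card * ∑ e ∈ S, (1 / 2 * ∫ x, 𝒯.normalJump v e x ∂(surf e)) ^ 2) := by
        gcongr
        exact sq_sum_le_card_mul_sum_sq
    _ ≤ (volume.real (cell T))⁻¹ *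
        (S.card * ∑ e ∈ S, C * volume.real (cell T) * 𝒯.jumpSq v e) := by
        gcongr with e he
        exact hterm e he
    _ = S.card * (C * ∑ e ∈ S, 𝒯.jumpSq v e) := by
        rw [← Finset.mul_sum]
        field_simp
    _ ≤ (d + 1) * (C * ∑ e ∈ S, 𝒯.jumpSq v e) := by
        have := hC.1
        gcongr
    _ = _ := by ring

/-! ### Summation by parts over the mesh -/

/-- The energy of a finite element function, in terms of its elementwise Laplacian and its
jumps. -/
lemma sum_energySq (hd : 1 ≤ d) (hΩ_open : IsOpen Ω) {v : Pt d → ℝ} (hv : v ∈ 𝒯.Vh) :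
    ∑ T ∈ 𝒯.elements, energySq v T =
      -(∑ T ∈ 𝒯.elements, 𝒯.elemLaplacian v T * ∫ x in cell T, v x) -
      ∑ e ∈ 𝒯.interiorFaces, ∫ x, v x * 𝒯.normalJump v e x ∂(surf e) := by
  rw [Finset.sum_congr rfl fun T hT => energySq_eq hd hv hT, Finset.sum_add_distrib,
    Finset.sum_neg_distrib, sum_elements_facesOf (F := fun T e => ∫ x, v x *
      gradDot v T x (outwardNormal T e) ∂(surf e)), sub_eq_add_neg,
    sum_faces_eq_sum_interiorFaces, ← Finset.sum_neg_distrib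
      (f := fun e => ∫ x, v x * 𝒯.normalJump v e x ∂(surf e))]
  · congr 1
    refine Finset.sum_congr rfl fun e he => ?_
    have hef := (mem_interiorFaces.1 he).1
    have hint : ∀ T ∈ 𝒯.elementsAt e,
        Integrable (fun x => v x * gradDot v T x (outwardNormal T e)) (surf e) := by
      intro T hT
      obtain ⟨hTe, heT⟩ := mem_elementsAt.1 hT
      exact integrable_surf hef
        (hv.1.continuousOn.mul ((continuousOn_gradDot hv hTe _).mono (cell_mono heT)))
    rw [← integral_finsetSum _ hint, ← integral_neg]
    refine integral_surf_congr fun x _ => ?_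
    rw [normalJump, ← Finset.mul_sum]
    ring
  · intro e he hei
    refine Finset.sum_eq_zero fun T _ => ?_
    rw [integral_surf_congr (g := fun _ => 0) fun x hx => by
      rw [eq_zero_of_mem_boundary_face hv hΩ_open he hei hx, zero_mul], integral_zero]

lemma abs_coord_sub_le (x z : Pt d) (i : Fin d) : |x i - z i| ≤ dist x z := by
  rw [dist_eq_norm]
  exact PiLp.norm_apply_le (x - z) i

/-- The Poincaré–Friedrichs inequality for finite element functions. -/
lemma sum_massSq_le (hd : 1 ≤ d) (hΩ_open : IsOpen Ω) (hΩ_nonempty : Ω.Nonempty)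
    (hΩ_bounded : Bornology.IsBounded Ω) {v : Pt d → ℝ} (hv : v ∈ 𝒯.Vh) :
    ∑ T ∈ 𝒯.elements, massSq v T ≤
      4 * Metric.diam Ω ^ 2 * ∑ T ∈ 𝒯.elements, energySq v T := by
  obtain ⟨z, hz⟩ := hΩ_nonempty
  set i : Fin d := ⟨0, hd⟩
  set R := Metric.diam Ω with hR
  have hR0 : 0 ≤ R := Metric.diam_nonneg
  -- in the sum of the integrations by parts over the elements, the terms on an interior face cancel
  -- because its normals are opposite, and those on a boundary face vanish with `v`
  have h1 : ∑ T ∈ 𝒯.elements, massSq v T = -∑ T ∈ 𝒯.elements, ∫ x in cell T, 2 * (x i - z i) *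
      (v x * gradDot v T x (EuclideanSpace.single i 1)) := by
    rw [Finset.sum_congr rfl fun T hT => massSq_eq hd hv hT i z, Finset.sum_add_distrib,
      Finset.sum_neg_distrib, sum_elements_facesOf (F := fun T e => outwardNormal T e i *
        ∫ x, (x i - z i) * v x ^ 2 ∂(surf e)), sum_faces_eq_sum_interiorFaces,
      add_eq_left]
    · refine Finset.sum_eq_zero fun e he => ?_
      rw [← Finset.sum_mul]
      have h := congrArg (fun w : Pt d => w i) (sum_outwardNormal hd hΩ_open he)
      simp only [WithLp.ofLp_sum, Finset.sum_apply, WithLp.ofLp_zero, Pi.zero_apply] at h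
      rw [h, zero_mul]
    · intro e he hei
      refine Finset.sum_eq_zero fun T _ => ?_
      rw [integral_surf_congr (g := fun _ => 0) fun x hx => by
        rw [eq_zero_of_mem_boundary_face hv hΩ_open he hei hx]; ring, integral_zero, mul_zero]
  have h2 : ∀ T ∈ 𝒯.elements, -(∫ x in cell T, 2 * (x i - z i) *
      (v x * gradDot v T x (EuclideanSpace.single i 1))) ≤
      1 / 2 * massSq v T + 2 * R ^ 2 * energySq v T := by
    intro T hT
    have hc := (isCompact_cell T)
    have hvc : ContinuousOn v (cell T) := hv.1.continuousOn
    have hgc : ∀ i, ContinuousOn (fun x => gradDot v T x (EuclideanSpace.single i 1)) (cell T) :=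
      fun i => continuousOn_gradDot hv hT _
    have hxc : ContinuousOn (fun x : Pt d => 2 * (x i - z i)) (cell T) := by
      have : Continuous fun x : Pt d => 2 * (x i - z i) := by fun_prop
      exact this.continuousOn
    have c1 : IntegrableOn (fun x => -(2 * (x i - z i) *
        (v x * gradDot v T x (EuclideanSpace.single i 1)))) (cell T) :=
      (hxc.mul (hvc.mul (hgc i))).neg.integrableOn_compact hc
    have c2 : IntegrableOn (fun x => v x ^ 2) (cell T) := (hvc.pow 2).integrableOn_compact hc
    have c3 : IntegrableOn (fun x => ∑ i, gradDot v T x (EuclideanSpace.single i 1) ^ 2)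
        (cell T) := (continuousOn_finsetSum _ fun i _ => (hgc i).pow 2).integrableOn_compact hc
    rw [massSq, energySq, ← integral_neg, ← integral_const_mul, ← integral_const_mul,
      ← integral_add (c2.const_mul _) (c3.const_mul _)]
    refine setIntegral_mono_on c1 ((c2.const_mul _).add (c3.const_mul _)) hc.measurableSet ?_
    intro x hx
    have hx1 : |x i - z i| ≤ R := by
      refine (abs_coord_sub_le x z i).trans ?_
      rw [hR, ← Metric.diam_closure]
      exact Metric.dist_le_diam_of_mem hΩ_bounded.closure (cell_subset_closure hT hx)
        (subset_closure hz)
    have hx2 : (x i - z i) ^ 2 ≤ R ^ 2 := sq_le_sq' (abs_le.1 hx1).1 (abs_le.1 hx1).2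
    have hx3 : gradDot v T x (EuclideanSpace.single i 1) ^ 2 ≤
        ∑ i, gradDot v T x (EuclideanSpace.single i 1) ^ 2 :=
      Finset.single_le_sum (f := fun i => gradDot v T x (EuclideanSpace.single i 1) ^ 2)
        (fun _ _ => sq_nonneg _) (Finset.mem_univ i)
    set g := gradDot v T x (EuclideanSpace.single i 1)
    have hx4 : (x i - z i) ^ 2 * g ^ 2 ≤ R ^ 2 *
        ∑ i, gradDot v T x (EuclideanSpace.single i 1) ^ 2 := by gcongr
    nlinarith [sq_nonneg (v x + 2 * ((x i - z i) * g))]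
  have h3 : ∑ T ∈ 𝒯.elements, massSq v T ≤ 1 / 2 * ∑ T ∈ 𝒯.elements, massSq v T +
      2 * R ^ 2 * ∑ T ∈ 𝒯.elements, energySq v T := by
    conv_lhs => rw [h1, ← Finset.sum_neg_distrib]
    rw [Finset.mul_sum, Finset.mul_sum, ← Finset.sum_add_distrib]
    exact Finset.sum_le_sum h2
  linarith

end Triangulation

namespace Triangulation

variable {d : ℕ} {Ω : Set (Pt d)} {𝒯 : Triangulation Ω}

/-! ### Coercivity -/

/-- A constant for the inverse estimate of quadratic polynomials on the elements of `𝒯`. -/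
def InverseEstimate (𝒯 : Triangulation Ω) (C : ℝ) : Prop :=
  0 < C ∧ ∀ T ∈ 𝒯.elements, ∀ q : Pt d → ℝ, EqQuadraticOn q Set.univ → ∀ x ∈ cell T,
    volume.real (cell T) * q x ^ 2 ≤ C * ∫ y in cell T, q y ^ 2

lemma exists_inverseEstimate (hd : 1 ≤ d) {σ : ℝ} (hσ : 0 < σ) :
    ∃ C : ℝ, 0 < C ∧ ∀ 𝒯 : Triangulation Ω, 𝒯.IsShapeRegular σ → 𝒯.InverseEstimate C := by
  obtain ⟨C, hC, h⟩ := exists_inverse_estimate d hd hσ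
  exact ⟨C, hC, fun 𝒯 h𝒯 => ⟨hC, fun T hT => h T (isShapeRegularSimplex h𝒯 hT)⟩⟩

lemma volume_mul_sq_le {C : ℝ} (hC : 𝒯.InverseEstimate C) {v : Pt d → ℝ} (hv : v ∈ 𝒯.Vh)
    {T : Finset (Pt d)} (hT : T ∈ 𝒯.elements) {x : Pt d} (hx : x ∈ cell T) :
    volume.real (cell T) * v x ^ 2 ≤ C * massSq v T := by
  obtain ⟨c, b, A, h⟩ := exists_quad hv hT
  have h1 := hC.2 T hT _ (eqQuadraticOn_quad c b A) x hx
  rw [massSq, setIntegral_cell_congr (g := fun x => quad c b A x ^ 2) fun y hy => by rw [h y hy],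
    h x hx]
  exact h1

/-- The inverse estimate for the gradient, whose components are affine. -/
lemma volume_mul_gradDot_sq_le {C : ℝ} (hC : 𝒯.InverseEstimate C) {v : Pt d → ℝ} (hv : v ∈ 𝒯.Vh)
    {T : Finset (Pt d)} (hT : T ∈ 𝒯.elements) {x : Pt d} (hx : x ∈ cell T) (n : Pt d) :
    volume.real (cell T) * gradDot v T x n ^ 2 ≤ C * energySq v T * ‖n‖ ^ 2 := by
  obtain ⟨c, b, A, h⟩ := exists_quad hv hT
  have hcont : ∀ m, Continuous (quadDeriv b A m) := fun m => (contDiff_quadDeriv b A m).continuous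
  have h1 : ∀ i, volume.real (cell T) * quadDeriv b A (EuclideanSpace.single i 1) x ^ 2 ≤
      C * ∫ y in cell T, quadDeriv b A (EuclideanSpace.single i 1) y ^ 2 := fun i =>
    hC.2 T hT _ (eqQuadraticOn_quadDeriv b A _) x hx
  have h2 : energySq v T =
      ∑ i, ∫ y in cell T, quadDeriv b A (EuclideanSpace.single i 1) y ^ 2 := by
    rw [energySq, setIntegral_cell_congr fun y hy =>
      Finset.sum_congr rfl fun i _ => by rw [gradDot_eq_quadDeriv hT h hy]]
    exact integral_finsetSum _ fun i _ => IsSimplex.integrableOn_cell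
      (g := fun y => quadDeriv b A (EuclideanSpace.single i 1) y ^ 2) (by fun_prop)
  have h3 : quadDeriv b A n x ^ 2 ≤
      ‖n‖ ^ 2 * ∑ i, quadDeriv b A (EuclideanSpace.single i 1) x ^ 2 := by
    rw [← sum_mul_quadDeriv, EuclideanSpace.norm_sq_eq]
    simp only [Real.norm_eq_abs, sq_abs]
    exact Finset.sum_mul_sq_le_sq_mul_sq _ _ _
  rw [gradDot_eq_quadDeriv hT h hx]
  calc volume.real (cell T) * quadDeriv b A n x ^ 2
      ≤ volume.real (cell T) *
        (‖n‖ ^ 2 * ∑ i, quadDeriv b A (EuclideanSpace.single i 1) x ^ 2) := by gcongr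
    _ = ‖n‖ ^ 2 * ∑ i, volume.real (cell T) *
        quadDeriv b A (EuclideanSpace.single i 1) x ^ 2 := by
        rw [Finset.mul_sum, Finset.mul_sum, Finset.mul_sum]
        exact Finset.sum_congr rfl fun i _ => by ring
    _ ≤ ‖n‖ ^ 2 * ∑ i, C * ∫ y in cell T, quadDeriv b A (EuclideanSpace.single i 1) y ^ 2 := by
        exact mul_le_mul_of_nonneg_left (Finset.sum_le_sum fun i _ => h1 i) (sq_nonneg _)
    _ = _ := by rw [← Finset.mul_sum, h2]; ring

/-- A bound for `|v|` on the element `T`. -/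
def maxVal (C : ℝ) (v : Pt d → ℝ) (T : Finset (Pt d)) : ℝ :=
  √(C * massSq v T / volume.real (cell T))

/-- A bound for `|∇v|` on the element `T`. -/
def maxGrad (C : ℝ) (v : Pt d → ℝ) (T : Finset (Pt d)) : ℝ :=
  √(C * energySq v T / volume.real (cell T))

lemma maxGrad_nonneg (C : ℝ) (v : Pt d → ℝ) (T : Finset (Pt d)) : 0 ≤ maxGrad C v T :=
  Real.sqrt_nonneg _

lemma volume_mul_maxVal_sq {C : ℝ} (hC : 0 < C) (v : Pt d → ℝ) {T : Finset (Pt d)}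
    (hT : T ∈ 𝒯.elements) : volume.real (cell T) * maxVal C v T ^ 2 = C * massSq v T := by
  have h1 := volume_cell_pos hT
  have h2 := massSq_nonneg v T
  rw [maxVal, Real.sq_sqrt (by positivity)]
  field_simp

lemma volume_mul_maxGrad_sq {C : ℝ} (hC : 0 < C) (v : Pt d → ℝ) {T : Finset (Pt d)}
    (hT : T ∈ 𝒯.elements) : volume.real (cell T) * maxGrad C v T ^ 2 = C * energySq v T := by
  have h1 := volume_cell_pos hT
  have h2 := energySq_nonneg v T
  rw [maxGrad, Real.sq_sqrt (by positivity)]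
  field_simp

lemma abs_le_maxVal {C : ℝ} (hC : 𝒯.InverseEstimate C) {v : Pt d → ℝ} (hv : v ∈ 𝒯.Vh)
    {T : Finset (Pt d)} (hT : T ∈ 𝒯.elements) {x : Pt d} (hx : x ∈ cell T) :
    |v x| ≤ maxVal C v T := by
  refine Real.abs_le_sqrt ?_
  rw [le_div_iff₀' (volume_cell_pos hT)]
  exact volume_mul_sq_le hC hv hT hx

lemma abs_gradDot_le {C : ℝ} (hC : 𝒯.InverseEstimate C) {v : Pt d → ℝ} (hv : v ∈ 𝒯.Vh)
    {T : Finset (Pt d)} (hT : T ∈ 𝒯.elements) {x : Pt d} (hx : x ∈ cell T) (n : Pt d) :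
    |gradDot v T x n| ≤ maxGrad C v T * ‖n‖ := by
  have h1 := volume_cell_pos hT
  refine abs_le_of_sq_le_sq ?_ (mul_nonneg (maxGrad_nonneg _ _ _) (norm_nonneg _))
  refine le_of_mul_le_mul_left ?_ h1
  rw [mul_pow, ← mul_assoc, volume_mul_maxGrad_sq hC.1 v hT]
  exact volume_mul_gradDot_sq_le hC hv hT hx n

/-- The elementwise Laplacian and the jumps control the energy. -/
lemma sum_energySq_le (hd : 1 ≤ d) (hΩ_open : IsOpen Ω) (hΩ_nonempty : Ω.Nonempty)
    (hΩ_bounded : Bornology.IsBounded Ω) {C₁ C₂ : ℝ} (hC₁ : 𝒯.FacetScaling C₁)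
    (hC₂ : 𝒯.InverseEstimate C₂) {v : Pt d → ℝ} (hv : v ∈ 𝒯.Vh) :
    ∑ T ∈ 𝒯.elements, energySq v T ≤
      (4 * Metric.diam Ω ^ 2 * (1 + (d + 1) * C₁ * C₂) + 1) *
        (∑ T ∈ 𝒯.elements, volume.real (cell T) * 𝒯.elemLaplacian v T ^ 2 +
          ∑ e ∈ 𝒯.interiorFaces, 𝒯.jumpSq v e) := by
  set K : ℝ := 1 + (d + 1) * C₁ * C₂ with hK
  set R2 : ℝ := 4 * Metric.diam Ω ^ 2 with hR2
  -- the weight in Young's inequality; it is so large that the Poincaré inequality lets half of the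
  -- energy absorb the terms that contain `v`
  set s : ℝ := R2 * K + 1 with hs
  have hC₁0 := hC₁.1
  have hC₂0 := hC₂.1
  have hK0 : 0 < K := by positivity
  have hR20 : 0 ≤ R2 := by positivity
  have hs0 : 0 < s := by positivity
  set X := ∑ T ∈ 𝒯.elements, massSq v T with hX
  set Y := ∑ T ∈ 𝒯.elements, energySq v T with hY
  set P := ∑ T ∈ 𝒯.elements, volume.real (cell T) * 𝒯.elemLaplacian v T ^ 2 with hP
  set Q := ∑ e ∈ 𝒯.interiorFaces, 𝒯.jumpSq v e with hQ
  have hXY : X ≤ R2 * Y := sum_massSq_le hd hΩ_open hΩ_nonempty hΩ_bounded hv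
  have hY0 : 0 ≤ Y := Finset.sum_nonneg fun T _ => energySq_nonneg v T
  -- Young's inequality on the elements
  have h1 : -(∑ T ∈ 𝒯.elements, 𝒯.elemLaplacian v T * ∫ x in cell T, v x) ≤
      s / 2 * P + 1 / (2 * s) * X := by
    rw [hP, hX, Finset.mul_sum, Finset.mul_sum, ← Finset.sum_add_distrib,
      ← Finset.sum_neg_distrib]
    refine Finset.sum_le_sum fun T hT => ?_
    have hc := isCompact_cell T
    have c1 : IntegrableOn v (cell T) := hv.1.continuousOn.integrableOn_compact hc
    have c2 : IntegrableOn (fun x => v x ^ 2) (cell T) :=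
      (hv.1.pow 2).continuousOn.integrableOn_compact hc
    have c0 : IntegrableOn (fun _ : Pt d => s / 2 * 𝒯.elemLaplacian v T ^ 2) (cell T) :=
      continuousOn_const.integrableOn_compact hc
    have e1 : s / 2 * (volume.real (cell T) * 𝒯.elemLaplacian v T ^ 2) +
        1 / (2 * s) * massSq v T =
        ∫ x in cell T, (s / 2 * 𝒯.elemLaplacian v T ^ 2 + 1 / (2 * s) * v x ^ 2) := by
      rw [integral_add c0 (c2.const_mul _), setIntegral_const, integral_const_mul, massSq,
        smul_eq_mul]
      ring
    rw [e1, ← integral_const_mul, ← integral_neg]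
    refine integral_mono (c1.const_mul _).neg (c0.add (c2.const_mul _)) fun x => ?_
    have : 0 ≤ (s * 𝒯.elemLaplacian v T + v x) ^ 2 / (2 * s) := by positivity
    have e2 : (s * 𝒯.elemLaplacian v T + v x) ^ 2 / (2 * s) =
        s / 2 * 𝒯.elemLaplacian v T ^ 2 + 1 / (2 * s) * v x ^ 2 + 𝒯.elemLaplacian v T * v x := by
      field_simp
      ring
    rw [e2] at this
    beta_reduce
    linarith
  -- Young's inequality on the faces
  have h2 : -(∑ e ∈ 𝒯.interiorFaces, ∫ x, v x * 𝒯.normalJump v e x ∂(surf e)) ≤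
      s / 2 * Q + 1 / (2 * s) *
        ∑ e ∈ 𝒯.interiorFaces, faceSize e * ∫ x, v x ^ 2 ∂(surf e) := by
    rw [hQ, Finset.mul_sum, Finset.mul_sum, ← Finset.sum_add_distrib,
      ← Finset.sum_neg_distrib]
    refine Finset.sum_le_sum fun e he => ?_
    have hef := (mem_interiorFaces.1 he).1
    have hf := (hC₁.2 e hef).1
    have hj := continuousOn_normalJump hv e
    have hvc : ContinuousOn v (cell e) := hv.1.continuousOn
    have c1 : Integrable (fun x => v x * 𝒯.normalJump v e x) (surf e) :=
      integrable_surf hef (hvc.mul hj)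
    have c2 : Integrable (fun x => v x ^ 2) (surf e) := integrable_surf hef (hvc.pow 2)
    have c3 : Integrable (fun x => 𝒯.normalJump v e x ^ 2) (surf e) :=
      integrable_surf hef (hj.pow 2)
    rw [jumpSq, ← mul_assoc, ← mul_assoc, ← integral_const_mul, ← integral_const_mul,
      ← integral_add (c3.const_mul _) (c2.const_mul _), ← integral_neg]
    refine integral_mono c1.neg ((c3.const_mul _).add (c2.const_mul _)) fun x => ?_
    set J := 𝒯.normalJump v e x with hJ
    set f := faceSize e with hf'
    have : 0 ≤ (s * J + f * v x) ^ 2 / (2 * s * f) := by positivity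
    have e2 : (s * J + f * v x) ^ 2 / (2 * s * f) =
        s / 2 * f⁻¹ * J ^ 2 + 1 / (2 * s) * f * v x ^ 2 + v x * J := by
      field_simp
      ring
    rw [e2] at this
    beta_reduce
    linarith
  -- the trace of `v` on the faces, by the inverse estimate
  have h3 : ∑ e ∈ 𝒯.interiorFaces, faceSize e * ∫ x, v x ^ 2 ∂(surf e) ≤
      (d + 1) * C₁ * C₂ * X := by
    have h4 : ∀ T ∈ 𝒯.elements, ∀ e ∈ 𝒯.facesOf T,
        faceSize e * ∫ x, v x ^ 2 ∂(surf e) ≤ C₁ * C₂ * massSq v T := by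
      intro T hT e he
      obtain ⟨hef, heT⟩ := mem_facesOf.1 he
      obtain ⟨hf, hsc⟩ := hC₁.2 e hef
      have hfin : IsFiniteMeasure (surf e) := ⟨surf_lt_top hef⟩
      have hle : ∫ x, v x ^ 2 ∂(surf e) ≤ (surf e).real Set.univ * maxVal C₂ v T ^ 2 := by
        rw [← smul_eq_mul, ← integral_const]
        refine integral_mono_ae (integrable_surf hef (hv.1.pow 2).continuousOn)
          (integrable_const _) ?_
        filter_upwards [ae_surf_mem e] with x hx
        rw [← sq_abs]
        exact pow_le_pow_left₀ (abs_nonneg _) (abs_le_maxVal hC₂ hv hT (cell_mono heT hx)) 2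
      calc faceSize e * ∫ x, v x ^ 2 ∂(surf e)
          ≤ faceSize e * ((surf e).real Set.univ * maxVal C₂ v T ^ 2) := by gcongr
        _ = (faceSize e * (surf e).real Set.univ) * maxVal C₂ v T ^ 2 := by ring
        _ ≤ (C₁ * volume.real (cell T)) * maxVal C₂ v T ^ 2 := by
          have := (hsc T (mem_elementsAt.2 ⟨hT, heT⟩)).1
          gcongr
        _ = _ := by rw [mul_assoc, volume_mul_maxVal_sq hC₂0 v hT]; ring
    calc ∑ e ∈ 𝒯.interiorFaces, faceSize e * ∫ x, v x ^ 2 ∂(surf e)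
        ≤ ∑ e ∈ 𝒯.faces, ∑ T ∈ 𝒯.elementsAt e, faceSize e * ∫ x, v x ^ 2 ∂(surf e) := by
          have hpos : ∀ e, 0 ≤ faceSize e * ∫ x, v x ^ 2 ∂(surf e) := fun e =>
            mul_nonneg (faceSize_nonneg e) (integral_nonneg fun _ => sq_nonneg _)
          refine (Finset.sum_le_sum_of_subset_of_nonneg 𝒯.interiorFaces_subset
            fun e _ _ => hpos e).trans (Finset.sum_le_sum fun e he => ?_)
          obtain ⟨T, hT⟩ := elementsAt_nonempty he
          exact Finset.single_le_sum (f := fun _ => faceSize e * ∫ x, v x ^ 2 ∂(surf e))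
            (fun _ _ => hpos e) hT
      _ = ∑ T ∈ 𝒯.elements, ∑ e ∈ 𝒯.facesOf T, faceSize e * ∫ x, v x ^ 2 ∂(surf e) :=
          (sum_elements_facesOf (F := fun _ e => faceSize e * ∫ x, v x ^ 2 ∂(surf e))).symm
      _ ≤ ∑ T ∈ 𝒯.elements, ∑ e ∈ 𝒯.facesOf T, C₁ * C₂ * massSq v T :=
          Finset.sum_le_sum fun T hT => Finset.sum_le_sum fun e he => h4 T hT e he
      _ = _ := by
          rw [hX, Finset.mul_sum]
          refine Finset.sum_congr rfl fun T hT => ?_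
          rw [Finset.sum_const, nsmul_eq_mul, card_facesOf hd hT]
          ring
  have h5 : Y ≤ s / 2 * (P + Q) + 1 / (2 * s) * (K * X) := by
    have := sum_energySq hd hΩ_open hv
    have h6 : 1 / (2 * s) * ∑ e ∈ 𝒯.interiorFaces, faceSize e * ∫ x, v x ^ 2 ∂(surf e) ≤
        1 / (2 * s) * ((d + 1) * C₁ * C₂ * X) := by gcongr
    have h7 : 1 / (2 * s) * (K * X) = 1 / (2 * s) * X + 1 / (2 * s) * ((d + 1) * C₁ * C₂ * X) := by
      rw [hK]; ring
    rw [h7]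
    linarith
  have h6 : 1 / (2 * s) * (K * X) ≤ 1 / 2 * Y := by
    calc 1 / (2 * s) * (K * X) ≤ 1 / (2 * s) * (K * (R2 * Y)) := by gcongr
      _ = (R2 * K) / s * (1 / 2 * Y) := by field_simp
      _ ≤ 1 * (1 / 2 * Y) := by
        gcongr
        rw [div_le_one hs0, hs]
        linarith
      _ = _ := one_mul _
  linarith

/-- The form `a_w` controls the broken `H¹`-norm, the elementwise Laplacian and the jumps. -/
theorem exists_coercivity (hd : 2 ≤ d) (hΩ_open : IsOpen Ω) (hΩ_nonempty : Ω.Nonempty)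
    (hΩ_bounded : Bornology.IsBounded Ω) (hΩ_convex : Convex ℝ Ω) {σ : ℝ} (hσ : 0 < σ) :
    ∃ C : ℝ, 0 < C ∧ ∀ 𝒯 : Triangulation Ω, 𝒯.IsShapeRegular σ → ∀ v ∈ 𝒯.Vh,
      ∑ T ∈ 𝒯.elements, (volume.real (cell T) * 𝒯.elemLaplacian v T ^ 2 + energySq v T +
        massSq v T) + ∑ e ∈ 𝒯.interiorFaces, 𝒯.jumpSq v e ≤
        C * 𝒯.form 𝒯.elements 𝒯.interiorFaces v v := by
  obtain ⟨C₁, hC₁, h₁⟩ := exists_facetScaling (Ω := Ω) hd hσ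
  obtain ⟨C₂, hC₂, h₂⟩ := exists_inverseEstimate (Ω := Ω) (by omega : 1 ≤ d) hσ
  set R2 : ℝ := 4 * Metric.diam Ω ^ 2 with hR2
  set s : ℝ := R2 * (1 + (d + 1) * C₁ * C₂) + 1 with hs
  set B : ℝ := 6 + 16 * ((d + 1) * C₁) with hB
  have hs0 : 0 < s := by positivity
  have hB0 : 0 < B := by positivity
  refine ⟨(1 + (1 + R2) * s) * B, by positivity, fun 𝒯 h𝒯 v hv => ?_⟩
  have hE := sum_energySq_le (by omega) hΩ_open hΩ_nonempty hΩ_bounded (h₁ 𝒯 h𝒯) (h₂ 𝒯 h𝒯) hv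
  have hM := sum_massSq_le (𝒯 := 𝒯) (by omega) hΩ_open hΩ_nonempty hΩ_bounded hv
  rw [← hR2] at hM
  rw [← hR2, ← hs] at hE
  rw [Finset.sum_add_distrib, Finset.sum_add_distrib, form_self]
  set P := ∑ T ∈ 𝒯.elements, volume.real (cell T) * 𝒯.elemLaplacian v T ^ 2
  set Q := ∑ e ∈ 𝒯.interiorFaces, 𝒯.jumpSq v e
  set W := ∑ T ∈ 𝒯.elements, volume.real (cell T) * 𝒯.weakLaplacian v T ^ 2
  have hQ0 : 0 ≤ Q := Finset.sum_nonneg fun e _ => jumpSq_nonneg v e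
  have hW0 : 0 ≤ W := Finset.sum_nonneg fun T _ => mul_nonneg measureReal_nonneg (sq_nonneg _)
  have hP : P ≤ 2 * W + 4 * ((d + 1) * C₁) * Q := by
    have h1 : ∀ T ∈ 𝒯.elements, volume.real (cell T) * 𝒯.elemLaplacian v T ^ 2 ≤
        2 * (volume.real (cell T) * 𝒯.weakLaplacian v T ^ 2) + 2 * ((d + 1) * C₁ *
          ∑ e ∈ 𝒯.facesOf T with e ∈ 𝒯.interiorFaces, 𝒯.jumpSq v e) := by
      intro T hT
      have h2 := weakLaplacian_sub_sq_le (by omega) hΩ_open hΩ_convex (h₁ 𝒯 h𝒯) hv hT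
      have h3 : 𝒯.elemLaplacian v T ^ 2 ≤ 2 * 𝒯.weakLaplacian v T ^ 2 +
          2 * (𝒯.weakLaplacian v T - 𝒯.elemLaplacian v T) ^ 2 := by
        nlinarith [sq_nonneg (2 * 𝒯.weakLaplacian v T - 𝒯.elemLaplacian v T)]
      have h4 := mul_le_mul_of_nonneg_left h3 (volume_cell_pos hT).le
      linarith
    have h5 := sum_elements_interior_facesOf_le (𝒯 := 𝒯) (by omega)
      (F := fun e => 𝒯.jumpSq v e) fun e => jumpSq_nonneg v e
    calc P ≤ ∑ T ∈ 𝒯.elements, (2 * (volume.real (cell T) * 𝒯.weakLaplacian v T ^ 2) +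
          2 * ((d + 1) * C₁ *
          ∑ e ∈ 𝒯.facesOf T with e ∈ 𝒯.interiorFaces, 𝒯.jumpSq v e)) := Finset.sum_le_sum h1
      _ = 2 * W + 2 * ((d + 1) * C₁) * ∑ T ∈ 𝒯.elements,
          ∑ e ∈ 𝒯.facesOf T with e ∈ 𝒯.interiorFaces, 𝒯.jumpSq v e := by
        rw [Finset.sum_add_distrib, ← Finset.mul_sum, ← Finset.mul_sum, ← Finset.mul_sum]
        ring
      _ ≤ 2 * W + 2 * ((d + 1) * C₁) * (2 * Q) := by gcongr
      _ = _ := by ring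
  have hPQ : P + Q ≤ B * (W + 1 / 4 * Q) := by
    have h7 : 0 ≤ (d + 1) * C₁ * W := by positivity
    rw [hB]
    nlinarith
  have hR20 : 0 ≤ R2 := by positivity
  have h8 : s * (P + Q) ≤ s * (B * (W + 1 / 4 * Q)) := mul_le_mul_of_nonneg_left hPQ hs0.le
  have h9 := mul_le_mul_of_nonneg_left (hE.trans h8) hR20
  have h10 := hE.trans h8
  nlinarith

end Triangulation

namespace Triangulation

variable {d : ℕ} {Ω : Set (Pt d)} {𝒯 : Triangulation Ω} {D : Set (Pt d)}

/-! ### Subdomains that are aligned with the mesh -/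

/-- The open set `D` is the interior of a union of elements. -/
def IsAligned (𝒯 : Triangulation Ω) (D : Set (Pt d)) : Prop :=
  ∃ 𝒮 ⊆ 𝒯.elements, D = interior (⋃ T ∈ 𝒮, cell T)

lemma mem_localElements {T : Finset (Pt d)} :
    T ∈ 𝒯.localElements D ↔ T ∈ 𝒯.elements ∧ cell T ⊆ closure D := by
  simp [localElements]

lemma mem_localFaces {e : Finset (Pt d)} :
    e ∈ 𝒯.localFaces D ↔ e ∈ 𝒯.interiorFaces ∧ cell e ⊆ closure D := by
  simp [localFaces]

lemma cell_eq_closure_interior {T : Finset (Pt d)} (hT : T ∈ 𝒯.elements) :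
    cell T = closure (interior (cell T)) := by
  have h : Convex ℝ (cell T) := convex_convexHull ℝ _
  rw [h.closure_interior_eq_closure_of_nonempty_interior (isSimplex hT).exists_mem_interior,
    (isCompact_cell T).isClosed.closure_eq]

/-- The elements in the closure of the interior of a union of elements are those of the union. -/
lemma localElements_interior_iUnion (hd : 1 ≤ d) {𝒮 : Finset (Finset (Pt d))}
    (h𝒮 : 𝒮 ⊆ 𝒯.elements) : 𝒯.localElements (interior (⋃ T ∈ 𝒮, cell T)) = 𝒮 := by
  ext T
  rw [mem_localElements]
  constructor
  · rintro ⟨hT, hsub⟩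
    by_contra hT'
    obtain ⟨x, hx⟩ := (isSimplex hT).exists_mem_interior
    have h1 : Disjoint (interior (cell T)) (⋃ S ∈ 𝒮, cell S) := by
      rw [Set.disjoint_iUnion₂_right]
      intro S hS
      exact disjoint_interior_cell hd hT (h𝒮 hS) (by rintro rfl; exact hT' hS)
    have h2 := (h1.mono_right interior_subset).closure_right isOpen_interior
    exact Set.disjoint_left.1 h2 hx (hsub (interior_subset hx))
  · intro hT
    refine ⟨h𝒮 hT, ?_⟩
    rw [cell_eq_closure_interior (h𝒮 hT)]
    exact closure_mono (interior_mono (Set.subset_iUnion₂_of_subset T hT subset_rfl))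

lemma IsAligned.eq_interior (hd : 1 ≤ d) (hD : 𝒯.IsAligned D) :
    D = interior (⋃ T ∈ 𝒯.localElements D, cell T) := by
  obtain ⟨𝒮, h𝒮, rfl⟩ := hD
  rw [localElements_interior_iUnion hd h𝒮]

lemma IsAligned.interior_cell_subset (hd : 1 ≤ d) (hD : 𝒯.IsAligned D) {T : Finset (Pt d)}
    (hT : T ∈ 𝒯.localElements D) : interior (cell T) ⊆ D := by
  rw [hD.eq_interior hd]
  exact interior_mono (Set.subset_iUnion₂_of_subset T hT subset_rfl)

lemma IsAligned.disjoint_interior_cell (hd : 1 ≤ d) (hD : 𝒯.IsAligned D) {T : Finset (Pt d)}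
    (hT : T ∈ 𝒯.elements) (hTD : T ∉ 𝒯.localElements D) : Disjoint (interior (cell T)) D := by
  rw [hD.eq_interior hd]
  refine Disjoint.mono_right interior_subset ?_
  rw [Set.disjoint_iUnion₂_right]
  intro S hS
  exact Triangulation.disjoint_interior_cell hd hT (mem_localElements.1 hS).1
    (by rintro rfl; exact hTD hS)

/-- A function on `closure Ω` that vanishes on `Ω \ D` vanishes on the elements outside of `D`. -/
lemma IsAligned.eq_zero_of_mem_cell (hd : 1 ≤ d) (hΩ_open : IsOpen Ω) (hΩ_convex : Convex ℝ Ω)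
    (hD : 𝒯.IsAligned D) {f : Pt d → ℝ} (hf : ContinuousOn f (closure Ω))
    (hf0 : ∀ x ∈ Ω \ D, f x = 0) {T : Finset (Pt d)} (hT : T ∈ 𝒯.elements)
    (hTD : T ∉ 𝒯.localElements D) {x : Pt d} (hx : x ∈ cell T) : f x = 0 := by
  have h := Set.disjoint_left.1 (hD.disjoint_interior_cell hd hT hTD)
  have h0 : Set.EqOn f (fun _ => 0) (interior (cell T)) := fun y hy =>
    hf0 y ⟨Triangulation.interior_cell_subset hΩ_open hΩ_convex hT hy, h hy⟩
  have h1 : Set.EqOn f (fun _ => 0) (cell T) := by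
    refine h0.of_subset_closure (hf.mono (cell_subset_closure hT)) continuousOn_const
      interior_subset ?_
    rw [← cell_eq_closure_interior hT]
  exact h1 hx

/-- The points of `Ω \ D` lie in elements outside of `D`. -/
lemma IsAligned.exists_mem_cell (hd : 1 ≤ d) (hΩ_open : IsOpen Ω) (hD : 𝒯.IsAligned D) {x : Pt d}
    (hx : x ∈ Ω \ D) : ∃ T ∈ 𝒯.elements, T ∉ 𝒯.localElements D ∧ x ∈ cell T := by
  by_contra! h
  refine hx.2 ?_
  rw [hD.eq_interior hd, mem_interior_iff_mem_nhds]
  have h1 : IsClosed (⋃ T ∈ 𝒯.elements \ 𝒯.localElements D, cell T) :=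
    Set.Finite.isClosed_biUnion (Finset.finite_toSet _) fun T _ => (isCompact_cell T).isClosed
  have h2 : x ∉ ⋃ T ∈ 𝒯.elements \ 𝒯.localElements D, cell T := by
    simp only [Set.mem_iUnion, not_exists]
    intro T hT
    rw [Finset.mem_sdiff] at hT
    exact h T hT.1 hT.2
  filter_upwards [h1.isOpen_compl.mem_nhds h2, hΩ_open.mem_nhds hx.1] with y hy hyΩ
  obtain ⟨T, hT, hyT⟩ := Triangulation.exists_mem_cell (𝒯 := 𝒯) (subset_closure hyΩ)
  by_cases hTD : T ∈ 𝒯.localElements D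
  · exact Set.mem_biUnion hTD hyT
  · exact absurd (Set.mem_biUnion (Finset.mem_coe.2 (Finset.mem_sdiff.2 ⟨hT, hTD⟩)) hyT) hy

lemma mem_localFaces_of_mem_localElements {e T : Finset (Pt d)} (he : e ∈ 𝒯.interiorFaces)
    (hT : T ∈ 𝒯.localElements D) (heT : e ⊆ T) : e ∈ 𝒯.localFaces D :=
  mem_localFaces.2 ⟨he, (cell_mono heT).trans (mem_localElements.1 hT).2⟩

/-! ### Functions supported in a subdomain -/

lemma gradDot_eq_zero {v : Pt d → ℝ} {T : Finset (Pt d)} (hT : T ∈ 𝒯.elements)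
    (hv : ∀ x ∈ cell T, v x = 0) {x : Pt d} (hx : x ∈ cell T) (n : Pt d) :
    gradDot v T x n = 0 := by
  rw [gradDot_eq_quadDeriv hT (c := 0) (b := 0) (A := 0) (fun y hy => by simp [hv y hy, quad]) hx]
  simp [quadDeriv]

lemma elemLaplacian_eq_zero (hd : 1 ≤ d) {v : Pt d → ℝ} {T : Finset (Pt d)}
    (hT : T ∈ 𝒯.elements) (hv : ∀ x ∈ cell T, v x = 0) : 𝒯.elemLaplacian v T = 0 := by
  rw [elemLaplacian_eq hd hT (c := 0) (b := 0) (A := 0) (fun y hy => by simp [hv y hy, quad])]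
  simp [quadLaplacian]

lemma jumpSq_eq_zero {v : Pt d → ℝ} {e : Finset (Pt d)}
    (hv : ∀ T ∈ 𝒯.elementsAt e, ∀ x ∈ cell T, v x = 0) : 𝒯.jumpSq v e = 0 := by
  rw [jumpSq, integral_surf_congr (g := fun _ => 0) fun x hx => ?_, integral_zero, mul_zero]
  rw [normalJump, Finset.sum_eq_zero fun T hT => ?_]
  · simp
  · obtain ⟨hTe, heT⟩ := mem_elementsAt.1 hT
    exact gradDot_eq_zero hTe (hv T hT) (cell_mono heT hx) _

/-- On functions supported in an aligned subdomain, the local form controls the global form. -/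
lemma IsAligned.form_le (hd : 1 ≤ d) (hΩ_open : IsOpen Ω) (hΩ_convex : Convex ℝ Ω)
    (hD : 𝒯.IsAligned D) {C : ℝ} (hC : 𝒯.FacetScaling C) {v : Pt d → ℝ} (hv : v ∈ 𝒯.Vh)
    (hv0 : ∀ x ∈ Ω \ D, v x = 0) :
    𝒯.form 𝒯.elements 𝒯.interiorFaces v v ≤
      (1 + 8 * ((d + 1) * C)) * 𝒯.form (𝒯.localElements D) (𝒯.localFaces D) v v := by
  have hC0 := hC.1
  have hz : ∀ T ∈ 𝒯.elements, T ∉ 𝒯.localElements D → ∀ x ∈ cell T, v x = 0 :=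
    fun T hT hTD x hx => hD.eq_zero_of_mem_cell hd hΩ_open hΩ_convex hv.1.continuousOn hv0 hT hTD hx
  have hQ : ∑ e ∈ 𝒯.interiorFaces, 𝒯.jumpSq v e = ∑ e ∈ 𝒯.localFaces D, 𝒯.jumpSq v e := by
    refine (Finset.sum_subset (Finset.filter_subset _ _) fun e he hel => ?_).symm
    refine jumpSq_eq_zero fun T hT => ?_
    obtain ⟨hTe, heT⟩ := mem_elementsAt.1 hT
    exact hz T hTe fun hTD => hel (mem_localFaces_of_mem_localElements he hTD heT)
  rw [form_self, form_self, hQ]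
  set Q := ∑ e ∈ 𝒯.localFaces D, 𝒯.jumpSq v e with hQdef
  set W := ∑ T ∈ 𝒯.localElements D, volume.real (cell T) * 𝒯.weakLaplacian v T ^ 2 with hW
  have hQ0 : 0 ≤ Q := Finset.sum_nonneg fun e _ => jumpSq_nonneg v e
  have hW0 : 0 ≤ W := Finset.sum_nonneg fun T _ => mul_nonneg measureReal_nonneg (sq_nonneg _)
  have h1 : ∑ T ∈ 𝒯.elements, volume.real (cell T) * 𝒯.weakLaplacian v T ^ 2 ≤
      W + (d + 1) * C * (2 * Q) := by
    have h2 : ∀ T ∈ 𝒯.elements, volume.real (cell T) * 𝒯.weakLaplacian v T ^ 2 ≤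
        (if T ∈ 𝒯.localElements D then volume.real (cell T) * 𝒯.weakLaplacian v T ^ 2 else 0) +
          (d + 1) * C * ∑ e ∈ 𝒯.facesOf T with e ∈ 𝒯.interiorFaces, 𝒯.jumpSq v e := by
      intro T hT
      have h3 : 0 ≤ ∑ e ∈ 𝒯.facesOf T with e ∈ 𝒯.interiorFaces, 𝒯.jumpSq v e :=
        Finset.sum_nonneg fun e _ => jumpSq_nonneg v e
      split_ifs with hTD
      · have : 0 ≤ (d + 1) * C * ∑ e ∈ 𝒯.facesOf T with e ∈ 𝒯.interiorFaces, 𝒯.jumpSq v e := by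
          positivity
        linarith
      -- outside of `D` the elementwise Laplacian vanishes, and only fluxes of jumps remain
      · have h4 := weakLaplacian_sub_sq_le hd hΩ_open hΩ_convex hC hv hT
        rw [elemLaplacian_eq_zero hd hT (hz T hT hTD), sub_zero] at h4
        linarith
    refine (Finset.sum_le_sum h2).trans ?_
    rw [Finset.sum_add_distrib, ← Finset.mul_sum, ← Finset.sum_filter]
    have h5 : {T ∈ 𝒯.elements | T ∈ 𝒯.localElements D} = 𝒯.localElements D := by
      ext T
      simp only [Finset.mem_filter, mem_localElements]
      tauto
    rw [h5, ← hW]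
    have h6 := sum_elements_interior_facesOf_le (𝒯 := 𝒯) hd
      (F := fun e => 𝒯.jumpSq v e) fun e => jumpSq_nonneg v e
    rw [hQ] at h6
    gcongr
  have h7 : 0 ≤ (d + 1) * C * W := by positivity
  nlinarith

/-- The local forms are partial sums of the nonnegative terms of the global form. -/
lemma form_local_le (D : Set (Pt d)) (v : Pt d → ℝ) :
    𝒯.form (𝒯.localElements D) (𝒯.localFaces D) v v ≤
      𝒯.form 𝒯.elements 𝒯.interiorFaces v v := by
  rw [form_self, form_self]
  have h1 : ∑ T ∈ 𝒯.localElements D, volume.real (cell T) * 𝒯.weakLaplacian v T ^ 2 ≤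
      ∑ T ∈ 𝒯.elements, volume.real (cell T) * 𝒯.weakLaplacian v T ^ 2 :=
    Finset.sum_le_sum_of_subset_of_nonneg (Finset.filter_subset _ _) fun T _ _ =>
      mul_nonneg measureReal_nonneg (sq_nonneg _)
  have h2 : ∑ e ∈ 𝒯.localFaces D, 𝒯.jumpSq v e ≤ ∑ e ∈ 𝒯.interiorFaces, 𝒯.jumpSq v e :=
    Finset.sum_le_sum_of_subset_of_nonneg (Finset.filter_subset _ _) fun e _ _ => jumpSq_nonneg v e
  linarith

/-- The elementwise Laplacian and the jumps control the form. -/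
lemma form_le_sum (hd : 1 ≤ d) (hΩ_open : IsOpen Ω) (hΩ_convex : Convex ℝ Ω)
    {C : ℝ} (hC : 𝒯.FacetScaling C) {v : Pt d → ℝ} (hv : v ∈ 𝒯.Vh) :
    𝒯.form 𝒯.elements 𝒯.interiorFaces v v ≤ (2 + 4 * ((d + 1) * C)) *
      (∑ T ∈ 𝒯.elements, volume.real (cell T) * 𝒯.elemLaplacian v T ^ 2 +
        ∑ e ∈ 𝒯.interiorFaces, 𝒯.jumpSq v e) := by
  have hC0 := hC.1
  rw [form_self]
  set Q := ∑ e ∈ 𝒯.interiorFaces, 𝒯.jumpSq v e with hQ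
  set P := ∑ T ∈ 𝒯.elements, volume.real (cell T) * 𝒯.elemLaplacian v T ^ 2 with hP
  have hQ0 : 0 ≤ Q := Finset.sum_nonneg fun e _ => jumpSq_nonneg v e
  have hP0 : 0 ≤ P := Finset.sum_nonneg fun T _ => mul_nonneg measureReal_nonneg (sq_nonneg _)
  have h1 : ∑ T ∈ 𝒯.elements, volume.real (cell T) * 𝒯.weakLaplacian v T ^ 2 ≤
      2 * P + 2 * ((d + 1) * C) * (2 * Q) := by
    have h2 : ∀ T ∈ 𝒯.elements, volume.real (cell T) * 𝒯.weakLaplacian v T ^ 2 ≤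
        2 * (volume.real (cell T) * 𝒯.elemLaplacian v T ^ 2) + 2 * ((d + 1) * C) *
          ∑ e ∈ 𝒯.facesOf T with e ∈ 𝒯.interiorFaces, 𝒯.jumpSq v e := by
      intro T hT
      have h4 := weakLaplacian_sub_sq_le hd hΩ_open hΩ_convex hC hv hT
      have h3 : 𝒯.weakLaplacian v T ^ 2 ≤ 2 * 𝒯.elemLaplacian v T ^ 2 +
          2 * (𝒯.weakLaplacian v T - 𝒯.elemLaplacian v T) ^ 2 := by
        nlinarith [sq_nonneg (2 * 𝒯.elemLaplacian v T - 𝒯.weakLaplacian v T)]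
      have h5 := mul_le_mul_of_nonneg_left h3 (volume_cell_pos hT).le
      linarith
    refine (Finset.sum_le_sum h2).trans ?_
    rw [Finset.sum_add_distrib, ← Finset.mul_sum, ← Finset.mul_sum]
    have h6 := sum_elements_interior_facesOf_le (𝒯 := 𝒯) hd
      (F := fun e => 𝒯.jumpSq v e) fun e => jumpSq_nonneg v e
    gcongr
  have h7 : 0 ≤ (d + 1) * C * P := by positivity
  nlinarith

/-! ### Overlap counts -/

/-- An element belongs to boundedly many subdomains. -/
lemma card_localElements_le (hd : 1 ≤ d) (hΩ_open : IsOpen Ω) (hΩ_convex : Convex ℝ Ω) {J : ℕ}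
    {D : Fin J → Set (Pt d)} {Nc : ℕ} (hD : ∀ j, 𝒯.IsAligned (D j))
    (hNc : ∀ x ∈ Ω, Nat.card {j : Fin J // x ∈ D j} ≤ Nc) {T : Finset (Pt d)}
    (hT : T ∈ 𝒯.elements) :
    (Finset.univ.filter fun j => T ∈ 𝒯.localElements (D j)).card ≤ Nc := by
  obtain ⟨x, hx⟩ := (isSimplex hT).exists_mem_interior
  refine le_trans ?_ (hNc x (Triangulation.interior_cell_subset hΩ_open hΩ_convex hT hx))
  rw [Nat.card_eq_fintype_card, Fintype.card_subtype]
  refine Finset.card_le_card fun j hj => ?_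
  rw [Finset.mem_filter] at hj ⊢
  exact ⟨hj.1, (hD j).interior_cell_subset hd hj.2 hx⟩

/-- A face lies in elements of boundedly many subdomains. -/
lemma card_elementsAt_localElements_le (hd : 1 ≤ d) (hΩ_open : IsOpen Ω) (hΩ_convex : Convex ℝ Ω)
    {J : ℕ} {D : Fin J → Set (Pt d)} {Nc : ℕ} (hD : ∀ j, 𝒯.IsAligned (D j))
    (hNc : ∀ x ∈ Ω, Nat.card {j : Fin J // x ∈ D j} ≤ Nc) {e : Finset (Pt d)}
    (he : e ∈ 𝒯.faces) :
    (Finset.univ.filter fun j => ∃ T ∈ 𝒯.elementsAt e, T ∈ 𝒯.localElements (D j)).card ≤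
      2 * Nc := by
  have h1 : (Finset.univ.filter fun j => ∃ T ∈ 𝒯.elementsAt e, T ∈ 𝒯.localElements (D j)) ⊆
      (𝒯.elementsAt e).biUnion fun T => Finset.univ.filter fun j => T ∈ 𝒯.localElements (D j) := by
    intro j hj
    simpa using hj
  refine (Finset.card_le_card h1).trans (Finset.card_biUnion_le.trans ?_)
  refine (Finset.sum_le_card_nsmul _ _ Nc fun T hT => card_localElements_le hd hΩ_open hΩ_convex
    hD hNc (mem_elementsAt.1 hT).1).trans ?_
  rw [smul_eq_mul]
  exact Nat.mul_le_mul_right _ (card_elementsAt_le hd he)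

end Triangulation

/-! ### Sums with few nonzero terms -/

/-- The Cauchy–Schwarz inequality for sums with at most `N` nonzero terms. -/
lemma sq_sum_le_of_card_le {ι : Type*} [Fintype ι] {N : ℕ} {f : ι → ℝ} {p : ι → Prop}
    [DecidablePred p]
    (hp : (Finset.univ.filter p).card ≤ N) (hf : ∀ j, ¬ p j → f j = 0) :
    (∑ j, f j) ^ 2 ≤ N * ∑ j, f j ^ 2 := by
  have h1 : ∑ j, f j = ∑ j with p j, f j := by
    rw [Finset.sum_filter]
    refine Finset.sum_congr rfl fun j _ => ?_
    split_ifs with h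
    · rfl
    · exact hf j h
  rw [h1]
  have hpos : ∀ j ∈ Finset.univ, 0 ≤ f j ^ 2 := fun j _ => sq_nonneg _
  calc (∑ j with p j, f j) ^ 2 ≤ (Finset.univ.filter p).card * ∑ j with p j, f j ^ 2 :=
        sq_sum_le_card_mul_sum_sq
    _ ≤ N * ∑ j, f j ^ 2 := by
        have h2 : ∑ j with p j, f j ^ 2 ≤ ∑ j, f j ^ 2 :=
          Finset.sum_le_sum_of_subset_of_nonneg (Finset.filter_subset _ _) fun j _ _ => sq_nonneg _
        have h3 : ((Finset.univ.filter p).card : ℝ) ≤ N := by exact_mod_cast hp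
        have h4 : 0 ≤ ∑ j with p j, f j ^ 2 := Finset.sum_nonneg fun j _ => sq_nonneg _
        gcongr

namespace Triangulation

variable {d : ℕ} {Ω : Set (Pt d)} {𝒯 : Triangulation Ω}

/-! ### Sums of functions supported in the subdomains -/

/-- A functional that is additive on `V_h` commutes with finite sums. -/
lemma map_sum_of_add {J : ℕ} {F : (Pt d → ℝ) → ℝ} (h0 : F 0 = 0)
    (hadd : ∀ v ∈ 𝒯.Vh, ∀ w ∈ 𝒯.Vh, F (v + w) = F v + F w) (v : Fin J → 𝒯.Vh) :
    F ((∑ j, v j : 𝒯.Vh) : Pt d → ℝ) = ∑ j, F (v j) :=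
  map_sum (⟨⟨fun w : 𝒯.Vh => F w, h0⟩, fun a b => hadd a a.2 b b.2⟩ : 𝒯.Vh →+ ℝ) v _

lemma elemLaplacian_add (hd : 1 ≤ d) {v w : Pt d → ℝ} (hv : v ∈ 𝒯.Vh) (hw : w ∈ 𝒯.Vh)
    {T : Finset (Pt d)} (hT : T ∈ 𝒯.elements) :
    𝒯.elemLaplacian (v + w) T = 𝒯.elemLaplacian v T + 𝒯.elemLaplacian w T := by
  obtain ⟨c, b, A, h⟩ := exists_quad hv hT
  obtain ⟨c', b', A', h'⟩ := exists_quad hw hT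
  rw [elemLaplacian_eq hd hT h, elemLaplacian_eq hd hT h', elemLaplacian_eq hd hT
    (c := c + c') (b := b + b') (A := A + A') fun x hx => ?_]
  · simp only [quadLaplacian, add_apply, mul_add, Finset.sum_add_distrib]
  · simp only [Pi.add_apply, h x hx, h' x hx, quad, add_apply]
    ring

lemma elemLaplacian_sum (hd : 1 ≤ d) {J : ℕ} (v : Fin J → 𝒯.Vh) {T : Finset (Pt d)}
    (hT : T ∈ 𝒯.elements) :
    𝒯.elemLaplacian ((∑ j, v j : 𝒯.Vh) : Pt d → ℝ) T = ∑ j, 𝒯.elemLaplacian (v j) T :=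
  map_sum_of_add (F := fun v => 𝒯.elemLaplacian v T)
    (elemLaplacian_eq_zero hd hT fun _ _ => rfl)
    (fun _ hv _ hw => elemLaplacian_add hd hv hw hT) v

lemma normalJump_eq_zero {v : Pt d → ℝ} {e : Finset (Pt d)}
    (hv : ∀ T ∈ 𝒯.elementsAt e, ∀ x ∈ cell T, v x = 0) {x : Pt d} (hx : x ∈ cell e) :
    𝒯.normalJump v e x = 0 := by
  rw [normalJump, Finset.sum_eq_zero fun T hT => ?_, neg_zero]
  obtain ⟨hTe, heT⟩ := mem_elementsAt.1 hT
  exact gradDot_eq_zero hTe (hv T hT) (cell_mono heT hx) _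

lemma normalJump_sum {J : ℕ} (v : Fin J → 𝒯.Vh) {e : Finset (Pt d)} {x : Pt d}
    (hx : x ∈ cell e) :
    𝒯.normalJump ((∑ j, v j : 𝒯.Vh) : Pt d → ℝ) e x = ∑ j, 𝒯.normalJump (v j) e x :=
  map_sum_of_add (F := fun v => 𝒯.normalJump v e x)
    (normalJump_eq_zero (fun _ _ _ _ => rfl) hx)
    (fun _ hv _ hw => normalJump_add hv hw hx) v

/-- The jump of a sum on a face where at most `N` of the summands have a jump. -/
lemma sum_jumpSq_le {J : ℕ} {N : ℕ} (v : Fin J → 𝒯.Vh) {e : Finset (Pt d)} (he : e ∈ 𝒯.faces)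
    {p : Fin J → Prop} [DecidablePred p] (hp : (Finset.univ.filter p).card ≤ N)
    (hv : ∀ j, ¬ p j → ∀ x ∈ cell e, 𝒯.normalJump (v j) e x = 0) :
    𝒯.jumpSq ((∑ j, v j : 𝒯.Vh) : Pt d → ℝ) e ≤ N * ∑ j, 𝒯.jumpSq (v j) e := by
  have hint : ∀ w : 𝒯.Vh, Integrable (fun x => 𝒯.normalJump w e x ^ 2) (surf e) := fun w =>
    integrable_surf he ((continuousOn_normalJump w.2 e).pow 2)
  have h1 : ∫ x, 𝒯.normalJump ((∑ j, v j : 𝒯.Vh) : Pt d → ℝ) e x ^ 2 ∂(surf e) ≤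
      ∫ x, N * ∑ j, 𝒯.normalJump (v j) e x ^ 2 ∂(surf e) := by
    refine integral_mono_ae (hint _)
      ((integrable_finsetSum _ fun j _ => hint (v j)).const_mul _) ?_
    filter_upwards [ae_surf_mem e] with x hx
    rw [normalJump_sum v hx]
    exact sq_sum_le_of_card_le hp fun j hj => hv j hj x hx
  rw [integral_const_mul, integral_finsetSum _ fun j _ => hint (v j)] at h1
  calc 𝒯.jumpSq ((∑ j, v j : 𝒯.Vh) : Pt d → ℝ) e
      ≤ (faceSize e)⁻¹ * (N * ∑ j, ∫ x, 𝒯.normalJump (v j) e x ^ 2 ∂(surf e)) :=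
        mul_le_mul_of_nonneg_left h1 (inv_nonneg.2 (faceSize_nonneg e))
    _ = _ := by
        simp only [jumpSq]
        rw [← Finset.mul_sum]
        ring

/-- Boundedness of the sum of functions supported in the subdomains. -/
theorem exists_form_sum_le (hd : 2 ≤ d) (hΩ_open : IsOpen Ω) (hΩ_nonempty : Ω.Nonempty)
    (hΩ_bounded : Bornology.IsBounded Ω) (hΩ_convex : Convex ℝ Ω) {σ : ℝ} (hσ : 0 < σ) (Nc : ℕ) :
    ∃ C : ℝ, 0 < C ∧ ∀ 𝒯 : Triangulation Ω, 𝒯.IsShapeRegular σ →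
      ∀ (J : ℕ) (D : Fin J → Set (Pt d)), (∀ j, 𝒯.IsAligned (D j)) →
      (∀ x ∈ Ω, Nat.card {j : Fin J // x ∈ D j} ≤ Nc) →
      ∀ v : Fin J → 𝒯.Vh, (∀ j, v j ∈ 𝒯.localSpace (D j)) →
        𝒯.form 𝒯.elements 𝒯.interiorFaces (∑ j, v j : 𝒯.Vh) (∑ j, v j : 𝒯.Vh) ≤
          C * ∑ j, 𝒯.form (𝒯.localElements (D j)) (𝒯.localFaces (D j)) (v j) (v j) := by
  obtain ⟨C₁, hC₁, h₁⟩ := exists_facetScaling (Ω := Ω) hd hσ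
  obtain ⟨C₂, hC₂, h₂⟩ := exists_coercivity hd hΩ_open hΩ_nonempty hΩ_bounded hΩ_convex hσ
  -- a face touches at most `2 * Nc` subdomains; the bound `2 * Nc + 1` is positive for every `Nc`
  refine ⟨(2 + 4 * ((d + 1) * C₁)) * ((2 * Nc + 1) * (C₂ * (1 + 8 * ((d + 1) * C₁)))),
    by positivity, fun 𝒯 h𝒯 J D hD hNc v hv => ?_⟩
  have hd1 : 1 ≤ d := by omega
  have hz : ∀ j, ∀ T ∈ 𝒯.elements, T ∉ 𝒯.localElements (D j) → ∀ x ∈ cell T,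
      (v j : Pt d → ℝ) x = 0 := fun j T hT hTD x hx =>
    (hD j).eq_zero_of_mem_cell hd1 hΩ_open hΩ_convex (v j).2.1.continuousOn (hv j) hT hTD hx
  have hL : ∀ T ∈ 𝒯.elements, volume.real (cell T) *
      𝒯.elemLaplacian ((∑ j, v j : 𝒯.Vh) : Pt d → ℝ) T ^ 2 ≤
      (2 * Nc + 1) * ∑ j, volume.real (cell T) * 𝒯.elemLaplacian (v j) T ^ 2 := by
    intro T hT
    have h3 := sq_sum_le_of_card_le (f := fun j => 𝒯.elemLaplacian (v j) T)
      (card_localElements_le hd1 hΩ_open hΩ_convex hD hNc hT)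
      fun j hj => elemLaplacian_eq_zero hd1 hT (hz j T hT hj)
    rw [elemLaplacian_sum hd1 v hT, ← Finset.mul_sum]
    have h4 : 0 ≤ ∑ j, 𝒯.elemLaplacian (v j) T ^ 2 := Finset.sum_nonneg fun j _ => sq_nonneg _
    have h5 : (Nc : ℝ) * ∑ j, 𝒯.elemLaplacian (v j) T ^ 2 ≤
        (2 * Nc + 1) * ∑ j, 𝒯.elemLaplacian (v j) T ^ 2 := by
      gcongr
      have : (0 : ℝ) ≤ Nc := Nat.cast_nonneg _
      linarith
    have h6 := mul_le_mul_of_nonneg_left (h3.trans h5) (volume_cell_pos hT).le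
    linarith
  have hQ : ∀ e ∈ 𝒯.interiorFaces, 𝒯.jumpSq ((∑ j, v j : 𝒯.Vh) : Pt d → ℝ) e ≤
      (2 * Nc + 1) * ∑ j, 𝒯.jumpSq (v j) e := by
    intro e he
    have hef := (mem_interiorFaces.1 he).1
    have h3 := sum_jumpSq_le v hef
      (card_elementsAt_localElements_le hd1 hΩ_open hΩ_convex hD hNc hef) fun j hj x hx => by
        push Not at hj
        exact normalJump_eq_zero
          (fun T hT => hz j T (mem_elementsAt.1 hT).1 (hj T hT)) hx
    refine h3.trans ?_
    have h4 : 0 ≤ ∑ j, 𝒯.jumpSq (v j) e := Finset.sum_nonneg fun j _ => jumpSq_nonneg _ e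
    push_cast
    linarith
  have hj : ∀ j, ∑ T ∈ 𝒯.elements, volume.real (cell T) * 𝒯.elemLaplacian (v j) T ^ 2 +
      ∑ e ∈ 𝒯.interiorFaces, 𝒯.jumpSq (v j) e ≤ C₂ * ((1 + 8 * ((d + 1) * C₁)) *
        𝒯.form (𝒯.localElements (D j)) (𝒯.localFaces (D j)) (v j) (v j)) := by
    intro j
    refine le_trans ?_ ((h₂ 𝒯 h𝒯 (v j) (v j).2).trans (mul_le_mul_of_nonneg_left
      ((hD j).form_le hd1 hΩ_open hΩ_convex (h₁ 𝒯 h𝒯) (v j).2 (hv j)) hC₂.le))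
    gcongr with T hT
    have h5 := energySq_nonneg (v j) T
    have h6 := massSq_nonneg (v j) T
    linarith
  calc 𝒯.form 𝒯.elements 𝒯.interiorFaces (∑ j, v j : 𝒯.Vh) (∑ j, v j : 𝒯.Vh)
      ≤ (2 + 4 * ((d + 1) * C₁)) *
        (∑ T ∈ 𝒯.elements, volume.real (cell T) *
            𝒯.elemLaplacian ((∑ j, v j : 𝒯.Vh) : Pt d → ℝ) T ^ 2 +
          ∑ e ∈ 𝒯.interiorFaces, 𝒯.jumpSq ((∑ j, v j : 𝒯.Vh) : Pt d → ℝ) e) :=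
        form_le_sum hd1 hΩ_open hΩ_convex (h₁ 𝒯 h𝒯) (∑ j, v j : 𝒯.Vh).2
    _ ≤ (2 + 4 * ((d + 1) * C₁)) *
        (∑ T ∈ 𝒯.elements, (2 * Nc + 1) *
            ∑ j, volume.real (cell T) * 𝒯.elemLaplacian (v j) T ^ 2 +
          ∑ e ∈ 𝒯.interiorFaces, (2 * Nc + 1) * ∑ j, 𝒯.jumpSq (v j) e) := by
        have h3 := Finset.sum_le_sum hL
        have h4 := Finset.sum_le_sum hQ
        gcongr
    _ = (2 + 4 * ((d + 1) * C₁)) * ((2 * Nc + 1) *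
        ∑ j, (∑ T ∈ 𝒯.elements, volume.real (cell T) * 𝒯.elemLaplacian (v j) T ^ 2 +
          ∑ e ∈ 𝒯.interiorFaces, 𝒯.jumpSq (v j) e)) := by
        rw [← Finset.mul_sum, ← Finset.mul_sum, Finset.sum_comm,
          Finset.sum_comm (s := 𝒯.interiorFaces), ← mul_add, ← Finset.sum_add_distrib]
    _ ≤ (2 + 4 * ((d + 1) * C₁)) * ((2 * Nc + 1) * ∑ j, C₂ * ((1 + 8 * ((d + 1) * C₁)) *
        𝒯.form (𝒯.localElements (D j)) (𝒯.localFaces (D j)) (v j) (v j))) := by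
        have h3 := Finset.sum_le_sum fun j (_ : j ∈ Finset.univ) => hj j
        gcongr
    _ = _ := by
        rw [← Finset.mul_sum, ← Finset.mul_sum]
        ring

end Triangulation

/-! ### Quadratic interpolation on a simplex -/

/-- The coefficient of `λ_p λ_q` in the quadratic Lagrange interpolant of `f` at the vertices and
the edge midpoints of a simplex, where `λ_p` are the barycentric coordinates. -/
def nodalCoeff {d : ℕ} (f : Pt d → ℝ) (p q : Pt d) : ℝ :=
  2 * f (midpoint ℝ p q) - (f p + f q) / 2

namespace IsSimplex

variable {d : ℕ} {T : Finset (Pt d)}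

/-- The quadratic Lagrange interpolant of `f` at the vertices and the edge midpoints of `T`. -/
def interp (hT : IsSimplex T) (f : Pt d → ℝ) (x : Pt d) : ℝ :=
  ∑ p ∈ T, ∑ q ∈ T, nodalCoeff f p q * (hT.bary p x * hT.bary q x)

lemma midpoint_mem_cell {s : Finset (Pt d)} {p q : Pt d} (hp : p ∈ s) (hq : q ∈ s) :
    midpoint ℝ p q ∈ cell s := by
  have h : Convex ℝ (cell s) := convex_convexHull ℝ _
  exact h.midpoint_mem (mem_cell_of_mem hp) (mem_cell_of_mem hq)

lemma nodalCoeff_congr {s : Finset (Pt d)} {f g : Pt d → ℝ} (h : ∀ x ∈ cell s, f x = g x)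
    {p q : Pt d} (hp : p ∈ s) (hq : q ∈ s) : nodalCoeff f p q = nodalCoeff g p q := by
  rw [nodalCoeff, nodalCoeff, h _ (midpoint_mem_cell hp hq), h _ (mem_cell_of_mem hp),
    h _ (mem_cell_of_mem hq)]

lemma interp_congr (hT : IsSimplex T) {f g : Pt d → ℝ} (h : ∀ x ∈ cell T, f x = g x) (x : Pt d) :
    hT.interp f x = hT.interp g x :=
  Finset.sum_congr rfl fun _ hp => Finset.sum_congr rfl fun _ hq => by
    rw [nodalCoeff_congr h hp hq]

lemma interp_zero (hT : IsSimplex T) (x : Pt d) : hT.interp (fun _ => 0) x = 0 := by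
  simp [interp, nodalCoeff]

lemma interp_add (hT : IsSimplex T) (f g : Pt d → ℝ) (x : Pt d) :
    hT.interp (fun y => f y + g y) x = hT.interp f x + hT.interp g x := by
  simp only [interp, ← Finset.sum_add_distrib]
  refine Finset.sum_congr rfl fun _ _ => Finset.sum_congr rfl fun _ _ => ?_
  simp only [nodalCoeff]
  ring

lemma interp_sum (hT : IsSimplex T) {J : ℕ} (f : Fin J → Pt d → ℝ) (x : Pt d) :
    hT.interp (fun y => ∑ j, f j y) x = ∑ j, hT.interp (f j) x := by
  have h : ∀ p q, nodalCoeff (fun y => ∑ j, f j y) p q = ∑ j, nodalCoeff (f j) p q := by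
    intro p q
    simp only [nodalCoeff, Finset.sum_sub_distrib, ← Finset.mul_sum, ← Finset.sum_div,
      ← Finset.sum_add_distrib]
  simp only [interp, h, Finset.sum_mul]
  rw [Finset.sum_comm]
  rw [Finset.sum_congr rfl fun q _ => Finset.sum_comm, Finset.sum_comm]
  exact Finset.sum_congr rfl fun j _ => Finset.sum_comm

/-- The interpolation reproduces quadratic polynomials. -/
lemma interp_quad (hT : IsSimplex T) (c : ℝ) (b : Pt d →L[ℝ] ℝ) (A : Pt d →L[ℝ] Pt d →L[ℝ] ℝ)
    (x : Pt d) : hT.interp (quad c b A) x = quad c b A x := by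
  set w : Pt d → ℝ := fun p => hT.bary p x with hw
  have hw1 : ∑ p ∈ T, w p = 1 := hT.sum_bary x
  have hwx : ∑ p ∈ T, w p • p = x := hT.sum_bary_smul x
  have hA : ∀ y, A y x = ∑ q ∈ T, w q * A y q := fun y => by
    conv_lhs => rw [← hwx]
    simp
  have hA' : A x x = ∑ p ∈ T, w p * A p x := by
    have h : A x = ∑ p ∈ T, w p • A p := by
      conv_lhs => rw [← hwx]
      simp only [map_sum, map_smul]
    rw [h]
    simp
  have hb : b x = ∑ p ∈ T, w p * b p := by
    conv_lhs => rw [← hwx]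
    simp
  set F : Pt d → Pt d → ℝ := fun p q => (c + b p + A p q) * (w p * w q) with hF
  have h1 : ∀ p q, nodalCoeff (quad c b A) p q * (w p * w q) = 1 / 2 * F p q + 1 / 2 * F q p := by
    intro p q
    simp only [nodalCoeff, quad, midpoint_eq_smul_add, map_smul, map_add, hF, smul_eq_mul,
      add_apply, smul_apply, invOf_eq_inv]
    ring
  have h2 : ∑ p ∈ T, ∑ q ∈ T, F p q = quad c b A x := by
    have h3 : ∀ p, ∑ q ∈ T, F p q = w p * c + w p * b p + w p * A p x := by
      intro p
      rw [hA p]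
      have : ∀ q, F p q = w p * (c + b p) * w q + w p * (w q * A p q) := fun q => by
        simp only [hF]; ring
      simp only [this, Finset.sum_add_distrib, ← Finset.mul_sum, hw1]
      ring
    simp only [h3, Finset.sum_add_distrib, ← Finset.sum_mul, hw1, ← hb, ← hA', quad, one_mul]
  simp only [interp]
  calc ∑ p ∈ T, ∑ q ∈ T, nodalCoeff (quad c b A) p q * (w p * w q)
      = ∑ p ∈ T, ∑ q ∈ T, (1 / 2 * F p q + 1 / 2 * F q p) :=
        Finset.sum_congr rfl fun p _ => Finset.sum_congr rfl fun q _ => h1 p q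
    _ = 1 / 2 * ∑ p ∈ T, ∑ q ∈ T, F p q + 1 / 2 * ∑ p ∈ T, ∑ q ∈ T, F q p := by
        simp only [Finset.sum_add_distrib, ← Finset.mul_sum]
    _ = _ := by
        rw [Finset.sum_comm (f := fun p q => F q p), h2]
        ring

/-- The derivative of the barycentric coordinate of the vertex `p`. -/
def baryGrad (hT : IsSimplex T) (p : Pt d) : Pt d →L[ℝ] ℝ :=
  LinearMap.toContinuousLinearMap (hT.bary p).linear

lemma bary_eq (hT : IsSimplex T) (p x : Pt d) :
    hT.bary p x = hT.bary p 0 + hT.baryGrad p x := by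
  have h := congrFun (AffineMap.decomp (hT.bary p)) x
  rw [h]
  simp [baryGrad, add_comm]

/-- The interpolant is a quadratic polynomial; its second-order part and its derivatives in terms of
the barycentric coordinates. -/
lemma exists_interp_eq_quad (hT : IsSimplex T) (f : Pt d → ℝ) :
    ∃ c b A, (∀ x, hT.interp f x = quad c b A x) ∧
      (∀ m n, A m n = ∑ p ∈ T, ∑ q ∈ T, nodalCoeff f p q *
        (hT.baryGrad p m * hT.baryGrad q n)) ∧
      (∀ n x, quadDeriv b A n x = ∑ p ∈ T, ∑ q ∈ T, nodalCoeff f p q *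
        (hT.bary p x * hT.baryGrad q n + hT.baryGrad p n * hT.bary q x)) := by
  set a : Pt d → ℝ := fun p => hT.bary p 0 with ha
  set l := hT.baryGrad with hl
  have hbary : ∀ p x, hT.bary p x = a p + l p x := hT.bary_eq
  set c : ℝ := ∑ p ∈ T, ∑ q ∈ T, nodalCoeff f p q * (a p * a q) with hc
  set b : Pt d →L[ℝ] ℝ := ∑ p ∈ T, ∑ q ∈ T, nodalCoeff f p q • (a p • l q + a q • l p) with hb
  set A : Pt d →L[ℝ] Pt d →L[ℝ] ℝ :=
    ∑ p ∈ T, ∑ q ∈ T, nodalCoeff f p q • (l p).smulRight (l q) with hA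
  have hAe : ∀ m n, A m n = ∑ p ∈ T, ∑ q ∈ T, nodalCoeff f p q * (l p m * l q n) := by
    intro m n
    simp [hA]
  have hbe : ∀ n, b n = ∑ p ∈ T, ∑ q ∈ T, nodalCoeff f p q * (a p * l q n + a q * l p n) := by
    intro n
    simp [hb, mul_add]
  refine ⟨c, b, A, fun x => ?_, hAe, fun n x => ?_⟩
  · rw [quad, hAe, hbe, hc, ← Finset.sum_add_distrib, ← Finset.sum_add_distrib, interp]
    refine Finset.sum_congr rfl fun p _ => ?_
    rw [← Finset.sum_add_distrib, ← Finset.sum_add_distrib]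
    refine Finset.sum_congr rfl fun q _ => ?_
    rw [hbary, hbary]
    ring
  · rw [quadDeriv, hAe, hAe, hbe, ← Finset.sum_add_distrib, ← Finset.sum_add_distrib]
    refine Finset.sum_congr rfl fun p _ => ?_
    rw [← Finset.sum_add_distrib, ← Finset.sum_add_distrib]
    refine Finset.sum_congr rfl fun q _ => ?_
    rw [hbary, hbary]
    ring

lemma eqQuadraticOn_interp (hT : IsSimplex T) (f : Pt d → ℝ) (s : Set (Pt d)) :
    EqQuadraticOn (hT.interp f) s := by
  obtain ⟨c, b, A, h, -⟩ := hT.exists_interp_eq_quad f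
  exact ⟨c, b, A, fun x _ => h x⟩

/-- On a face `s` of `T`, the interpolant only depends on the nodal values on `s`. -/
lemma interp_eq_of_mem_face (hT : IsSimplex T) (f : Pt d → ℝ) {s : Finset (Pt d)} (hs : s ⊆ T)
    {x : Pt d} (hx : x ∈ cell s) :
    hT.interp f x = ∑ p ∈ s, ∑ q ∈ s, nodalCoeff f p q * (hT.bary p x * hT.bary q x) := by
  rw [hT.cell_eq_of_subset hs] at hx
  rw [interp]
  refine (Finset.sum_subset hs fun p _ hp => ?_).symm.trans
    (Finset.sum_congr rfl fun p _ => (Finset.sum_subset hs fun q _ hq => ?_).symm)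
  · simp [hx.2 p hp]
  · simp [hx.2 q hq]

lemma abs_baryGrad_le (hT : IsSimplex T) (hd : 1 ≤ d) {p : Pt d} (hp : p ∈ T) (n : Pt d) :
    |hT.baryGrad p n| ≤ ‖n‖ / height T p := by
  have hh := hT.height_pos hd hp
  have h1 := hT.bary_mul_height hd hp n
  have h2 := hT.bary_mul_height hd hp 0
  rw [hT.bary_eq p n] at h1
  rw [inner_zero_right] at h2
  have h3 : hT.baryGrad p n * height T p = - inner ℝ (outwardNormal T (T.erase p)) n := by
    linarith
  rw [le_div_iff₀ hh, ← abs_of_pos hh, ← abs_mul, h3, abs_neg]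
  refine (abs_real_inner_le_norm _ _).trans ?_
  rw [hT.norm_outwardNormal hd hp, one_mul]

lemma abs_nodalCoeff_le {s : Finset (Pt d)} {f : Pt d → ℝ} {K : ℝ} (hf : ∀ x ∈ cell s, |f x| ≤ K)
    {p q : Pt d} (hp : p ∈ s) (hq : q ∈ s) : |nodalCoeff f p q| ≤ 3 * K := by
  have h1 := abs_le.1 (hf _ (midpoint_mem_cell hp hq))
  have h2 := abs_le.1 (hf _ (mem_cell_of_mem hp))
  have h3 := abs_le.1 (hf _ (mem_cell_of_mem hq))
  rw [nodalCoeff, abs_le]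
  constructor <;> linarith [h1.1, h1.2, h2.1, h2.2, h3.1, h3.2]

end IsSimplex

lemma abs_sum_sum_le {ι : Type*} {T : Finset ι} {N : ℕ} (hN : T.card = N) {F : ι → ι → ℝ} {K : ℝ}
    (hF : ∀ p ∈ T, ∀ q ∈ T, |F p q| ≤ K) : |∑ p ∈ T, ∑ q ∈ T, F p q| ≤ N ^ 2 * K := by
  have h1 : ∀ p ∈ T, |∑ q ∈ T, F p q| ≤ N * K := fun p hp => by
    refine (Finset.abs_sum_le_sum_abs _ _).trans ((Finset.sum_le_card_nsmul _ _ K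
      fun q hq => hF p hp q hq).trans ?_)
    rw [nsmul_eq_mul, hN]
  refine (Finset.abs_sum_le_sum_abs _ _).trans ((Finset.sum_le_card_nsmul _ _ _ h1).trans ?_)
  rw [nsmul_eq_mul, hN]
  exact le_of_eq (by ring)

/-- Stability of the interpolation, with the scaling of the inverse estimates. -/
lemma IsShapeRegularSimplex.exists_interp_eq_quad {d : ℕ} {σ : ℝ} {T : Finset (Pt d)}
    (hT : IsShapeRegularSimplex σ T) (hσ : 0 < σ) (hd : 1 ≤ d) {f : Pt d → ℝ} {K : ℝ}
    (hf : ∀ x ∈ cell T, |f x| ≤ K) :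
    ∃ c b A, (∀ x, hT.toIsSimplex.interp f x = quad c b A x) ∧
      |quadLaplacian A| ≤ 6 * d * (d + 1) ^ 2 * (σ / cellDiam T) ^ 2 * K ∧
      ∀ x ∈ cell T, ∀ n, |quadDeriv b A n x| ≤ 6 * (d + 1) ^ 2 * (σ / cellDiam T) * K * ‖n‖ := by
  obtain ⟨c, b, A, h1, h2, h3⟩ := hT.toIsSimplex.exists_interp_eq_quad f
  have hdiam := hT.toIsSimplex.cellDiam_pos hd
  have hcard : T.card = d + 1 := hT.card_eq
  obtain ⟨p₀, hp₀⟩ := hT.toIsSimplex.nonempty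
  have hK : 0 ≤ K := (abs_nonneg _).trans (hf p₀ (mem_cell_of_mem hp₀))
  set s := σ / cellDiam T with hs
  have hs0 : 0 < s := by positivity
  have hl : ∀ p ∈ T, ∀ n, |hT.toIsSimplex.baryGrad p n| ≤ s * ‖n‖ := by
    intro p hp n
    refine (hT.toIsSimplex.abs_baryGrad_le hd hp n).trans ?_
    have h4 := hT.le_height hσ hd hp
    have h5 := hT.toIsSimplex.height_pos hd hp
    rw [div_le_iff₀ h5, mul_comm s, mul_assoc]
    refine le_mul_of_one_le_right (norm_nonneg _) ?_
    calc (1 : ℝ) = s * (cellDiam T / σ) := by rw [hs]; field_simp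
      _ ≤ _ := by gcongr
  have hB : ∀ p ∈ T, ∀ q ∈ T, |nodalCoeff f p q| ≤ 3 * K := fun p hp q hq =>
    IsSimplex.abs_nodalCoeff_le hf hp hq
  refine ⟨c, b, A, h1, ?_, fun x hx n => ?_⟩
  · have h6 : ∀ i : Fin d, |2 * A (EuclideanSpace.single i 1) (EuclideanSpace.single i 1)| ≤
        2 * ((d + 1 : ℕ) ^ 2 * (3 * K * (s * s))) := by
      intro i
      rw [abs_mul, abs_two, h2]
      refine mul_le_mul_of_nonneg_left (abs_sum_sum_le hcard fun p hp q hq => ?_) two_pos.le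
      rw [abs_mul, abs_mul]
      have h7 := hl p hp (EuclideanSpace.single i 1)
      have h8 := hl q hq (EuclideanSpace.single i 1)
      have h9 : ‖EuclideanSpace.single i (1 : ℝ)‖ = 1 := by simp
      rw [h9, mul_one] at h7 h8
      have := hB p hp q hq
      gcongr
    rw [quadLaplacian]
    refine (Finset.abs_sum_le_sum_abs _ _).trans ((Finset.sum_le_card_nsmul _ _ _
      fun i _ => h6 i).trans (le_of_eq ?_))
    rw [nsmul_eq_mul, Finset.card_univ, Fintype.card_fin]
    push_cast
    ring
  · rw [h3]
    refine (abs_sum_sum_le (K := 3 * K * (1 * (s * ‖n‖) + s * ‖n‖ * 1)) hcard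
      fun p hp q hq => ?_).trans (le_of_eq (by push_cast; ring))
    rw [abs_mul]
    have h4 : ∀ r, |hT.toIsSimplex.bary r x| ≤ 1 := fun r => by
      rw [abs_of_nonneg (hT.toIsSimplex.bary_nonneg hx r)]
      exact hT.toIsSimplex.bary_le_one hx r
    have h5 := hl p hp n
    have h6 := hl q hq n
    have h7 := hB p hp q hq
    have h8 : |hT.toIsSimplex.bary p x * hT.toIsSimplex.baryGrad q n +
        hT.toIsSimplex.baryGrad p n * hT.toIsSimplex.bary q x| ≤
        1 * (s * ‖n‖) + s * ‖n‖ * 1 := by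
      refine (abs_add_le _ _).trans ?_
      rw [abs_mul, abs_mul]
      have := h4 p
      have := h4 q
      gcongr
    gcongr

namespace Triangulation

variable {d : ℕ} {Ω : Set (Pt d)} {𝒯 : Triangulation Ω}

/-! ### Interpolation in the finite element space -/

/-- The elementwise quadratic Lagrange interpolant of `f`, extended by zero outside of `Ω`. -/
def interp (𝒯 : Triangulation Ω) (f : Pt d → ℝ) (x : Pt d) : ℝ :=
  if h : ∃ T, ∃ _ : T ∈ 𝒯.elements, x ∈ cell T then
    (isSimplex h.choose_spec.1).interp f x else 0

/-- The interpolant is well defined: the interpolants on two elements agree on their common face. -/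
lemma interp_eq {f : Pt d → ℝ} {T : Finset (Pt d)} (hT : T ∈ 𝒯.elements) {x : Pt d}
    (hx : x ∈ cell T) : 𝒯.interp f x = (isSimplex hT).interp f x := by
  have h : ∃ T, ∃ _ : T ∈ 𝒯.elements, x ∈ cell T := ⟨T, hT, hx⟩
  rw [interp, dif_pos h]
  set S := h.choose
  have hS : S ∈ 𝒯.elements := h.choose_spec.1
  have hxS : x ∈ cell S := h.choose_spec.2
  have hxi := mem_cell_inter hS hT hxS hx
  rw [(isSimplex hS).interp_eq_of_mem_face f Finset.inter_subset_left hxi,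
    (isSimplex hT).interp_eq_of_mem_face f Finset.inter_subset_right hxi]
  refine Finset.sum_congr rfl fun p _ => Finset.sum_congr rfl fun q _ => ?_
  have h1 := fun p => IsSimplex.bary_eq_of_mem_face (isSimplex hS) (isSimplex hT)
    Finset.inter_subset_left Finset.inter_subset_right hxi p
  rw [h1, h1]

/-- A simplex of the mesh whose relative interior contains a point outside of `Ω` does not
meet `Ω`. -/
lemma notMem_of_mem_cell_of_bary_pos (hΩ_open : IsOpen Ω) (hΩ_convex : Convex ℝ Ω)
    {T s : Finset (Pt d)} (hT : T ∈ 𝒯.elements) (hs : s ⊆ T) {x y : Pt d} (hx : x ∈ cell s)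
    (hpos : ∀ p ∈ s, 0 < (isSimplex hT).bary p x) (hxΩ : x ∉ Ω) (hy : y ∈ cell s) : y ∉ Ω := by
  intro hyΩ
  refine hxΩ ?_
  have hST := isSimplex hT
  -- if `y` were in `Ω`, the segment from `y` to `x` could be extended a little beyond `x` within
  -- the face, and `x` would lie in `Ω` by convexity
  obtain ⟨t, ht, hpt⟩ := exists_small_shift (eventually_bary_pos hST hpos) (x - y)
  have hx' := hx
  have hy' := hy
  rw [hST.cell_eq_of_subset hs] at hx' hy'
  set z := x + t • (x - y) with hz
  have hzx : z = AffineMap.lineMap y x (1 + t) := by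
    rw [hz, AffineMap.lineMap_apply_module']
    module
  have hzT : z ∈ cell T := by
    refine hST.mem_cell_of_bary fun p _ => ?_
    by_cases hps : p ∈ s
    · exact (hpt p hps).le
    · rw [hzx, AffineMap.apply_lineMap, hx'.2 p hps, hy'.2 p hps]
      simp
  have h1 := hΩ_convex.openSegment_interior_closure_subset_interior
    (hΩ_open.interior_eq.symm ▸ hyΩ) (cell_subset_closure hT hzT)
  rw [hΩ_open.interior_eq] at h1
  refine h1 ⟨t / (1 + t), 1 / (1 + t), by positivity, by positivity, by field_simp; ring, ?_⟩
  have h2 : (1 + t) ≠ 0 := by positivity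
  rw [hz]
  have h3 : x = (1 / (1 + t)) • ((1 + t) • x) := by
    rw [smul_smul, one_div_mul_cancel h2, one_smul]
  have h4 : (t / (1 + t)) • y = (1 / (1 + t)) • (t • y) := by
    rw [smul_smul]; congr 1; ring
  rw [h4, ← smul_add]
  conv_rhs => rw [h3]
  congr 1
  module

/-- The interpolant of a function that vanishes outside of `Ω` vanishes there too: a point of the
closure of `Ω` outside of `Ω` lies in the relative interior of some face of the mesh, and no node on
this face belongs to `Ω`. -/
lemma interp_eq_zero_of_notMem (hΩ_open : IsOpen Ω) (hΩ_convex : Convex ℝ Ω) {f : Pt d → ℝ}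
    (hf : ∀ x ∉ Ω, f x = 0) {x : Pt d} (hx : x ∉ Ω) : 𝒯.interp f x = 0 := by
  by_cases h : ∃ T, ∃ _ : T ∈ 𝒯.elements, x ∈ cell T
  · obtain ⟨T, hT, hxT⟩ := h
    have hST := isSimplex hT
    set s := T.filter fun p => 0 < hST.bary p x with hs
    have hsT : s ⊆ T := Finset.filter_subset _ _
    have hpos : ∀ p ∈ s, 0 < hST.bary p x := fun p hp => (Finset.mem_filter.1 hp).2
    have hxs : x ∈ cell s := by
      rw [hST.cell_eq_of_subset hsT]
      refine ⟨hxT, fun p hp => ?_⟩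
      by_cases hpT : p ∈ T
      · refine le_antisymm (not_lt.1 fun h => hp (Finset.mem_filter.2 ⟨hpT, h⟩))
          (hST.bary_nonneg hxT p)
      · rw [IsSimplex.bary, dif_neg hpT]
        rfl
    rw [interp_eq hT hxT, hST.interp_eq_of_mem_face f hsT hxs]
    refine Finset.sum_eq_zero fun p hp => Finset.sum_eq_zero fun q hq => ?_
    rw [IsSimplex.nodalCoeff_congr (g := fun _ => 0) (fun y hy => hf y
      (notMem_of_mem_cell_of_bary_pos hΩ_open hΩ_convex hT hsT hxs hpos hx hy)) hp hq]
    simp [nodalCoeff]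
  · rw [interp, dif_neg h]

lemma continuous_interp (hΩ_open : IsOpen Ω) (hΩ_convex : Convex ℝ Ω) {f : Pt d → ℝ}
    (hf : ∀ x ∉ Ω, f x = 0) : Continuous (𝒯.interp f) := by
  let F : Option 𝒯.elements → Set (Pt d) := fun o => o.elim Ωᶜ fun T => cell T.1
  refine (locallyFinite_of_finite F).continuous ?_ ?_ ?_
  · refine Set.eq_univ_of_forall fun x => ?_
    by_cases hx : x ∈ Ω
    · obtain ⟨T, hT, hxT⟩ := exists_mem_cell (𝒯 := 𝒯) (subset_closure hx)
      exact Set.mem_iUnion.2 ⟨some ⟨T, hT⟩, hxT⟩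
    · exact Set.mem_iUnion.2 ⟨none, hx⟩
  · rintro (_ | T)
    · exact hΩ_open.isClosed_compl
    · exact (isCompact_cell T.1).isClosed
  · rintro (_ | T)
    · exact continuousOn_const.congr fun x hx => interp_eq_zero_of_notMem hΩ_open hΩ_convex hf hx
    · obtain ⟨c, b, A, h, -⟩ := (isSimplex T.2).exists_interp_eq_quad f
      refine ContinuousOn.congr (f := quad c b A) (contDiff_quad c b A).continuous.continuousOn
        fun x hx => ?_
      rw [interp_eq T.2 hx, h]

lemma interp_mem_Vh (hΩ_open : IsOpen Ω) (hΩ_convex : Convex ℝ Ω) {f : Pt d → ℝ}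
    (hf : ∀ x ∉ Ω, f x = 0) : 𝒯.interp f ∈ 𝒯.Vh := by
  refine ⟨continuous_interp hΩ_open hΩ_convex hf,
    fun x hx => interp_eq_zero_of_notMem hΩ_open hΩ_convex hf hx, fun T hT => ?_⟩
  obtain ⟨c, b, A, h⟩ := (isSimplex hT).eqQuadraticOn_interp f (cell T)
  exact ⟨c, b, A, fun x hx => by rw [interp_eq hT hx, h x hx]⟩

/-- The interpolation reproduces finite element functions. -/
lemma interp_self_of_mem_cell {v : Pt d → ℝ} (hv : v ∈ 𝒯.Vh) {T : Finset (Pt d)}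
    (hT : T ∈ 𝒯.elements) {x : Pt d} (hx : x ∈ cell T) : (isSimplex hT).interp v x = v x := by
  obtain ⟨c, b, A, h⟩ := exists_quad hv hT
  rw [(isSimplex hT).interp_congr h, (isSimplex hT).interp_quad, h x hx]

/-- A finite element function is determined by its values at the nodes. -/
instance finiteDimensional_Vh : FiniteDimensional ℝ 𝒯.Vh := by
  let N : Finset (Pt d) := 𝒯.elements.biUnion fun T =>
    T ∪ (T ×ˢ T).image fun p => midpoint ℝ p.1 p.2
  let L : 𝒯.Vh →ₗ[ℝ] (N → ℝ) :=
    { toFun := fun v z => (v : Pt d → ℝ) z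
      map_add' := fun _ _ => rfl
      map_smul' := fun _ _ => rfl }
  refine FiniteDimensional.of_injective L ((injective_iff_map_eq_zero L).2 fun v hv => ?_)
  have h0 : ∀ z ∈ N, (v : Pt d → ℝ) z = 0 := fun z hz => congrFun hv ⟨z, hz⟩
  ext x
  by_cases hx : x ∈ Ω
  · obtain ⟨T, hT, hxT⟩ := exists_mem_cell (𝒯 := 𝒯) (subset_closure hx)
    rw [← interp_self_of_mem_cell v.2 hT hxT]
    refine Finset.sum_eq_zero fun p hp => Finset.sum_eq_zero fun q hq => ?_
    have hN : ∀ z ∈ T ∪ (T ×ˢ T).image fun p => midpoint ℝ p.1 p.2, z ∈ N := fun z hz =>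
      Finset.mem_biUnion.2 ⟨T, hT, hz⟩
    rw [nodalCoeff, h0 _ (hN _ (Finset.mem_union_left _ hp)),
      h0 _ (hN _ (Finset.mem_union_left _ hq)),
      h0 _ (hN _ (Finset.mem_union_right _ (Finset.mem_image.2
        ⟨(p, q), Finset.mem_product.2 ⟨hp, hq⟩, rfl⟩)))]
    simp
  · exact v.2.2.1 x hx

end Triangulation

/-! ### Taylor expansion of the cut-off functions -/

/-- The first-order Taylor expansion on a convex open set, up to the boundary. -/
lemma abs_sub_sub_fderiv_le {d : ℕ} {Ω : Set (Pt d)} (hΩ_open : IsOpen Ω)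
    (hΩ_convex : Convex ℝ Ω) {θ : Pt d → ℝ} (hθ : ContDiffOn ℝ ∞ θ (closure Ω)) {H : ℝ}
    (hH : ∀ x ∈ Ω, ‖fderiv ℝ (fderiv ℝ θ) x‖ ≤ H) {x₀ x : Pt d} (hx₀ : x₀ ∈ Ω)
    (hx : x ∈ closure Ω) :
    |θ x - θ x₀ - fderiv ℝ θ x₀ (x - x₀)| ≤ H * ‖x - x₀‖ ^ 2 := by
  have hH0 : 0 ≤ H := (norm_nonneg (fderiv ℝ (fderiv ℝ θ) x₀)).trans (hH x₀ hx₀)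
  have hat : ∀ y ∈ Ω, ContDiffAt ℝ ∞ θ y := fun y hy =>
    hθ.contDiffAt (Filter.mem_of_superset (hΩ_open.mem_nhds hy) subset_closure)
  have hd1 : ∀ y ∈ Ω, DifferentiableAt ℝ θ y := fun y hy =>
    (hat y hy).differentiableAt (by simp)
  have hd2 : ∀ y ∈ Ω, DifferentiableAt ℝ (fderiv ℝ θ) y := fun y hy =>
    ((hat y hy).fderiv_right (m := 1) (by norm_cast)).differentiableAt (by simp)
  have h1 : ∀ y ∈ Ω, ‖fderiv ℝ θ y - fderiv ℝ θ x₀‖ ≤ H * ‖y - x₀‖ := fun y hy =>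
    hΩ_convex.norm_image_sub_le_of_norm_fderiv_le hd2 hH hx₀ hy
  have h2 : ∀ y ∈ Ω, |θ y - θ x₀ - fderiv ℝ θ x₀ (y - x₀)| ≤ H * ‖y - x₀‖ ^ 2 := by
    intro y hy
    have hseg : segment ℝ x₀ y ⊆ Ω := hΩ_convex.segment_subset hx₀ hy
    have h3 := (convex_segment x₀ y).norm_image_sub_le_of_norm_hasFDerivWithin_le
      (f := fun z => θ z - fderiv ℝ θ x₀ z) (f' := fun z => fderiv ℝ θ z - fderiv ℝ θ x₀)
      (C := H * ‖y - x₀‖) (x := x₀) (y := y)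
      (fun z hz => ((hd1 z (hseg hz)).hasFDerivAt.sub
        (fderiv ℝ θ x₀).hasFDerivAt).hasFDerivWithinAt)
      (fun z hz => (h1 z (hseg hz)).trans (mul_le_mul_of_nonneg_left
        (norm_sub_le_of_mem_segment hz) hH0))
      (left_mem_segment ℝ x₀ y) (right_mem_segment ℝ x₀ y)
    rw [Real.norm_eq_abs] at h3
    rw [map_sub]
    calc _ = |θ y - fderiv ℝ θ x₀ y - (θ x₀ - fderiv ℝ θ x₀ x₀)| := by congr 1; ring
      _ ≤ _ := h3
      _ = _ := by ring
  exact le_on_closure h2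
    (((hθ.continuousOn.sub continuousOn_const).sub (by fun_prop)).abs) (by fun_prop) hx

namespace Triangulation

variable {d : ℕ} {Ω : Set (Pt d)} {𝒯 : Triangulation Ω}

/-! ### Interpolation of products -/

/-- If `f` is a multiple of the finite element function `v` plus an affine function, up to a
perturbation of size `K`, then so is its interpolant. -/
lemma interp_expansion (hd : 1 ≤ d) {σ : ℝ} (h𝒯 : 𝒯.IsShapeRegular σ) {v f : Pt d → ℝ}
    (hv : v ∈ 𝒯.Vh) {T : Finset (Pt d)} (hT : T ∈ 𝒯.elements) {t a K : ℝ} {l : Pt d →L[ℝ] ℝ}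
    (hf : ∀ x ∈ cell T, |f x - (t * v x + (a + l x))| ≤ K) :
    |𝒯.elemLaplacian (𝒯.interp f) T - t * 𝒯.elemLaplacian v T| ≤
        6 * d * (d + 1) ^ 2 * (σ / cellDiam T) ^ 2 * K ∧
      ∀ x ∈ cell T, ∀ n, |gradDot (𝒯.interp f) T x n - (t * gradDot v T x n + l n)| ≤
        6 * (d + 1) ^ 2 * (σ / cellDiam T) * K * ‖n‖ := by
  have hST := isShapeRegularSimplex h𝒯 hT
  obtain ⟨c, b, A, h⟩ := exists_quad hv hT
  obtain ⟨c', b', A', h1, h2, h3⟩ := hST.exists_interp_eq_quad h𝒯.1 hd hf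
  have h4 : ∀ x ∈ cell T, 𝒯.interp f x = quad (t * c + a + c') (t • b + l + b') (t • A + A') x := by
    intro x hx
    rw [interp_eq hT hx, (isSimplex hT).interp_congr (g := fun y =>
      quad (t * c + a) (t • b + l) (t • A) y + (f y - (t * v y + (a + l y)))) fun y hy => by
        simp only [h y hy, quad, add_apply, smul_apply, smul_eq_mul]
        ring, (isSimplex hT).interp_add, h1 x, (isSimplex hT).interp_quad]
    simp only [quad, add_apply, smul_apply, smul_eq_mul]
    ring
  refine ⟨?_, fun x hx n => ?_⟩
  · rw [elemLaplacian_eq hd hT h4, elemLaplacian_eq hd hT h]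
    refine le_trans (le_of_eq ?_) h2
    congr 1
    simp only [quadLaplacian, add_apply, smul_apply, smul_eq_mul, mul_add,
      Finset.sum_add_distrib, Finset.mul_sum]
    rw [add_sub_right_comm, ← Finset.sum_sub_distrib]
    simp only [mul_left_comm t, sub_self, Finset.sum_const_zero, zero_add]
  · rw [gradDot_eq_quadDeriv hT h4 hx, gradDot_eq_quadDeriv hT h hx]
    refine le_trans (le_of_eq ?_) (h3 x hx n)
    congr 1
    simp only [quadDeriv, add_apply, smul_apply, smul_eq_mul]
    ring

/-- Finite element functions are Lipschitz continuous on the elements. -/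
lemma abs_sub_le_maxGrad {C : ℝ} (hC : 𝒯.InverseEstimate C) {v : Pt d → ℝ} (hv : v ∈ 𝒯.Vh)
    {T : Finset (Pt d)} (hT : T ∈ 𝒯.elements) {x y : Pt d} (hx : x ∈ cell T) (hy : y ∈ cell T) :
    |v y - v x| ≤ maxGrad C v T * ‖y - x‖ := by
  have h : Convex ℝ (cell T) := convex_convexHull ℝ _
  refine h.norm_image_sub_le_of_norm_fderivWithin_le
    ((contDiffOn_cell hv hT).differentiableOn (by simp)) (fun z hz => ?_) hx hy
  exact ContinuousLinearMap.opNorm_le_bound _ (maxGrad_nonneg _ _ _) fun n =>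
    abs_gradDot_le hC hv hT hz n

/-- The size of the lower-order terms in the second derivatives of `θ v` on the element `T`, for a
cut-off function `θ` with derivatives bounded by `M δ⁻¹` and `M δ⁻²`. -/
def cutoffError (C M δ : ℝ) (v : Pt d → ℝ) (T : Finset (Pt d)) : ℝ :=
  M * δ⁻¹ * maxGrad C v T + M * (δ ^ 2)⁻¹ * maxVal C v T

/-- Up to an error of second order in the diameter of the element, `θ v` is a multiple of `v` plus
an affine function: with `θ = θ(x₀) + ∇θ(x₀)·(x - x₀) + ρ`, the error consists of
`∇θ(x₀)·(x - x₀) (v - v(x₀))` and `ρ v`. -/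
lemma cutoff_mul_expansion (hΩ_open : IsOpen Ω) (hΩ_convex : Convex ℝ Ω) {C : ℝ}
    (hC : 𝒯.InverseEstimate C) {v θ : Pt d → ℝ} (hv : v ∈ 𝒯.Vh)
    (hθ : ContDiffOn ℝ ∞ θ (closure Ω)) {M δ : ℝ}
    (h1 : ∀ x ∈ Ω, ‖fderiv ℝ θ x‖ ≤ M * δ⁻¹)
    (h2 : ∀ x ∈ Ω, ‖fderiv ℝ (fderiv ℝ θ) x‖ ≤ M * (δ ^ 2)⁻¹) {T : Finset (Pt d)}
    (hT : T ∈ 𝒯.elements) {x₀ : Pt d} (hx₀ : x₀ ∈ cell T) (hx₀Ω : x₀ ∈ Ω) :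
    ∀ x ∈ cell T, |θ x * v x - (θ x₀ * v x +
      (-(v x₀ * fderiv ℝ θ x₀ x₀) + (v x₀ • fderiv ℝ θ x₀) x))| ≤
        cellDiam T ^ 2 * cutoffError C M δ v T := by
  intro x hx
  have hdist : ‖x - x₀‖ ≤ cellDiam T := by
    rw [← dist_eq_norm]
    exact dist_le_cellDiam hx hx₀
  have hA0 : 0 ≤ M * δ⁻¹ := (norm_nonneg _).trans (h1 x₀ hx₀Ω)
  have hB0 : 0 ≤ M * (δ ^ 2)⁻¹ :=
    (norm_nonneg (fderiv ℝ (fderiv ℝ θ) x₀)).trans (h2 x₀ hx₀Ω)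
  have hG0 := maxGrad_nonneg C v T
  have hr0 : 0 ≤ cellDiam T := (norm_nonneg _).trans hdist
  have e1 := abs_sub_sub_fderiv_le hΩ_open hΩ_convex hθ h2 hx₀Ω (cell_subset_closure hT hx)
  have e2 : |fderiv ℝ θ x₀ (x - x₀)| ≤ M * δ⁻¹ * ‖x - x₀‖ :=
    (fderiv ℝ θ x₀).le_of_opNorm_le (h1 x₀ hx₀Ω) _
  have e3 := abs_sub_le_maxGrad hC hv hT hx₀ hx
  have e4 := abs_le_maxVal hC hv hT hx
  have key : θ x * v x - (θ x₀ * v x +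
      (-(v x₀ * fderiv ℝ θ x₀ x₀) + (v x₀ • fderiv ℝ θ x₀) x)) =
      fderiv ℝ θ x₀ (x - x₀) * (v x - v x₀) +
        (θ x - θ x₀ - fderiv ℝ θ x₀ (x - x₀)) * v x := by
    simp only [smul_apply, smul_eq_mul, map_sub]
    ring
  rw [key]
  calc |fderiv ℝ θ x₀ (x - x₀) * (v x - v x₀) +
        (θ x - θ x₀ - fderiv ℝ θ x₀ (x - x₀)) * v x|
      ≤ (M * δ⁻¹ * cellDiam T) * (maxGrad C v T * cellDiam T) +
        (M * (δ ^ 2)⁻¹ * cellDiam T ^ 2) * maxVal C v T := by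
        refine (abs_add_le _ _).trans ?_
        rw [abs_mul, abs_mul]
        have e2' : |fderiv ℝ θ x₀ (x - x₀)| ≤ M * δ⁻¹ * cellDiam T := e2.trans (by gcongr)
        have e3' : |v x - v x₀| ≤ maxGrad C v T * cellDiam T := e3.trans (by gcongr)
        have e1' : |θ x - θ x₀ - fderiv ℝ θ x₀ (x - x₀)| ≤ M * (δ ^ 2)⁻¹ * cellDiam T ^ 2 :=
          e1.trans (by gcongr)
        gcongr
    _ = _ := by rw [cutoffError]; ring

/-- The lower-order terms in terms of the energy and the mass of `v`; the factor `δ⁻²` of the energy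
is absorbed into `δ⁻⁴` because `δ` is bounded by `R`. -/
lemma volume_mul_cutoffError_sq_le {C : ℝ} (hC : 0 < C) (M : ℝ) {δ R : ℝ} (hδ : 0 < δ) (hR : δ ≤ R)
    (v : Pt d → ℝ) {T : Finset (Pt d)} (hT : T ∈ 𝒯.elements) :
    volume.real (cell T) * cutoffError C M δ v T ^ 2 ≤
      2 * M ^ 2 * C * (R ^ 2 + 1) * (δ ^ 4)⁻¹ * (energySq v T + massSq v T) := by
  have h1 := volume_mul_maxGrad_sq hC v hT
  have h2 := volume_mul_maxVal_sq hC v hT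
  have hv := volume_cell_pos hT
  have hE := energySq_nonneg v T
  have hX := massSq_nonneg v T
  have h3 : cutoffError C M δ v T ^ 2 ≤
      2 * (M ^ 2 * (δ ^ 2)⁻¹ * maxGrad C v T ^ 2) + 2 * (M ^ 2 * (δ ^ 4)⁻¹ * maxVal C v T ^ 2) := by
    have h4 := add_sq_le (a := M * δ⁻¹ * maxGrad C v T) (b := M * (δ ^ 2)⁻¹ * maxVal C v T)
    rw [cutoffError]
    refine h4.trans (le_of_eq ?_)
    rw [show (δ ^ 4)⁻¹ = ((δ ^ 2)⁻¹) ^ 2 by rw [← inv_pow]; ring, ← inv_pow δ 2]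
    ring
  have h5 : (δ ^ 2)⁻¹ ≤ R ^ 2 * (δ ^ 4)⁻¹ := by
    rw [inv_le_iff_one_le_mul₀ (by positivity)]
    have : R ^ 2 * (δ ^ 4)⁻¹ * δ ^ 2 = R ^ 2 / δ ^ 2 := by field_simp
    rw [this, one_le_div (by positivity)]
    gcongr
  calc volume.real (cell T) * cutoffError C M δ v T ^ 2
      ≤ volume.real (cell T) * (2 * (M ^ 2 * (δ ^ 2)⁻¹ * maxGrad C v T ^ 2) +
        2 * (M ^ 2 * (δ ^ 4)⁻¹ * maxVal C v T ^ 2)) := by gcongr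
    _ = 2 * M ^ 2 * ((δ ^ 2)⁻¹ * (volume.real (cell T) * maxGrad C v T ^ 2) +
        (δ ^ 4)⁻¹ * (volume.real (cell T) * maxVal C v T ^ 2)) := by ring
    _ = 2 * M ^ 2 * C * ((δ ^ 2)⁻¹ * energySq v T + (δ ^ 4)⁻¹ * massSq v T) := by
        rw [h1, h2]; ring
    _ ≤ 2 * M ^ 2 * C * ((R ^ 2 * (δ ^ 4)⁻¹) * energySq v T + (δ ^ 4)⁻¹ * massSq v T) := by
        gcongr
    _ ≤ 2 * M ^ 2 * C * ((R ^ 2 * (δ ^ 4)⁻¹) * (energySq v T + massSq v T) +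
        (δ ^ 4)⁻¹ * (energySq v T + massSq v T)) := by
        gcongr
        · linarith
        · linarith
    _ = _ := by ring

end Triangulation

/-! ### Stability of the decomposition by cut-off and interpolation -/

/-- A sum of at most `N` nonzero terms, each bounded by `K`. -/
lemma sum_le_of_card_le {ι : Type*} [Fintype ι] {N : ℕ} {f : ι → ℝ} {p : ι → Prop}
    [DecidablePred p] (hp : (Finset.univ.filter p).card ≤ N) (hf : ∀ j, ¬ p j → f j = 0) {K : ℝ}
    (hK : 0 ≤ K) (hfK : ∀ j, f j ≤ K) : ∑ j, f j ≤ N * K := by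
  have h1 : ∑ j, f j = ∑ j with p j, f j := by
    rw [Finset.sum_filter]
    refine Finset.sum_congr rfl fun j _ => ?_
    split_ifs with h
    · rfl
    · exact hf j h
  rw [h1]
  refine (Finset.sum_le_card_nsmul _ _ K fun j _ => hfK j).trans ?_
  rw [nsmul_eq_mul]
  have h3 : ((Finset.univ.filter p).card : ℝ) ≤ N := by exact_mod_cast hp
  gcongr

lemma sq_le_of_abs_sub_mul_le {x y t K : ℝ} (ht0 : 0 ≤ t) (ht1 : t ≤ 1) (h : |x - t * y| ≤ K) :
    x ^ 2 ≤ 2 * y ^ 2 + 2 * K ^ 2 := by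
  have h1 : (x - t * y) ^ 2 ≤ K ^ 2 := sq_le_sq' (abs_le.1 h).1 (abs_le.1 h).2
  have h2 : (t * y) ^ 2 ≤ y ^ 2 := by
    rw [mul_pow]
    exact mul_le_of_le_one_left (sq_nonneg _) (pow_le_one₀ ht0 ht1)
  nlinarith [sq_nonneg (x - t * y - t * y)]

namespace Triangulation

variable {d : ℕ} {Ω : Set (Pt d)} {𝒯 : Triangulation Ω}

lemma norm_outwardNormal_eq_one (hd : 1 ≤ d) {e T : Finset (Pt d)} (he : e ∈ 𝒯.faces)
    (hT : T ∈ 𝒯.elementsAt e) : ‖outwardNormal T e‖ = 1 := by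
  obtain ⟨hTe, heT⟩ := mem_elementsAt.1 hT
  obtain ⟨p, hp, rfl⟩ := exists_eq_erase hTe he heT
  exact (isSimplex hTe).norm_outwardNormal hd hp

/-- The Laplacian of the interpolant of `θ v`: the affine part of the expansion of `θ v` does not
contribute. -/
lemma elemLaplacian_interp_sq_le (hd : 1 ≤ d) (hΩ_open : IsOpen Ω) (hΩ_convex : Convex ℝ Ω)
    {σ : ℝ} (h𝒯 : 𝒯.IsShapeRegular σ) {C : ℝ} (hC : 𝒯.InverseEstimate C) {v θ : Pt d → ℝ}
    (hv : v ∈ 𝒯.Vh) (hθ : ContDiffOn ℝ ∞ θ (closure Ω)) (hθ0 : ∀ x ∈ closure Ω, 0 ≤ θ x)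
    (hθ1 : ∀ x ∈ closure Ω, θ x ≤ 1) {M δ : ℝ}
    (h1 : ∀ x ∈ Ω, ‖fderiv ℝ θ x‖ ≤ M * δ⁻¹)
    (h2 : ∀ x ∈ Ω, ‖fderiv ℝ (fderiv ℝ θ) x‖ ≤ M * (δ ^ 2)⁻¹) {T : Finset (Pt d)}
    (hT : T ∈ 𝒯.elements) :
    𝒯.elemLaplacian (𝒯.interp fun x => θ x * v x) T ^ 2 ≤
      2 * 𝒯.elemLaplacian v T ^ 2 +
        2 * (6 * d * (d + 1) ^ 2 * σ ^ 2 * cutoffError C M δ v T) ^ 2 := by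
  obtain ⟨x₀, hx₀⟩ := (isSimplex hT).exists_mem_interior
  have hx₀T := interior_subset hx₀
  have hr := (isSimplex hT).cellDiam_pos hd
  have h3 := (interp_expansion hd h𝒯 hv hT (cutoff_mul_expansion hΩ_open hΩ_convex hC hv hθ h1 h2
    hT hx₀T (interior_cell_subset hΩ_open hΩ_convex hT hx₀))).1
  refine sq_le_of_abs_sub_mul_le (hθ0 x₀ (cell_subset_closure hT hx₀T))
    (hθ1 x₀ (cell_subset_closure hT hx₀T)) (h3.trans (le_of_eq ?_))
  field_simp

/-- The jumps of the interpolant of `θ v`: the affine part of the expansion of `θ v` at a point of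
the face is the same on both sides, so that it does not contribute. -/
lemma normalJump_interp_sq_le (hd : 1 ≤ d) (hΩ_open : IsOpen Ω) (hΩ_convex : Convex ℝ Ω)
    {σ : ℝ} (h𝒯 : 𝒯.IsShapeRegular σ) {C : ℝ} (hC : 𝒯.InverseEstimate C) {v θ : Pt d → ℝ}
    (hv : v ∈ 𝒯.Vh) (hθ : ContDiffOn ℝ ∞ θ (closure Ω)) (hθ0 : ∀ x ∈ closure Ω, 0 ≤ θ x)
    (hθ1 : ∀ x ∈ closure Ω, θ x ≤ 1) {M δ : ℝ}
    (h1 : ∀ x ∈ Ω, ‖fderiv ℝ θ x‖ ≤ M * δ⁻¹)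
    (h2 : ∀ x ∈ Ω, ‖fderiv ℝ (fderiv ℝ θ) x‖ ≤ M * (δ ^ 2)⁻¹) {e : Finset (Pt d)}
    (he : e ∈ 𝒯.interiorFaces) {x : Pt d} (hx : x ∈ cell e) :
    𝒯.normalJump (𝒯.interp fun x => θ x * v x) e x ^ 2 ≤
      2 * 𝒯.normalJump v e x ^ 2 + 4 * (6 * (d + 1) ^ 2 * σ) ^ 2 *
        ∑ T ∈ 𝒯.elementsAt e, cellDiam T ^ 2 * cutoffError C M δ v T ^ 2 := by
  obtain ⟨x₀, hx₀, hx₀Ω⟩ := exists_mem_cell_inter hΩ_open he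
  have hef := (mem_interiorFaces.1 he).1
  set w := 𝒯.interp fun x => θ x * v x with hw
  set t := θ x₀ with ht
  set l := v x₀ • fderiv ℝ θ x₀ with hl
  set c : ℝ := 6 * (d + 1) ^ 2 * σ with hc
  have h3 : ∀ T ∈ 𝒯.elementsAt e, |gradDot w T x (outwardNormal T e) -
      (t * gradDot v T x (outwardNormal T e) + l (outwardNormal T e))| ≤
      c * (cellDiam T * cutoffError C M δ v T) := by
    intro T hT
    obtain ⟨hTe, heT⟩ := mem_elementsAt.1 hT
    have hr := (isSimplex hTe).cellDiam_pos hd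
    have h4 := (interp_expansion hd h𝒯 hv hTe (cutoff_mul_expansion hΩ_open hΩ_convex hC hv hθ h1
      h2 hTe (cell_mono heT hx₀) hx₀Ω)).2 x (cell_mono heT hx) (outwardNormal T e)
    refine h4.trans (le_of_eq ?_)
    rw [norm_outwardNormal_eq_one hd hef hT, hc]
    field_simp
  -- the affine term is summed over the two sides of the face, where the normals add up to zero
  have h5 : 𝒯.normalJump w e x - t * 𝒯.normalJump v e x =
      -∑ T ∈ 𝒯.elementsAt e, (gradDot w T x (outwardNormal T e) -
      (t * gradDot v T x (outwardNormal T e) + l (outwardNormal T e))) := by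
    rw [Finset.sum_sub_distrib, Finset.sum_add_distrib, ← map_sum, sum_outwardNormal hd hΩ_open he,
      map_zero, ← Finset.mul_sum, normalJump, normalJump]
    ring
  have h6 : |𝒯.normalJump w e x - t * 𝒯.normalJump v e x| ≤
      ∑ T ∈ 𝒯.elementsAt e, c * (cellDiam T * cutoffError C M δ v T) := by
    rw [h5, abs_neg]
    exact (Finset.abs_sum_le_sum_abs _ _).trans (Finset.sum_le_sum h3)
  have h7 : (∑ T ∈ 𝒯.elementsAt e, c * (cellDiam T * cutoffError C M δ v T)) ^ 2 ≤
      2 * c ^ 2 * ∑ T ∈ 𝒯.elementsAt e, cellDiam T ^ 2 * cutoffError C M δ v T ^ 2 := by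
    refine sq_sum_le_card_mul_sum_sq.trans ?_
    simp only [mul_pow]
    rw [← Finset.mul_sum, mul_assoc]
    have h8 : ((𝒯.elementsAt e).card : ℝ) ≤ 2 := by exact_mod_cast card_elementsAt_le hd hef
    gcongr
  have h9 := sq_le_of_abs_sub_mul_le (hθ0 x₀ (subset_closure hx₀Ω)) (hθ1 x₀ (subset_closure hx₀Ω))
    h6
  linarith

/-- The integrated form of `normalJump_interp_sq_le`: the facet scaling turns the factor `h_T²` into
a volume. -/
lemma jumpSq_interp_le (hd : 1 ≤ d) (hΩ_open : IsOpen Ω) (hΩ_convex : Convex ℝ Ω)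
    {σ : ℝ} (h𝒯 : 𝒯.IsShapeRegular σ) {C₁ : ℝ} (hC₁ : 𝒯.FacetScaling C₁) {C : ℝ}
    (hC : 𝒯.InverseEstimate C) {v θ : Pt d → ℝ}
    (hv : v ∈ 𝒯.Vh) (hθ : ContDiffOn ℝ ∞ θ (closure Ω)) (hθ0 : ∀ x ∈ closure Ω, 0 ≤ θ x)
    (hθ1 : ∀ x ∈ closure Ω, θ x ≤ 1) {M δ : ℝ}
    (h1 : ∀ x ∈ Ω, ‖fderiv ℝ θ x‖ ≤ M * δ⁻¹)
    (h2 : ∀ x ∈ Ω, ‖fderiv ℝ (fderiv ℝ θ) x‖ ≤ M * (δ ^ 2)⁻¹) {e : Finset (Pt d)}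
    (he : e ∈ 𝒯.interiorFaces) :
    𝒯.jumpSq (𝒯.interp fun x => θ x * v x) e ≤
      2 * 𝒯.jumpSq v e + 4 * (6 * (d + 1) ^ 2 * σ) ^ 2 * C₁ *
        ∑ T ∈ 𝒯.elementsAt e, volume.real (cell T) * cutoffError C M δ v T ^ 2 := by
  have hef := (mem_interiorFaces.1 he).1
  obtain ⟨hf, hsc⟩ := hC₁.2 e hef
  have hfin : IsFiniteMeasure (surf e) := ⟨surf_lt_top hef⟩
  set w := 𝒯.interp fun x => θ x * v x with hw
  have hwV : w ∈ 𝒯.Vh := interp_mem_Vh hΩ_open hΩ_convex fun x hx => by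
    rw [hv.2.1 x hx, mul_zero]
  set c : ℝ := 4 * (6 * (d + 1) ^ 2 * σ) ^ 2 with hc
  set S := ∑ T ∈ 𝒯.elementsAt e, cellDiam T ^ 2 * cutoffError C M δ v T ^ 2 with hS
  have hint : ∀ u ∈ 𝒯.Vh, Integrable (fun x => 𝒯.normalJump u e x ^ 2) (surf e) := fun u hu =>
    integrable_surf hef ((continuousOn_normalJump hu e).pow 2)
  have h3 : ∫ x, 𝒯.normalJump w e x ^ 2 ∂(surf e) ≤
      2 * ∫ x, 𝒯.normalJump v e x ^ 2 ∂(surf e) + c * S * (surf e).real Set.univ := by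
    have h4 : ∫ x, 𝒯.normalJump w e x ^ 2 ∂(surf e) ≤
        ∫ x, (2 * 𝒯.normalJump v e x ^ 2 + c * S) ∂(surf e) := by
      refine integral_mono_ae (hint w hwV)
        (((hint v hv).const_mul 2).add (integrable_const (c * S))) ?_
      filter_upwards [ae_surf_mem e] with x hx
      exact normalJump_interp_sq_le hd hΩ_open hΩ_convex h𝒯 hC hv hθ hθ0 hθ1 h1 h2 he hx
    rw [integral_add ((hint v hv).const_mul 2) (integrable_const (c * S)), integral_const_mul,
      integral_const, smul_eq_mul] at h4
    linarith
  have h5 : (faceSize e)⁻¹ * (c * S * (surf e).real Set.univ) ≤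
      c * C₁ * ∑ T ∈ 𝒯.elementsAt e, volume.real (cell T) * cutoffError C M δ v T ^ 2 := by
    rw [hS, Finset.mul_sum, Finset.mul_sum, Finset.sum_mul, Finset.mul_sum]
    refine Finset.sum_le_sum fun T hT => ?_
    have h6 := (hsc T hT).2
    have h7 : 0 ≤ c * cutoffError C M δ v T ^ 2 := by positivity
    have h8 := mul_le_mul_of_nonneg_left h6 h7
    linarith
  have h6 := mul_le_mul_of_nonneg_left h3 (inv_nonneg.2 hf.le)
  rw [jumpSq, jumpSq]
  linarith

/-- The functions `θⱼ v`, interpolated in `V_h`, form a stable decomposition of `v`. -/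
theorem exists_stable_decomposition (hd : 2 ≤ d) (hΩ_open : IsOpen Ω) (hΩ_nonempty : Ω.Nonempty)
    (hΩ_bounded : Bornology.IsBounded Ω) (hΩ_convex : Convex ℝ Ω) {σ : ℝ} (hσ : 0 < σ) (M : ℝ)
    (Nc : ℕ) :
    ∃ C : ℝ, 0 < C ∧ ∀ 𝒯 : Triangulation Ω, 𝒯.IsShapeRegular σ →
      ∀ (J : ℕ) (D : Fin J → Set (Pt d)) (θ : Fin J → Pt d → ℝ) (δ : ℝ), 0 < δ →
      δ ≤ Metric.diam Ω → 𝒯.IsOverlappingDecomposition D θ δ M Nc →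
      ∀ v : 𝒯.Vh, ∃ w : Fin J → 𝒯.Vh, (∀ j, w j ∈ 𝒯.localSpace (D j)) ∧ ∑ j, w j = v ∧
        ∑ j, 𝒯.form (𝒯.localElements (D j)) (𝒯.localFaces (D j)) (w j) (w j) ≤
          C * (δ ^ 4)⁻¹ * 𝒯.form 𝒯.elements 𝒯.interiorFaces v v := by
  obtain ⟨C₁, hC₁, h₁⟩ := exists_facetScaling (Ω := Ω) hd hσ
  obtain ⟨C₂, hC₂, h₂⟩ := exists_inverseEstimate (Ω := Ω) (by omega : 1 ≤ d) hσ
  obtain ⟨C₃, hC₃, h₃⟩ := exists_coercivity hd hΩ_open hΩ_nonempty hΩ_bounded hΩ_convex hσ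
  set R := Metric.diam Ω with hR
  -- `a₁` and `a₂` are the constants for the Laplacian and for the jumps of the interpolant, `a₃` is
  -- the one of `volume_mul_cutoffError_sq_le`, and `N` bounds the number of subdomains that touch a
  -- face
  set a₁ : ℝ := 6 * d * (d + 1) ^ 2 * σ ^ 2 with ha₁
  set a₂ : ℝ := 4 * (6 * (d + 1) ^ 2 * σ) ^ 2 * C₁ with ha₂
  set a₃ : ℝ := 2 * M ^ 2 * C₂ * (R ^ 2 + 1) with ha₃
  set b : ℝ := 2 * a₁ ^ 2 + (d + 1) * a₂ with hb
  set N : ℝ := 2 * Nc + 1 with hN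
  have hN0 : 0 < N := by positivity
  have ha₂0 : 0 ≤ a₂ := by positivity
  have ha₃0 : 0 ≤ a₃ := by positivity
  have hb0 : 0 ≤ b := by positivity
  refine ⟨(2 + 4 * ((d + 1) * C₁)) * (N * ((2 * R ^ 4 + b * a₃ + 1) * C₃)), by positivity,
    fun 𝒯 h𝒯 J D θ δ hδ hδR hD v => ?_⟩
  have hd1 : 1 ≤ d := by omega
  have hIE := h₂ 𝒯 h𝒯
  have hFS := h₁ 𝒯 h𝒯
  have hal : ∀ j, 𝒯.IsAligned (D j) := hD.aligned
  set f : Fin J → Pt d → ℝ := fun j x => θ j x * (v : Pt d → ℝ) x with hf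
  have hf0 : ∀ j, ∀ x ∉ Ω, f j x = 0 := fun j x hx => by
    change θ j x * (v : Pt d → ℝ) x = 0
    rw [v.2.2.1 x hx, mul_zero]
  have hθ1 : ∀ j, ∀ x ∈ closure Ω, θ j x ≤ 1 := fun j x hx => by
    rw [← hD.sum_eq_one x hx]
    exact Finset.single_le_sum (f := fun j => θ j x) (fun i _ => hD.nonneg i x hx)
      (Finset.mem_univ j)
  have hfz : ∀ j, ∀ T ∈ 𝒯.elements, T ∉ 𝒯.localElements (D j) → ∀ x ∈ cell T, f j x = 0 :=
    fun j T hT hTD x hx => (hal j).eq_zero_of_mem_cell hd1 hΩ_open hΩ_convex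
      ((hD.smooth j).continuousOn.mul v.2.1.continuousOn)
      (fun y hy => mul_eq_zero_of_left (hD.eq_zero j y hy) _) hT hTD hx
  have hwz : ∀ j, ∀ T ∈ 𝒯.elements, T ∉ 𝒯.localElements (D j) → ∀ x ∈ cell T,
      𝒯.interp (f j) x = 0 := fun j T hT hTD x hx => by
    rw [interp_eq hT hx, (isSimplex hT).interp_congr (hfz j T hT hTD), (isSimplex hT).interp_zero]
  let w : Fin J → 𝒯.Vh := fun j => ⟨𝒯.interp (f j), interp_mem_Vh hΩ_open hΩ_convex (hf0 j)⟩
  have hw : ∀ j, ((w j : 𝒯.Vh) : Pt d → ℝ) = 𝒯.interp (f j) := fun _ => rfl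
  have hwD : ∀ j, w j ∈ 𝒯.localSpace (D j) := fun j x hx => by
    obtain ⟨T, hT, hTD, hxT⟩ := (hal j).exists_mem_cell hd1 hΩ_open hx
    exact hwz j T hT hTD x hxT
  refine ⟨w, hwD, ?_, ?_⟩
  · ext x
    rw [Submodule.coe_sum, Finset.sum_apply]
    by_cases hx : x ∈ Ω
    · obtain ⟨T, hT, hxT⟩ := exists_mem_cell (𝒯 := 𝒯) (subset_closure hx)
      calc ∑ j, (w j : Pt d → ℝ) x = ∑ j, (isSimplex hT).interp (f j) x :=
            Finset.sum_congr rfl fun j _ => by rw [hw, interp_eq hT hxT]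
        _ = (isSimplex hT).interp (v : Pt d → ℝ) x := by
            rw [← (isSimplex hT).interp_sum]
            refine (isSimplex hT).interp_congr (fun y hy => ?_) x
            simp only [hf]
            rw [← Finset.sum_mul, hD.sum_eq_one y (cell_subset_closure hT hy), one_mul]
        _ = _ := interp_self_of_mem_cell v.2 hT hxT
    · rw [v.2.2.1 x hx]
      exact Finset.sum_eq_zero fun j _ => (w j).2.2.1 x hx
  · set E : Finset (Pt d) → ℝ := fun T =>
      volume.real (cell T) * cutoffError C₂ M δ v T ^ 2 with hE
    have hE0 : ∀ T, 0 ≤ E T := fun T => mul_nonneg measureReal_nonneg (sq_nonneg _)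
    set P := ∑ T ∈ 𝒯.elements, volume.real (cell T) * 𝒯.elemLaplacian v T ^ 2 with hP
    set Q := ∑ e ∈ 𝒯.interiorFaces, 𝒯.jumpSq v e with hQ
    set X := ∑ T ∈ 𝒯.elements, (energySq v T + massSq v T) with hX
    set a := 𝒯.form 𝒯.elements 𝒯.interiorFaces v v with ha
    have hP0 : 0 ≤ P := Finset.sum_nonneg fun T _ => mul_nonneg measureReal_nonneg (sq_nonneg _)
    have hQ0 : 0 ≤ Q := Finset.sum_nonneg fun e _ => jumpSq_nonneg _ e
    have hX0 : 0 ≤ X := Finset.sum_nonneg fun T _ =>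
      add_nonneg (energySq_nonneg _ T) (massSq_nonneg _ T)
    have hcoer : P + X + Q ≤ C₃ * a := by
      refine le_trans (le_of_eq ?_) (h₃ 𝒯 h𝒯 v v.2)
      rw [hP, hX, ← Finset.sum_add_distrib]
      congr 1
      exact Finset.sum_congr rfl fun T _ => by ring
    have hL : ∀ T ∈ 𝒯.elements, ∑ j, volume.real (cell T) * 𝒯.elemLaplacian (w j) T ^ 2 ≤
        N * (2 * (volume.real (cell T) * 𝒯.elemLaplacian v T ^ 2) + 2 * a₁ ^ 2 * E T) := by
      intro T hT
      have hvol := volume_cell_pos hT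
      have hK : 0 ≤ 2 * (volume.real (cell T) * 𝒯.elemLaplacian v T ^ 2) + 2 * a₁ ^ 2 * E T := by
        have := hE0 T
        positivity
      refine (sum_le_of_card_le (card_localElements_le hd1 hΩ_open hΩ_convex hal hD.overlap hT)
        (fun j hj => ?_) hK fun j => ?_).trans ?_
      · rw [elemLaplacian_eq_zero hd1 hT (hwz j T hT hj)]
        ring
      · have h4 := elemLaplacian_interp_sq_le hd1 hΩ_open hΩ_convex h𝒯 hIE v.2 (hD.smooth j)
          (hD.nonneg j) (hθ1 j) (hD.grad_le j) (hD.hessian_le j) hT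
        have h5 := mul_le_mul_of_nonneg_left h4 hvol.le
        refine h5.trans (le_of_eq ?_)
        rw [← ha₁, hE]
        ring
      · refine mul_le_mul_of_nonneg_right ?_ hK
        rw [hN]
        have : (0 : ℝ) ≤ Nc := Nat.cast_nonneg _
        linarith
    have hJ : ∀ e ∈ 𝒯.interiorFaces, ∑ j, 𝒯.jumpSq (w j) e ≤
        N * (2 * 𝒯.jumpSq v e + a₂ * ∑ T ∈ 𝒯.elementsAt e, E T) := by
      intro e he
      have hef := (mem_interiorFaces.1 he).1
      have hK : 0 ≤ 2 * 𝒯.jumpSq v e + a₂ * ∑ T ∈ 𝒯.elementsAt e, E T := by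
        have h4 := jumpSq_nonneg (𝒯 := 𝒯) (v : Pt d → ℝ) e
        have h5 : 0 ≤ ∑ T ∈ 𝒯.elementsAt e, E T := Finset.sum_nonneg fun T _ => hE0 T
        positivity
      refine (sum_le_of_card_le (card_elementsAt_localElements_le hd1 hΩ_open hΩ_convex hal
        hD.overlap hef) (fun j hj => ?_) hK fun j => ?_).trans ?_
      · push Not at hj
        exact jumpSq_eq_zero fun T hT => hwz j T (mem_elementsAt.1 hT).1 (hj T hT)
      · exact jumpSq_interp_le hd1 hΩ_open hΩ_convex h𝒯 hFS hIE v.2 (hD.smooth j)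
          (hD.nonneg j) (hθ1 j) (hD.grad_le j) (hD.hessian_le j) he
      · refine mul_le_mul_of_nonneg_right ?_ hK
        push_cast
        rw [hN]
        linarith
    have hEsum : ∑ T ∈ 𝒯.elements, E T ≤ a₃ * (δ ^ 4)⁻¹ * X := by
      rw [hX, Finset.mul_sum]
      refine Finset.sum_le_sum fun T hT => ?_
      have h4 := volume_mul_cutoffError_sq_le (𝒯 := 𝒯) hC₂ M hδ hδR (v : Pt d → ℝ) hT
      rw [← ha₃] at h4
      exact h4
    have hEface : ∑ e ∈ 𝒯.interiorFaces, ∑ T ∈ 𝒯.elementsAt e, E T ≤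
        (d + 1) * ∑ T ∈ 𝒯.elements, E T := by
      refine (Finset.sum_le_sum_of_subset_of_nonneg 𝒯.interiorFaces_subset fun e _ _ =>
        Finset.sum_nonneg fun T _ => hE0 T).trans (le_of_eq ?_)
      rw [← sum_elements_facesOf (F := fun T _ => E T), Finset.mul_sum]
      refine Finset.sum_congr rfl fun T hT => ?_
      rw [Finset.sum_const, nsmul_eq_mul, card_facesOf hd1 hT]
    -- the terms without a negative power of `δ` are absorbed because `δ ≤ diam Ω`
    have hδ4 : 1 ≤ R ^ 4 * (δ ^ 4)⁻¹ := by
      rw [← div_eq_mul_inv, one_le_div (by positivity)]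
      gcongr
    have hinv : 0 < (δ ^ 4)⁻¹ := by positivity
    calc ∑ j, 𝒯.form (𝒯.localElements (D j)) (𝒯.localFaces (D j)) (w j) (w j)
        ≤ ∑ j, (2 + 4 * ((d + 1) * C₁)) *
          (∑ T ∈ 𝒯.elements, volume.real (cell T) * 𝒯.elemLaplacian (w j) T ^ 2 +
            ∑ e ∈ 𝒯.interiorFaces, 𝒯.jumpSq (w j) e) :=
          Finset.sum_le_sum fun j _ => (form_local_le (D j) (w j)).trans
            (form_le_sum hd1 hΩ_open hΩ_convex hFS (w j).2)
      _ = (2 + 4 * ((d + 1) * C₁)) *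
          (∑ T ∈ 𝒯.elements, ∑ j, volume.real (cell T) * 𝒯.elemLaplacian (w j) T ^ 2 +
            ∑ e ∈ 𝒯.interiorFaces, ∑ j, 𝒯.jumpSq (w j) e) := by
          rw [← Finset.mul_sum, Finset.sum_add_distrib, Finset.sum_comm,
            Finset.sum_comm (t := 𝒯.interiorFaces)]
      _ ≤ (2 + 4 * ((d + 1) * C₁)) *
          (∑ T ∈ 𝒯.elements,
            N * (2 * (volume.real (cell T) * 𝒯.elemLaplacian v T ^ 2) + 2 * a₁ ^ 2 * E T) +
          ∑ e ∈ 𝒯.interiorFaces, N * (2 * 𝒯.jumpSq v e + a₂ * ∑ T ∈ 𝒯.elementsAt e, E T)) := by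
          have h4 := Finset.sum_le_sum hL
          have h5 := Finset.sum_le_sum hJ
          gcongr
      _ = (2 + 4 * ((d + 1) * C₁)) * (N * (2 * P + 2 * Q + (2 * a₁ ^ 2 * ∑ T ∈ 𝒯.elements, E T +
          a₂ * ∑ e ∈ 𝒯.interiorFaces, ∑ T ∈ 𝒯.elementsAt e, E T))) := by
          rw [← Finset.mul_sum, ← Finset.mul_sum, Finset.sum_add_distrib, Finset.sum_add_distrib,
            ← Finset.mul_sum, ← Finset.mul_sum, ← Finset.mul_sum, ← Finset.mul_sum]
          ring
      _ ≤ (2 + 4 * ((d + 1) * C₁)) * (N * ((2 * R ^ 4 + b * a₃ + 1) * (δ ^ 4)⁻¹ *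
          (P + X + Q))) := by
          refine mul_le_mul_of_nonneg_left (mul_le_mul_of_nonneg_left ?_ hN0.le) (by positivity)
          have h4 : 2 * a₁ ^ 2 * ∑ T ∈ 𝒯.elements, E T +
              a₂ * ∑ e ∈ 𝒯.interiorFaces, ∑ T ∈ 𝒯.elementsAt e, E T ≤
              b * a₃ * (δ ^ 4)⁻¹ * X := by
            have h5 := mul_le_mul_of_nonneg_left hEface ha₂0
            have h6 := mul_le_mul_of_nonneg_left hEsum hb0
            rw [hb] at h6 ⊢
            linarith
          have h7 : 2 * P + 2 * Q ≤ 2 * (R ^ 4 * (δ ^ 4)⁻¹) * (P + Q) := by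
            have := mul_le_mul_of_nonneg_right hδ4 (add_nonneg hP0 hQ0)
            linarith
          have h8 : 0 ≤ R ^ 4 * (δ ^ 4)⁻¹ * X := by positivity
          have h9 : 0 ≤ b * a₃ * (δ ^ 4)⁻¹ * (P + Q) := by positivity
          have h10 : 0 ≤ (δ ^ 4)⁻¹ * (P + X + Q) := by positivity
          linarith
      _ ≤ (2 + 4 * ((d + 1) * C₁)) * (N * ((2 * R ^ 4 + b * a₃ + 1) * (δ ^ 4)⁻¹ *
          (C₃ * a))) := by gcongr
      _ = _ := by ring

end Triangulation

/-! ### Additive Schwarz preconditioners -/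

lemma apply_linearInverse {V W : Type*} [AddCommMonoid V] [Module ℝ V] [AddCommMonoid W]
    [Module ℝ W] {f : V →ₗ[ℝ] W} (hf : Function.Bijective f) (y : W) :
    f (linearInverse f y) = y := by
  rw [linearInverse, dif_pos hf]
  exact (LinearEquiv.ofBijective f hf).apply_symm_apply y

section abstractSchwarz

variable {V : Type*} [AddCommGroup V] [Module ℝ V] [FiniteDimensional ℝ V]

/-- A map to the dual space that comes from a positive definite form is bijective. -/
lemma bijective_of_pos {a : V →ₗ[ℝ] Module.Dual ℝ V} (ha : ∀ v, v ≠ 0 → 0 < a v v) :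
    Function.Bijective a := by
  have hinj : Function.Injective a := by
    rw [injective_iff_map_eq_zero]
    intro v hv
    by_contra h
    have := ha v h
    rw [hv] at this
    simp at this
  exact ⟨hinj, (LinearMap.injective_iff_surjective_of_finrank_eq_finrank
    Subspace.dual_finrank_eq.symm).1 hinj⟩

/-- An operator that is symmetric with respect to a positive definite form has a real
eigenvalue. -/
lemma exists_hasEigenvalue_of_symmetric [Nontrivial V] {a : V →ₗ[ℝ] Module.Dual ℝ V}
    (hsymm : ∀ v w, a v w = a w v) (ha : ∀ v, v ≠ 0 → 0 < a v v) {P : Module.End ℝ V}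
    (hP : ∀ v w, a (P v) w = a v (P w)) : ∃ μ : ℝ, P.HasEigenvalue μ := by
  -- the form is an inner product, for which the operator is symmetric
  let core : InnerProductSpace.Core ℝ V :=
    { inner := fun v w => a v w
      conj_inner_symm := fun v w => hsymm w v
      re_inner_nonneg := fun v => by
        by_cases hv : v = 0
        · simp [hv]
        · exact (ha v hv).le
      add_left := fun u v w => by simp
      smul_left := fun u v r => by simp
      definite := fun v hv => by
        by_contra h
        exact (ha v h).ne' hv }
  let _ : NormedAddCommGroup V := core.toNormedAddCommGroup
  let _ : InnerProductSpace ℝ V := InnerProductSpace.ofCore core.toCore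
  have hs : P.IsSymmetric := fun v w => hP v w
  exact ⟨_, hs.hasEigenvalue_iSup_of_finiteDimensional⟩

variable {J : ℕ} {W : Fin J → Submodule ℝ V} {a : V →ₗ[ℝ] Module.Dual ℝ V}
  {b : (j : Fin J) → W j →ₗ[ℝ] Module.Dual ℝ (W j)}

/-- The eigenvalue bounds for an additive Schwarz preconditioner: the upper bound follows from the
boundedness of sums of local functions, and the lower bound from the existence of stable
decompositions. -/
theorem exists_extreme_eigenvalues [Nontrivial V] (hsymm : ∀ v w, a v w = a w v)
    (ha : ∀ v, v ≠ 0 → 0 < a v v) (hbsymm : ∀ j v w, b j v w = b j w v)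
    (hb : ∀ j v, v ≠ 0 → 0 < b j v v) {C₁ C₂ : ℝ} (hC₁ : 0 < C₁) (hC₂ : 0 < C₂)
    (h₁ : ∀ w : (j : Fin J) → W j,
      a (∑ j, (w j : V)) (∑ j, (w j : V)) ≤ C₁ * ∑ j, b j (w j) (w j))
    (h₂ : ∀ v, ∃ w : (j : Fin J) → W j, ∑ j, (w j : V) = v ∧ ∑ j, b j (w j) (w j) ≤ C₂ * a v v)
    {P : Module.End ℝ V}
    (hP : P = (∑ j, (W j).subtype ∘ₗ linearInverse (b j) ∘ₗ (W j).subtype.dualMap) ∘ₗ a) :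
    ∃ lmin lmax : ℝ, IsLeast {μ : ℝ | P.HasEigenvalue μ} lmin ∧
      IsGreatest {μ : ℝ | P.HasEigenvalue μ} lmax ∧ 0 < lmin ∧ lmax / lmin ≤ C₁ * C₂ := by
  have hbij : ∀ j, Function.Bijective (b j) := fun j => bijective_of_pos (hb j)
  set p : (j : Fin J) → V → W j := fun j v =>
    linearInverse (b j) ((W j).subtype.dualMap (a v)) with hp
  have hp' : ∀ j v u, b j (p j v) u = a v u := fun j v u => by
    rw [hp, apply_linearInverse (hbij j)]
    rfl
  have hPv : ∀ v, P v = ∑ j, (p j v : V) := fun v => by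
    rw [hP]
    simp [hp]
  -- `p j` is the Ritz projection onto the `j`-th subspace with respect to the forms `a` and `b j`
  have hPa : ∀ v w, a (P v) w = ∑ j, b j (p j w) (p j v) := fun v w => by
    rw [hsymm, hPv, map_sum]
    exact Finset.sum_congr rfl fun j _ => (hp' j w _).symm
  have hPs : ∀ v w, a (P v) w = a v (P w) := fun v w => by
    rw [hPa, hsymm v, hPa]
    exact Finset.sum_congr rfl fun j _ => hbsymm j _ _
  have hb0 : ∀ j v, 0 ≤ b j v v := fun j v => by
    by_cases hv : v = 0
    · simp [hv]
    · exact (hb j v hv).le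
  have hupper : ∀ μ, P.HasEigenvalue μ → μ ≤ C₁ := by
    intro μ hμ
    obtain ⟨v, hv⟩ := hμ.exists_hasEigenvector
    have hav := ha v hv.2
    have h3 := h₁ fun j => p j v
    rw [← hPv, ← hPa, hv.apply_eq_smul] at h3
    simp only [map_smul, LinearMap.smul_apply, smul_eq_mul] at h3
    by_contra! hlt
    have hμ0 : 0 < μ := hC₁.trans hlt
    have h4 : C₁ * (μ * a v v) < μ * (μ * a v v) :=
      mul_lt_mul_of_pos_right hlt (mul_pos hμ0 hav)
    linarith
  have hlower : ∀ μ, P.HasEigenvalue μ → C₂⁻¹ ≤ μ := by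
    intro μ hμ
    obtain ⟨v, hv⟩ := hμ.exists_hasEigenvector
    have hav := ha v hv.2
    obtain ⟨w, hw, hwle⟩ := h₂ v
    have h3 : a v v = ∑ j, b j (p j v) (w j) := by
      calc a v v = a v (∑ j, (w j : V)) := by rw [hw]
        _ = _ := by
          rw [map_sum]
          exact Finset.sum_congr rfl fun j _ => (hp' j v _).symm
    have h4 : μ * a v v = ∑ j, b j (p j v) (p j v) := by
      rw [← hPa, hv.apply_eq_smul, map_smul, LinearMap.smul_apply, smul_eq_mul]
    -- Young's inequality for the local forms
    have h5 : ∀ j, 2 * b j (p j v) (w j) ≤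
        C₂ * b j (p j v) (p j v) + C₂⁻¹ * b j (w j) (w j) := by
      intro j
      have h6 := hb0 j (C₂ • p j v - w j)
      simp only [map_sub, map_smul, LinearMap.sub_apply, LinearMap.smul_apply, smul_eq_mul] at h6
      rw [hbsymm j (w j) (p j v)] at h6
      set x := b j (p j v) (p j v)
      set y := b j (p j v) (w j)
      set z := b j (w j) (w j)
      have h7 := mul_nonneg (inv_nonneg.2 hC₂.le) h6
      have h8 : C₂⁻¹ * (C₂ * (C₂ * x - y) - (C₂ * y - z)) = C₂ * x - 2 * y + C₂⁻¹ * z := by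
        field_simp
        ring
      linarith
    have h6 := Finset.sum_le_sum fun j (_ : j ∈ Finset.univ) => h5 j
    rw [← Finset.mul_sum, Finset.sum_add_distrib, ← Finset.mul_sum, ← Finset.mul_sum, ← h3,
      ← h4] at h6
    have h7 : C₂⁻¹ * ∑ j, b j (w j) (w j) ≤ a v v := by
      rw [inv_mul_le_iff₀ hC₂]
      exact hwle
    have h8 : 1 * a v v ≤ (C₂ * μ) * a v v := by linarith
    rw [inv_le_iff_one_le_mul₀' hC₂]
    exact le_of_mul_le_mul_right h8 hav
  have hfin : {μ : ℝ | P.HasEigenvalue μ}.Finite := Module.End.finite_hasEigenvalue P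
  have hne : {μ : ℝ | P.HasEigenvalue μ}.Nonempty := exists_hasEigenvalue_of_symmetric hsymm ha hPs
  obtain ⟨lmin, hmin, hmin'⟩ := Set.exists_min_image _ id hfin hne
  obtain ⟨lmax, hmax, hmax'⟩ := Set.exists_max_image _ id hfin hne
  have hpos : 0 < lmin := (inv_pos.2 hC₂).trans_le (hlower _ hmin)
  refine ⟨lmin, lmax, ⟨hmin, hmin'⟩, ⟨hmax, hmax'⟩, hpos, ?_⟩
  rw [div_le_iff₀ hpos]
  have h3 : 1 ≤ C₂ * lmin := (inv_le_iff_one_le_mul₀' hC₂).1 (hlower _ hmin)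
  calc lmax ≤ C₁ := hupper _ hmax
    _ ≤ C₁ * (C₂ * lmin) := le_mul_of_one_le_right hC₁.le h3
    _ = _ := by ring

end abstractSchwarz

namespace Triangulation

variable {d : ℕ} {Ω : Set (Pt d)} {𝒯 : Triangulation Ω}

/-- The form `a_w` is positive definite. -/
lemma form_pos (hd : 2 ≤ d) (hΩ_open : IsOpen Ω) (hΩ_nonempty : Ω.Nonempty)
    (hΩ_bounded : Bornology.IsBounded Ω) (hΩ_convex : Convex ℝ Ω) {σ : ℝ}
    (h𝒯 : 𝒯.IsShapeRegular σ) {v : 𝒯.Vh} (hv : v ≠ 0) :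
    0 < 𝒯.form 𝒯.elements 𝒯.interiorFaces v v := by
  obtain ⟨C₂, hC₂, h₂⟩ := exists_inverseEstimate (Ω := Ω) (by omega : 1 ≤ d) h𝒯.1
  obtain ⟨C₃, hC₃, h₃⟩ := exists_coercivity hd hΩ_open hΩ_nonempty hΩ_bounded hΩ_convex h𝒯.1
  by_contra! hle
  refine hv (Subtype.ext (funext fun x => ?_))
  by_cases hx : x ∈ Ω
  · obtain ⟨T, hT, hxT⟩ := exists_mem_cell (𝒯 := 𝒯) (subset_closure hx)
    have h1 := h₃ 𝒯 h𝒯 v v.2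
    have h2 : 0 ≤ ∑ e ∈ 𝒯.interiorFaces, 𝒯.jumpSq v e :=
      Finset.sum_nonneg fun e _ => jumpSq_nonneg _ e
    have hnn : ∀ S, 0 ≤ volume.real (cell S) * 𝒯.elemLaplacian v S ^ 2 + energySq v S := fun S =>
      add_nonneg (mul_nonneg measureReal_nonneg (sq_nonneg _)) (energySq_nonneg _ S)
    have h3 := Finset.single_le_sum (f := fun S => volume.real (cell S) *
      𝒯.elemLaplacian v S ^ 2 + energySq v S + massSq v S)
      (fun S _ => add_nonneg (hnn S) (massSq_nonneg _ S)) hT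
    have h4 : massSq (v : Pt d → ℝ) T ≤ 0 := by
      have h5 := hnn T
      have h6 := mul_le_mul_of_nonneg_left hle hC₃.le
      linarith
    have h5 := volume_mul_sq_le (h₂ 𝒯 h𝒯) v.2 hT hxT
    have h6 := mul_le_mul_of_nonneg_left h4 hC₂.le
    have h7 := volume_cell_pos hT
    have h8 : (v : Pt d → ℝ) x ^ 2 ≤ 0 := by
      refine le_of_mul_le_mul_left ?_ h7
      linarith
    exact pow_eq_zero_iff (two_ne_zero) |>.1 (le_antisymm h8 (sq_nonneg _))
  · exact v.2.2.1 x hx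

/-- The local forms are positive definite. -/
lemma localForm_pos (hd : 2 ≤ d) (hΩ_open : IsOpen Ω) (hΩ_nonempty : Ω.Nonempty)
    (hΩ_bounded : Bornology.IsBounded Ω) (hΩ_convex : Convex ℝ Ω) {σ : ℝ}
    (h𝒯 : 𝒯.IsShapeRegular σ) {D : Set (Pt d)} (hD : 𝒯.IsAligned D) {v : 𝒯.localSpace D}
    (hv : v ≠ 0) : 0 < 𝒯.localOp D v v := by
  obtain ⟨C, hC, h⟩ := exists_facetScaling (Ω := Ω) hd h𝒯.1
  have h1 := form_pos hd hΩ_open hΩ_nonempty hΩ_bounded hΩ_convex h𝒯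
    (v := (v : 𝒯.Vh)) (fun h => hv (Subtype.ext h))
  have h2 := hD.form_le (by omega) hΩ_open hΩ_convex (h 𝒯 h𝒯) (v : 𝒯.Vh).2 v.2
  have h3 : 0 < 1 + 8 * ((d + 1) * C) := by positivity
  exact pos_of_mul_pos_right (h1.trans_le h2) h3.le

end Triangulation

end C0WG

end

theorem mainTheorem3 (d : ℕ) (hd : d = 2 ∨ d = 3) (Ω : Set (C0WG.Pt d)) (hΩ_open : IsOpen Ω)
    (hΩ_nonempty : Ω.Nonempty) (hΩ_bounded : Bornology.IsBounded Ω) (hΩ_convex : Convex ℝ Ω)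
    (σ M : ℝ) (Nc : ℕ) :
    ∃ C : ℝ, 0 < C ∧
      ∀ 𝒯 : C0WG.Triangulation Ω, 𝒯.IsShapeRegular σ →
      ∀ (J : ℕ) (D : Fin J → Set (C0WG.Pt d)) (θ : Fin J → C0WG.Pt d → ℝ) (δ : ℝ),
        0 < δ → δ ≤ Metric.diam Ω → 𝒯.IsOverlappingDecomposition D θ δ M Nc →
        (∀ j, Function.Bijective (𝒯.localOp (D j))) ∧
        (Nontrivial 𝒯.Vh →
          ∃ lmin lmax : ℝ,
            IsLeast {μ : ℝ | (𝒯.preconditioned D).HasEigenvalue μ} lmin ∧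
            IsGreatest {μ : ℝ | (𝒯.preconditioned D).HasEigenvalue μ} lmax ∧
            0 < lmin ∧ lmax / lmin ≤ C * (δ ^ 4)⁻¹) := by
  have hd2 : 2 ≤ d := by omega
  by_cases hσ : 0 < σ
  · obtain ⟨C₁, hC₁, h₁⟩ := C0WG.Triangulation.exists_form_sum_le hd2 hΩ_open hΩ_nonempty
      hΩ_bounded hΩ_convex hσ Nc
    obtain ⟨C₂, hC₂, h₂⟩ := C0WG.Triangulation.exists_stable_decomposition hd2 hΩ_open
      hΩ_nonempty hΩ_bounded hΩ_convex hσ M Nc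
    refine ⟨C₁ * C₂, by positivity, fun 𝒯 h𝒯 J D θ δ hδ hδR hD => ?_⟩
    have hpos : ∀ j, ∀ v : 𝒯.localSpace (D j), v ≠ 0 → 0 < 𝒯.localOp (D j) v v := fun j v hv =>
      C0WG.Triangulation.localForm_pos hd2 hΩ_open hΩ_nonempty hΩ_bounded hΩ_convex h𝒯
        (hD.aligned j) hv
    have hbij : ∀ j, Function.Bijective (𝒯.localOp (D j)) := fun j => by
      have h := C0WG.bijective_of_pos (V := 𝒯.localSpace (D j)) (a := 𝒯.localOp (D j)) (hpos j)
      exact h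
    refine ⟨hbij, fun _ => ?_⟩
    rw [mul_assoc]
    refine C0WG.exists_extreme_eigenvalues (a := 𝒯.globalOp) (b := fun j => 𝒯.localOp (D j))
      (fun v w => C0WG.Triangulation.form_comm _ _ _ _)
      (fun v hv => C0WG.Triangulation.form_pos hd2 hΩ_open hΩ_nonempty hΩ_bounded hΩ_convex h𝒯 hv)
      (fun j v w => C0WG.Triangulation.form_comm _ _ _ _) hpos hC₁ (by positivity)
      (fun w => h₁ 𝒯 h𝒯 J D hD.aligned hD.overlap (fun j => w j) fun j => (w j).2)
      (fun v => ?_) rfl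
    obtain ⟨w, hwD, hw, hle⟩ := h₂ 𝒯 h𝒯 J D θ δ hδ hδR hD v
    exact ⟨fun j => ⟨w j, hwD j⟩, hw, hle⟩
  -- a triangulation that is shape regular with parameter `σ` exists only for `σ > 0`
  · exact ⟨1, one_pos, fun 𝒯 h𝒯 => absurd h𝒯.1 hσ⟩
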